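/- Let $\mathcal O$ be a complete discrete valuation ring of characteristic $0$ whose residue field $k$ has characteristic $p>0$. Let $\omega:G\to\Gamma$ and $\omega':G'\to\Gamma$ be epimorphisms of finite groups with kernels $N$ and $N'$, and let $\ddot G=\{(g,g')\in G\times G'\mid \omega(g)=\omega'(g')\}$. Let $b$ be a $G$-invariant block of $\mathcal ON$ and $b'$ a $G'$-invariant block of $\mathcal ON'$; put $A=\mathcal OGb$ and $A'=\mathcal OG'b'$, with their $\Gamma$-gradings, so that $A_1=\mathcal ONb$ and $A_1'=\mathcal ON'b'$. Let $M$ be a finitely generated $\mathcal O\ddot G$-module that is indecomposable as an $\mathcal O(N\times N')$-module, associated with $b\otimes (b')^\circ$, and projective over $\mathcal O(N\times 1)$ and over $\mathcal O(1\times N')$. Let $\ddot P\le\ddot G$ be a vertex of $M$, $\ddot N$ an $\mathcal O\ddot P$-source of $M$, $S=\operatorname{End}_{\mathcal O}(\ddot N)$, and let $\sigma:\ddot P\to P\le G$ and $\sigma':\ddot P\to P'\le G'$ be the projections onto their images. Assume that $\ddot M=\operatorname{Ind}_{\ddot G}^{G\times G'}(M)$ determines a basic graded Morita equivalence between $A$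 and $A'$, that is, $\ddot M$ induces a $\Gamma$-graded Morita equivalence and $S$ is a Dade $\ddot P$-algebra. Let $\gamma$ be a local point of $P$ on $A_1$ and $\gamma'$ a local point of $P'$ on $A'_1$, let $i\in\gamma$, $i'\in\gamma'$, $A_\gamma=iAi$, $A'_{\gamma'}=i'A'i'$, and let $f:A_\gamma\to S\otimes_{\mathcal O}A'_{\gamma'}$ be an embedding of $\Gamma$-graded $\mathcal O\ddot P$-interior algebras (with respect to $\sigma$ and $\sigma'$). Let $Q\le P$, $\ddot Q=\sigma^{-1}(Q)$, $Q'=\sigma'(\ddot Q)$. Let $\delta$ be a local point of $Q$ on $A_1$, $\delta'$ a local point of $Q'$ on $A_1'$, and $\ddot\delta$ the local point of $\ddot Q$ on $S$, and assume that $Q_\delta\le P_\gamma$ and $Q'_{\delta'}\le P'_{\gamma'}$ correspond through $f$: for some $j_0\in\delta\cap A_\gamma$, $l_0\in\ddot\delta$ and $j_0'\in\delta'\cap A'_{\gamma'}$, the idempotent $f(j_0)$ is conjugate, by a unit of $(S\otimes \mathcal ON')^{\ddot Q}$, to an idempotent $e$ with $e(l_0\otimes j_0')=e=(l_0\otimes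 j_0')e$. Let $j\in\delta$, $j'\in\delta'$, $l\in\ddot\delta$, $A_\delta=jAj$, $A'_{\delta'}=j'A'j'$, $S_{\ddot\delta}=lSl$. Put $\operatorname{Aut}^\Gamma(Q)=\{\varphi\in\operatorname{Aut}(Q)\mid\varphi(u)\in uN\text{ for all }u\in Q\}$. Let $N_G^K(Q_\delta)$ be the group of all $g\in N_G(Q)$ that stabilize $\delta$ and induce by conjugation an element of $K=\operatorname{Aut}^\Gamma(Q)$ on $Q$. Let $F^\Gamma_{A_\gamma}(Q_\delta)$ be the group, under componentwise multiplication, of all pairs $(\varphi,x)\in\operatorname{Aut}^\Gamma(Q)\times\Gamma$ such that there is a $\Gamma$-graded $(i\mathcal OGi,\mathcal OQ)$-bimodule isomorphism $(i\mathcal OGj)_\varphi\simeq i\mathcal OGj$ that is homogeneous of degree $x$; here $u\in Q$ acts on the right of $(i\mathcal OGj)_\varphi$ as multiplication by $\varphi(u)$. Thus a $(G,\Gamma)$-fusion is an automorphism $\varphi$ recorded together with the degree $x$ of an isomorphism realizing it. Define $F^\Gamma_{A'_{\gamma'}}(Q'_{\delta'})$ likewise. Let $F_S(\ddot Q_{\ddot\delta})$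 be the group of all $\varphi\in\operatorname{Aut}(\ddot Q)$ such that for some $s\in S^\times$ one has $s(ul)s^{-1}=\varphi(u)l$ for all $u\in\ddot Q$. Then the following hold. 1) $C_N(Q)\le N_G^K(Q_\delta)$, and $g\mapsto\big((u\mapsto gug^{-1}),\,\omega(g)\big)$ induces a group isomorphism $$N_G^K(Q_\delta)/C_N(Q)\simeq F^\Gamma_{A_\gamma}(Q_\delta).$$ 2) There is an embedding $A_\delta\to S_{\ddot\delta}\otimes_{\mathcal O}A'_{\delta'}$ of $\Gamma$-graded $\mathcal O\ddot Q$-interior algebras. The maps $\sigma$ and $\sigma'$ restrict to isomorphisms $\ddot Q\simeq Q$ and $\ddot Q\simeq Q'$. Identifying $Q$, $Q'$ and $\ddot Q$ through them, every $(\varphi,x)\in F^\Gamma_{A_\gamma}(Q_\delta)$ satisfies $\varphi\in F_S(\ddot Q_{\ddot\delta})$, and $$F^\Gamma_{A_\gamma}(Q_\delta)=F^\Gamma_{A'_{\gamma'}}(Q'_{\delta'}).$$ In particular the sets of underlying automorphisms $\varphi$ of these two groups also coincide. -/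

import Mathlib

open scoped TensorProduct

noncomputable section

/-! ## Interior algebras, pointed groups, corners -/

section Interior

variable {O B C G Γ : Type*} [CommRing O] [Ring B] [Algebra O B] [Ring C] [Algebra O C]
  [Group G] [Group Γ]

/-- For a `G`-interior algebra `B` (structural map `θ : G → Bˣ`, so that `G` acts by conjugation) and
a `G`-stable submodule `B₁`, the submodule `B₁ ^ H` of elements fixed by the subgroup `H`. -/
def fixedPts (θ : G →* Bˣ) (B₁ : Submodule O B) (H : Subgroup G) : Submodule O B where
  carrier := {a | a ∈ B₁ ∧ ∀ h ∈ H, (θ h : B) * a = a * θ h}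
  zero_mem' := ⟨B₁.zero_mem, by simp⟩
  add_mem' := fun ha hb => ⟨B₁.add_mem ha.1 hb.1, fun h hh => by
    rw [mul_add, add_mul, ha.2 h hh, hb.2 h hh]⟩
  smul_mem' := fun c a ha => ⟨B₁.smul_mem c ha.1, fun h hh => by
    rw [mul_smul_comm, smul_mul_assoc, ha.2 h hh]⟩

/-- `i` is a primitive idempotent of the (multiplicatively closed) submodule `Z`. -/
def IsPrimitiveIdempotentIn (Z : Submodule O B) (i : B) : Prop :=
  i ∈ Z ∧ i * i = i ∧ i ≠ 0 ∧
    ∀ e ∈ Z, e * e = e → i * e = e → e * i = e → e = 0 ∨ e = i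

/-- `a` and `c` are conjugate by a unit of `B₁ ^ H`. -/
def FixedConj (θ : G →* Bˣ) (B₁ : Submodule O B) (H : Subgroup G) (a c : B) : Prop :=
  ∃ w : Bˣ, (w : B) ∈ fixedPts θ B₁ H ∧ ((w⁻¹ : Bˣ) : B) ∈ fixedPts θ B₁ H ∧ c = w * a * (w⁻¹ : Bˣ)

/-- `γ` is a point of `H` on `B₁`: a conjugacy class, under the units of `B₁ ^ H`, of primitive
idempotents of `B₁ ^ H`. -/
def IsPoint (θ : G →* Bˣ) (B₁ : Submodule O B) (H : Subgroup G) (γ : Set B) : Prop :=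
  ∃ i, IsPrimitiveIdempotentIn (fixedPts θ B₁ H) i ∧ γ = {c | FixedConj θ B₁ H i c}

lemma IsPoint.commute {θ : G →* Bˣ} {B₁ : Submodule O B} {H : Subgroup G} {γ : Set B}
    (hγ : IsPoint θ B₁ H γ) {j : B} (hj : j ∈ γ) : ∀ h ∈ H, (θ h : B) * j = j * θ h := by
  obtain ⟨i, hi, rfl⟩ := hγ
  obtain ⟨w, hw, hw', rfl⟩ := hj
  intro h hh
  rw [← mul_assoc, ← mul_assoc, hw.2 h hh, mul_assoc (w : B), hi.1.2 h hh, ← mul_assoc,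
    mul_assoc (_ * i), hw'.2 h hh, ← mul_assoc]

/-- The relative trace `Tr_R^H`, on elements fixed by `R ≤ H`. -/
def relTrace (θ : G →* Bˣ) (R H : Subgroup G) (a : B) : B :=
  ∑ᶠ q : H ⧸ R.subgroupOf H, (θ (q.out : H) : B) * a * ((θ (q.out : H))⁻¹ : Bˣ)

/-- The kernel of the Brauer map `Br_H : B₁ ^ H → B₁(H)`, that is
`∑_{R < H} Tr_R^H (B₁ ^ R) + J(O) B₁ ^ H`. -/
def brauerKer [IsLocalRing O] (θ : G →* Bˣ) (B₁ : Submodule O B) (H : Subgroup G) :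
    Submodule O B :=
  (⨆ R : Subgroup G, ⨆ _ : R < H,
      Submodule.span O {x | ∃ a ∈ fixedPts θ B₁ R, x = relTrace θ R H a}) ⊔
    IsLocalRing.maximalIdeal O • fixedPts θ B₁ H

/-- `γ` is a local point of `H` on `B₁`: a point on which the Brauer map does not vanish. -/
def IsLocalPoint [IsLocalRing O] (θ : G →* Bˣ) (B₁ : Submodule O B) (H : Subgroup G)
    (γ : Set B) : Prop :=
  IsPoint θ B₁ H γ ∧ ∀ i ∈ γ, i ∉ brauerKer θ B₁ H

/-- `B` is a Dade `G`-algebra: it has a `G`-stable `O`-basis and `B(G) ≠ 0`. (It is applied only to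
full matrix algebras `End_O(W)` and to finite `p`-groups `G`.) -/
def IsDadeAlgebra [IsLocalRing O] (θ : G →* Bˣ) : Prop :=
  (∃ X : Set B, LinearIndependent O ((↑) : X → B) ∧ Submodule.span O X = ⊤ ∧
      ∀ g, ∀ x ∈ X, (θ g : B) * x * ((θ g)⁻¹ : Bˣ) ∈ X) ∧
    (1 : B) ∉ brauerKer θ (⊤ : Submodule O B) ⊤

variable (O) in
/-- The Peirce component `i B j` (for idempotents `i`, `j`). -/
def peirceComp (i j : B) : Submodule O B where
  carrier := {m | i * m = m ∧ m * j = m}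
  zero_mem' := by simp
  add_mem' := fun ha hb => ⟨by rw [mul_add, ha.1, hb.1], by rw [add_mul, ha.2, hb.2]⟩
  smul_mem' := fun c a ha => ⟨by rw [mul_smul_comm, ha.1], by rw [smul_mul_assoc, ha.2]⟩

variable (O) in
/-- The algebra `e B e` (for an idempotent `e`); for `e` in a point `γ`, this is `B_γ`. -/
def corner (e : B) : NonUnitalSubalgebra O B where
  carrier := {a | e * a = a ∧ a * e = a}
  zero_mem' := by simp
  add_mem' := fun ha hb => ⟨by rw [mul_add, ha.1, hb.1], by rw [add_mul, ha.2, hb.2]⟩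
  mul_mem' := fun ha hb => ⟨by rw [← mul_assoc, ha.1], by rw [mul_assoc, hb.2]⟩
  smul_mem' := fun c a ha => ⟨by rw [mul_smul_comm, ha.1], by rw [smul_mul_assoc, ha.2]⟩

/-- `f : e B e → e' C e'` is an embedding of `Γ`-graded `H`-interior algebras: it is an injective
(not necessarily unital) algebra homomorphism with image `f(e) C f(e)`, it commutes with left and
right multiplication by the images of the elements of `H`, and it preserves degrees. -/
structure IsGradedEmbedding (θ : G →* Bˣ) (𝓑 : Γ → Submodule O B)
    (θ' : G →* Cˣ) (𝓒 : Γ → Submodule O C) (H : Subgroup G) (e : B) (e' : C)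
    (f : corner O e →ₙₐ[O] corner O e') : Prop where
  injective : Function.Injective f
  image : ∀ ε : corner O e, (ε : B) = e → Set.range f = {c | f ε * c * f ε = c}
  interior_left : ∀ h ∈ H, ∀ a a' : corner O e,
    (a' : B) = θ h * a → (f a' : C) = θ' h * f a
  interior_right : ∀ h ∈ H, ∀ a a' : corner O e,
    (a' : B) = a * θ h → (f a' : C) = f a * θ' h
  graded : ∀ x, ∀ a : corner O e, (a : B) ∈ 𝓑 x → (f a : C) ∈ 𝓒 x

/-! ## Fusions -/

/-- `φ ∈ Aut(Q)` is a `B`-fusion of `Q_δ`, where `l ∈ δ`: some unit of `B` conjugates `u l` to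
`φ(u) l` for all `u ∈ Q`. These form the group `F_B(Q_δ)`. -/
def fusionGroup (θ : G →* Bˣ) (Q : Subgroup G) (l : B) : Subgroup (MulAut Q) where
  carrier := {φ | ∃ s : Bˣ, ∀ u : Q,
    (s : B) * (θ u * l) * (s⁻¹ : Bˣ) = θ (φ u : Q) * l}
  one_mem' := ⟨1, by simp⟩
  mul_mem' := by
    rintro φ ψ ⟨s, hs⟩ ⟨t, ht⟩
    refine ⟨s * t, fun u => ?_⟩
    have h := hs (ψ u)
    rw [← ht u] at h
    rw [MulAut.mul_apply, ← h]
    simp [mul_assoc]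
  inv_mem' := by
    rintro φ ⟨s, hs⟩
    refine ⟨s⁻¹, fun u => ?_⟩
    have h := hs (φ⁻¹ u)
    rw [MulAut.apply_inv_self] at h
    rw [← h]
    simp [mul_assoc]

/-- The group `Aut^Γ(Q) = {φ ∈ Aut(Q) | φ(u) ∈ uN for all u ∈ Q}`, where `N = ker ω`. -/
def gradedAut (ω : G →* Γ) (Q : Subgroup G) : Subgroup (MulAut Q) where
  carrier := {φ | ∀ u : Q, ω (φ u : Q) = ω u}
  one_mem' := by simp
  mul_mem' := by
    intro φ ψ hφ hψ u
    rw [MulAut.mul_apply, hφ, hψ]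
  inv_mem' := by
    intro φ hφ u
    rw [← hφ (φ⁻¹ u), MulAut.apply_inv_self]

/-- `(i B j)_φ ≃ i B j` as `Γ`-graded `(i B i, O Q)`-bimodules, by an isomorphism that is homogeneous
of degree `x`. Here the right action of `u ∈ Q` on `(i B j)_φ` is right multiplication by `φ(u)`. -/
def HasTwistedIso (θ : G →* Bˣ) (𝓑 : Γ → Submodule O B) (Q : Subgroup G) (i j : B)
    (φ : MulAut Q) (x : Γ) : Prop :=
  ∃ h : peirceComp O i j ≃ₗ[O] peirceComp O i j,
    (∀ a ∈ corner O i, ∀ m m' : peirceComp O i j, (m' : B) = a * m → (h m' : B) = a * h m) ∧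
    (∀ u : Q, ∀ m m' : peirceComp O i j,
      (m' : B) = m * θ (φ u : Q) → (h m' : B) = h m * θ u) ∧
    ∀ y, ∀ m : peirceComp O i j, (m : B) ∈ 𝓑 y ↔ (h m : B) ∈ 𝓑 (y * x)

/-- The group of `(G, Γ)`-fusions, for representatives `i ∈ γ` and `j ∈ δ` (with `j` fixed by `Q`). A
fusion is recorded together with the degree of the homogeneous isomorphism that realizes it. -/
def gradedFusionGroup (ω : G →* Γ) (θ : G →* Bˣ) (𝓑 : Γ → Submodule O B) (Q : Subgroup G) (i j : B)
    (hj : ∀ u ∈ Q, (θ u : B) * j = j * θ u) : Subgroup (MulAut Q × Γ) where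
  carrier := {q | q.1 ∈ gradedAut ω Q ∧ HasTwistedIso θ 𝓑 Q i j q.1 q.2}
  one_mem' := by
    refine ⟨(gradedAut ω Q).one_mem, LinearEquiv.refl O _, ?_, ?_, ?_⟩
    · intro a _ m m' h; exact h
    · intro u m m' h; exact h
    · intro y m; simp
  mul_mem' := by
    rintro ⟨φ, x⟩ ⟨ψ, y⟩ ⟨hφ, h, h1, h2, h3⟩ ⟨hψ, k, k1, k2, k3⟩
    refine ⟨(gradedAut ω Q).mul_mem hφ hψ, h.trans k, ?_, ?_, ?_⟩
    · intro a ha m m' hm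
      exact k1 a ha _ _ (h1 a ha _ _ hm)
    · intro u m m' hm
      exact k2 u _ _ (h2 (ψ u) m m' hm)
    · intro z m
      rw [h3, k3, LinearEquiv.trans_apply, Prod.mk_mul_mk, mul_assoc]
  inv_mem' := by
    rintro ⟨φ, x⟩ ⟨hφ, h, h1, h2, h3⟩
    refine ⟨(gradedAut ω Q).inv_mem hφ, h.symm, ?_, ?_, ?_⟩
    · intro a ha m m' hm
      have hmem : a * (h.symm m : B) ∈ peirceComp O i j :=
        ⟨by rw [← mul_assoc, ha.1], by rw [mul_assoc, (h.symm m).2.2]⟩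
      have e := h1 a ha (h.symm m) ⟨_, hmem⟩ rfl
      rw [h.apply_symm_apply, ← hm] at e
      have e' : h ⟨_, hmem⟩ = m' := Subtype.ext e
      rw [← e', h.symm_apply_apply]
    · intro u m m' hm
      have hmem : (h.symm m : B) * θ u ∈ peirceComp O i j :=
        ⟨by rw [← mul_assoc, (h.symm m).2.1],
          by rw [mul_assoc, hj u u.2, ← mul_assoc, (h.symm m).2.2]⟩
      have e := h2 (φ⁻¹ u) (h.symm m) ⟨_, hmem⟩ (by rw [MulAut.apply_inv_self])
      rw [h.apply_symm_apply] at e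
      have e' : h ⟨_, hmem⟩ = m' := Subtype.ext (e.trans hm.symm)
      rw [← e', h.symm_apply_apply]
    · intro y m
      have e := h3 (y * x⁻¹) (h.symm m)
      rw [h.apply_symm_apply, inv_mul_cancel_right] at e
      exact e.symm

/-! ## Normalizers -/

/-- `C_N(Q)`, where `N = ker ω`. -/
def centralizerInKer (ω : G →* Γ) (Q : Subgroup G) : Subgroup G :=
  ω.ker ⊓ Subgroup.centralizer (Q : Set G)

/-- `N_G^K(Q)` for `K = Aut^Γ(Q)`: the inverse image of `K` under `N_G(Q) → Aut(Q)`. -/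
def gradedNormalizer (ω : G →* Γ) (Q : Subgroup G) : Subgroup G :=
  ((gradedAut ω Q).comap Q.normalizerMonoidHom).map (Subgroup.normalizer (Q : Set G)).subtype

/-- The stabilizer in `G` of a set `δ ⊆ B` under conjugation. -/
def conjStabilizer (θ : G →* Bˣ) (δ : Set B) : Subgroup G where
  carrier := {g | ∀ a, a ∈ δ ↔ (θ g : B) * a * ((θ g)⁻¹ : Bˣ) ∈ δ}
  one_mem' := by simp
  mul_mem' := by
    intro g k hg hk a
    rw [hk a, hg]
    simp [mul_assoc]
  inv_mem' := by
    intro g hg a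
    rw [hg (((θ g⁻¹ : Bˣ) : B) * a * (((θ g⁻¹)⁻¹ : Bˣ) : B))]
    simp [mul_assoc]

/-- `N_G^K(Q_δ)` for `K = Aut^Γ(Q)`. -/
def gradedPointNormalizer (ω : G →* Γ) (θ : G →* Bˣ) (Q : Subgroup G) (δ : Set B) : Subgroup G :=
  gradedNormalizer ω Q ⊓ conjStabilizer θ δ

instance centralizerInKer_normal (ω : G →* Γ) (θ : G →* Bˣ) (Q : Subgroup G) (δ : Set B) :
    ((centralizerInKer ω Q).subgroupOf (gradedPointNormalizer ω θ Q δ)).Normal where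
  conj_mem := by
    rintro ⟨c, hc⟩ hcm ⟨g, hg⟩
    rw [Subgroup.mem_subgroupOf] at hcm ⊢
    have hgN : g ∈ Subgroup.normalizer (Q : Set G) := by
      obtain ⟨k, -, rfl⟩ := hg.1
      exact k.2
    refine ⟨?_, ?_⟩
    · exact (inferInstance : ω.ker.Normal).conj_mem c hcm.1 g
    · refine Subgroup.mem_centralizer_iff.2 fun u hu => ?_
      have hu' : g⁻¹ * u * g ∈ Q := by
        have := (Subgroup.mem_normalizer_iff.1 (inv_mem hgN) u).1 hu
        simpa using this
      have h := Subgroup.mem_centralizer_iff.1 hcm.2 _ hu'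
      change u * (g * c * g⁻¹) = g * c * g⁻¹ * u
      have h' : g * (g⁻¹ * u * g * c) * g⁻¹ = g * (c * (g⁻¹ * u * g)) * g⁻¹ := by rw [h]
      simpa [mul_assoc] using h'

end Interior

/-! ## Group algebras graded by `ω : G → Γ` -/

section GroupAlgebra

variable {G G' Γ : Type*} [Group G] [Group G'] [Group Γ]

/-- The structural map of `O G` as an `O G`-interior algebra. -/
def groupUnits (O G : Type*) [CommRing O] [Group G] : G →* (MonoidAlgebra O G)ˣ :=
  (MonoidAlgebra.of O G).toHomUnits

/-- The component of degree `x` of the `Γ`-graded algebra `O G`: the elements supported on `ω⁻¹(x)`.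
For `x = 1` it is `O N`, where `N = ker ω`. -/
def gradeComp (O : Type*) [CommRing O] (ω : G →* Γ) (x : Γ) : Submodule O (MonoidAlgebra O G) :=
  Submodule.span O (MonoidAlgebra.of O G '' {g | ω g = x})

/-- The inclusion `O N → O G`, where `N = ker ω`. -/
def kerInclusion (O : Type*) [CommRing O] (ω : G →* Γ) :
    MonoidAlgebra O ω.ker →ₐ[O] MonoidAlgebra O G :=
  MonoidAlgebra.lift O _ ω.ker ((MonoidAlgebra.of O G).comp ω.ker.subtype)

/-- `b` is a block (a primitive central idempotent) of `O N` and it is `G`-invariant. -/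
def IsInvariantBlock {O : Type*} [CommRing O] (ω : G →* Γ) (b : MonoidAlgebra O ω.ker) : Prop :=
  IsPrimitiveIdempotentIn
      (Subalgebra.toSubmodule (Subalgebra.center O (MonoidAlgebra O ω.ker))) b ∧
    ∀ g : G, MonoidAlgebra.of O G g * kerInclusion O ω b = kerInclusion O ω b * MonoidAlgebra.of O G g

/-- `G̈ = {(g, g') | ω g = ω' g'}`. -/
def diagGroup (ω : G →* Γ) (ω' : G' →* Γ) : Subgroup (G × G') :=
  (ω.comp (MonoidHom.fst G G')).eqLocus (ω'.comp (MonoidHom.snd G G'))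

/-- The projection `G̈ → Γ`; its kernel is `N × N'`. -/
def diagDegree (ω : G →* Γ) (ω' : G' →* Γ) : diagGroup ω ω' →* Γ :=
  (ω.comp (MonoidHom.fst G G')).comp (diagGroup ω ω').subtype

/-- `N → G̈`, `n ↦ (n, 1)`. -/
def diagInl (ω : G →* Γ) (ω' : G' →* Γ) : ω.ker →* diagGroup ω ω' :=
  ((MonoidHom.inl G G').comp ω.ker.subtype).codRestrict _ fun n => by
    have h : ω n = 1 := n.2
    change ω n = ω' 1
    rw [h, map_one]

/-- `N' → G̈`, `n' ↦ (1, n')`. -/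
def diagInr (ω : G →* Γ) (ω' : G' →* Γ) : ω'.ker →* diagGroup ω ω' :=
  ((MonoidHom.inr G G').comp ω'.ker.subtype).codRestrict _ fun n => by
    have h : ω' n = 1 := n.2
    change ω 1 = ω' n
    rw [h, map_one]

/-- `P̈ → G`, the restriction of the first projection; its image is `P`. -/
def sigmaL {ω : G →* Γ} {ω' : G' →* Γ} (P : Subgroup (diagGroup ω ω')) : P →* G :=
  (MonoidHom.fst G G').comp ((diagGroup ω ω').subtype.comp P.subtype)

/-- `P̈ → G'`, the restriction of the second projection; its image is `P'`. -/
def sigmaR {ω : G →* Γ} {ω' : G' →* Γ} (P : Subgroup (diagGroup ω ω')) : P →* G' :=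
  (MonoidHom.snd G G').comp ((diagGroup ω ω').subtype.comp P.subtype)

end GroupAlgebra

/-! ## Modules -/

section Modules

variable {O : Type*} [CommRing O]

/-- A nonzero representation that is not the direct sum of two nonzero subrepresentations. -/
def IsIndecomposableRep {H V : Type*} [Group H] [AddCommGroup V] [Module O V]
    (τ : Representation O H V) : Prop :=
  Nontrivial V ∧ ∀ U U' : Submodule O V, (∀ h, ∀ v ∈ U, τ h v ∈ U) → (∀ h, ∀ v ∈ U', τ h v ∈ U') →
    IsCompl U U' → U = ⊥ ∨ U' = ⊥

/-- `V` is isomorphic to a direct summand of `W`. -/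
def IsRepSummand {H V W : Type*} [Group H] [AddCommGroup V] [Module O V] [AddCommGroup W]
    [Module O W] (τ : Representation O H V) (κ : Representation O H W) : Prop :=
  ∃ (s : V →ₗ[O] W) (r : W →ₗ[O] V), (∀ h, s ∘ₗ τ h = κ h ∘ₗ s) ∧ (∀ h, r ∘ₗ κ h = τ h ∘ₗ r) ∧
    r ∘ₗ s = LinearMap.id

/-- `P` is a vertex of the `O H`-module `V`, with source `W`. -/
structure IsVertexSource {H V W : Type*} [Group H] [AddCommGroup V] [Module O V] [AddCommGroup W]
    [Module O W] (τ : Representation O H V) (P : Subgroup H) (κ : Representation O P W) : Prop where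
  source_indecomposable : IsIndecomposableRep κ
  summand_ind : IsRepSummand τ (Representation.ind P.subtype κ)
  source_summand : IsRepSummand κ (τ.comp P.subtype)
  vertex_minimal : ∀ R : Subgroup H, R < P →
    ¬ IsRepSummand τ (Representation.ind R.subtype (τ.comp R.subtype))

/-- The right action of `a ∈ O H` on a left `O H`-module: `v ↦ ∑ a_h h⁻¹ v`. -/
def rightAct {H V : Type*} [Group H] [AddCommGroup V] [Module O V] (τ : Representation O H V)
    (a : MonoidAlgebra O H) : Module.End O V :=
  a.coeff.sum fun h c => c • τ h⁻¹

variable {G G' Γ : Type*} [Group G] [Group G'] [Group Γ]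

/-- The hypotheses on the `O G̈`-module `M`: it is finitely generated, it is indecomposable as an
`O(N × N')`-module, it is associated with `b ⊗ (b')°`, and it is projective as an `O(N × 1)`-module and
as an `O(1 × N')`-module. -/
structure IsDiagonalModule {ω : G →* Γ} {ω' : G' →* Γ} (b : MonoidAlgebra O ω.ker)
    (b' : MonoidAlgebra O ω'.ker) {M : Type*} [AddCommGroup M] [Module O M]
    (ρ : Representation O (diagGroup ω ω') M) : Prop where
  finite : Module.Finite O M
  indecomposable : IsIndecomposableRep (ρ.comp (diagDegree ω ω').ker.subtype)
  block_left : ∀ m, Representation.asAlgebraHom (ρ.comp (diagInl ω ω')) b m = m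
  block_right : ∀ m, rightAct (ρ.comp (diagInr ω ω')) b' m = m
  projective_left :
    Module.Projective (MonoidAlgebra O ω.ker) (Representation.asModule (ρ.comp (diagInl ω ω')))
  projective_right :
    Module.Projective (MonoidAlgebra O ω'.ker) (Representation.asModule (ρ.comp (diagInr ω ω')))

/-- The `(O G, O G')`-bimodule `V` (an `O(G × G')`-module, `g v g' = (g, g'⁻¹) v`) induces a Morita
equivalence between `A = O G b` and `A' = O G' b'`, for central idempotents `b` and `b'` that act as the
identity on `V`: `V` is finitely generated projective on both sides, and the structural maps
`A → End_{A'}(V)` and `A' → End_A(V)ᵒᵖ` are bijective. -/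
structure InducesMorita (b : MonoidAlgebra O G) (b' : MonoidAlgebra O G') {V : Type*}
    [AddCommGroup V] [Module O V] (τ : Representation O (G × G') V) : Prop where
  finite : Module.Finite O V
  projective_left : Module.Projective (MonoidAlgebra O G) (Representation.asModule (τ.comp (MonoidHom.inl G G')))
  projective_right : Module.Projective (MonoidAlgebra O G') (Representation.asModule (τ.comp (MonoidHom.inr G G')))
  end_right : ∀ f : Module.End O V, (∀ g' : G', f * τ (1, g') = τ (1, g') * f) →
    ∃! a : MonoidAlgebra O G, a * b = a ∧ Representation.asAlgebraHom (τ.comp (MonoidHom.inl G G')) a = f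
  end_left : ∀ f : Module.End O V, (∀ g : G, f * τ (g, 1) = τ (g, 1) * f) →
    ∃! a : MonoidAlgebra O G', a * b' = a ∧ rightAct (τ.comp (MonoidHom.inr G G')) a = f

/-- `M̈ = Ind_{G̈}^{G × G'}(M)` determines a basic `Γ`-graded Morita equivalence between `A = O G b` and
`A' = O G' b'`, where the `O P̈`-module `N̈` (with action `κ`) is a source of `M`. The bimodule `M̈` is
`Γ`-graded by construction, with `1`-component `M`, so the Morita equivalence that it induces is a graded
one; it is basic if `S = End_O(N̈)` is a Dade `P̈`-algebra. -/
structure IsBasicGradedMorita {ω : G →* Γ} {ω' : G' →* Γ} [IsLocalRing O] (b : MonoidAlgebra O ω.ker)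
    (b' : MonoidAlgebra O ω'.ker) {M W : Type*} [AddCommGroup M] [Module O M] [AddCommGroup W]
    [Module O W] (ρ : Representation O (diagGroup ω ω') M) (P : Subgroup (diagGroup ω ω'))
    (κ : Representation O P W) : Prop where
  morita : InducesMorita (kerInclusion O ω b) (kerInclusion O ω' b')
    (Representation.ind (diagGroup ω ω').subtype ρ)
  dade : IsDadeAlgebra (O := O) κ.toHomUnits

end Modules

/-! ## The tensor product `S ⊗ O G'` -/

section Tensor

variable {O G G' Γ W : Type*} [CommRing O] [Group G] [Group G'] [Group Γ] [AddCommGroup W] [Module O W]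

/-- The structural map of the `P̈`-interior algebra `S ⊗ Res_{σ'}(O G')`. -/
def tensorUnits {ω : G →* Γ} {ω' : G' →* Γ} {P : Subgroup (diagGroup ω ω')}
    (κ : Representation O P W) : P →* (Module.End O W ⊗[O] MonoidAlgebra O G')ˣ :=
  MonoidHom.toHomUnits
    { toFun := fun u => κ u ⊗ₜ[O] MonoidAlgebra.of O G' (sigmaR P u)
      map_one' := by rw [map_one, map_one, map_one, Algebra.TensorProduct.one_def]
      map_mul' := fun u v => by rw [map_mul, map_mul, map_mul, Algebra.TensorProduct.tmul_mul_tmul] }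

variable (O W) in
/-- The component of degree `x` of `S ⊗ O G'`, namely `S ⊗ (O G')_x`. -/
def tensorGrade (ω' : G' →* Γ) (x : Γ) : Submodule O (Module.End O W ⊗[O] MonoidAlgebra O G') :=
  LinearMap.range ((gradeComp O ω' x).subtype.lTensor (Module.End O W))

/-- The local points `δ` and `δ'` correspond to each other through the embedding
`f : A_γ → S ⊗ A'_γ'`, where `i ∈ γ` and `i' ∈ γ'`: some element of `f(δ)` is conjugate, by a unit of
`(S ⊗ A'_1)^Q̈`, to an idempotent contained in `l ⊗ j'`, where `l ∈ δ̈` and `j' ∈ δ'`. -/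
def PointsCorrespond {ω : G →* Γ} {ω' : G' →* Γ} {P : Subgroup (diagGroup ω ω')}
    (κ : Representation O P W) {i : MonoidAlgebra O G} {i' : MonoidAlgebra O G'}
    (f : corner O i →ₙₐ[O] corner O ((1 : Module.End O W) ⊗ₜ[O] i')) (Qdd : Subgroup P)
    (δ : Set (MonoidAlgebra O G)) (δdd : Set (Module.End O W)) (δ' : Set (MonoidAlgebra O G')) : Prop :=
  ∃ j : corner O i, (j : MonoidAlgebra O G) ∈ δ ∧ ∃ l ∈ δdd, ∃ j' ∈ δ', j' ∈ corner O i' ∧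
    ∃ e ∈ corner O (l ⊗ₜ[O] j'),
      FixedConj (tensorUnits κ) (tensorGrade O W ω' 1) Qdd
        (f j : Module.End O W ⊗[O] MonoidAlgebra O G') e

end Tensor

end

/-! ## Finite algebras over a complete local ring -/

section FiniteAlgebra

variable {O : Type*} [CommRing O]

section

variable [IsNoetherianRing O]

/-! Fusions are units. Since `j` is equivalent, through elements fixed by `Q` and of degree 1, to an
idempotent of `i O G i`, an isomorphism `(i O G j)_φ ≃ i O G j` homogeneous of degree `x` is right
multiplication by an invertible element `a` of `j O G j`, of degree `x`, with `φ(u) a = a u`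
(`IsTwistedUnit`, `hasTwistedIso_iff`). The question is which pairs `(φ, x)` are realized by such
units.

The engine is `exists_realization`. Let `e` be an idempotent of `(S ⊗ (O G)_1)^H` below `l ⊗ j`,
outside the kernel of the Brauer map, and let `y y' = e` with `y` of degree `x` twisted by `φ` and
`y'` of degree `x⁻¹` twisted by `φ⁻¹`. Expanding both over `G` writes `e` as a sum over pairs `(g,
h)`. The group `H` permutes the pairs by an action twisted by `φ`, and the terms equivariantly, so
modulo the Brauer kernel only the fixed pairs count; in such a pair, `g` induces `φ`. The term there
is `c ⊗ d`, with `c` in the local algebra `l S^H l` and, when the pair has degrees `(x, x⁻¹)`, `d`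
in the local algebra `j (O G)_1^H j`; terms of other degrees vanish. If `c` or `d` were always in
the radical, `e` would lie in a sum of two submodules that are nilpotent modulo the Brauer kernel,
hence in this kernel. So both are invertible for some pair: then `g` has degree `x` and fixes the
point of `j`, and the coefficient of `y` at `g` yields a unit of `S` that realizes `φ` at `l`.

Part 1 is the case `S = O`: each twisted unit comes from an element of `N_G^K(Q_δ)`. Conversely, if
`g j g⁻¹ = w j w⁻¹` with a unit `w` of `(O N)^Q`, then `w⁻¹ g j` is a twisted unit. The kernel
consists of the elements of degree 1 that centralize `Q`.

For part 2, the embedding identifies `j O G j` with a corner `e (S ⊗ O G') e`, `e` below `l ⊗ j'`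
(`IsCornerEquiv`). Twisted units at `j` become twisted units at `e`, and the engine gives both an
element of `G'` and a fusion in `S`. For the other inclusion a dual map from `j' O G' j'` to `Sᵒᵖ ⊗
O G` is built: with dual bases `E`, `F` of `S` for the trace form `τ` and the inverse `ψ` of the
embedding, it is `a ↦ ∑ F_kᵒᵖ ⊗ ψ((E_k ⊗ a) m)`, which respects products on the corner of `j'` as
soon as `(τ ⊗ 1)(m e) = j'`. Such an `m` exists because `S` has a stable basis: the Brauer argument
applied to the expansion of `e` in this basis produces an invertible trace. An equivariant left
inverse on the corner of `j'` (`dualTrace`) shows that locality survives, and the engine applies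
again.

Finally, `ker σ` and `ker σ'` embed in `N'` and `N`, over which `M` is projective, so the identity
of `S` is a trace from the trivial subgroup. In a Dade algebra this forces order prime to `p`, while
`P̈` is a `p`-group; hence `σ` and `σ'` are injective. -/

lemma mul_eq_one_comm_of_finite {E : Type*} [Ring E] [Algebra O E] [Module.Finite O E] {a b : E}
    (h : a * b = 1) : b * a = 1 := by
  have : IsNoetherian O E := isNoetherian_of_isNoetherianRing_of_finite O E
  have hs : Function.Surjective (LinearMap.mulLeft O a) := fun x => ⟨b * x, by simp [← mul_assoc, h]⟩
  refine IsNoetherian.injective_of_surjective_endomorphism _ hs ?_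
  simp [← mul_assoc, h]

end

variable [IsLocalRing O]

lemma mem_smul_top_of_tmul_eq_zero {M : Type*} [AddCommGroup M] [Module O M] {m : M}
    (h : (1 : IsLocalRing.ResidueField O) ⊗ₜ[O] m = 0) :
    m ∈ IsLocalRing.maximalIdeal O • (⊤ : Submodule O M) := by
  have h1 : (TensorProduct.quotTensorEquivQuotSMul M (IsLocalRing.maximalIdeal O))
      ((1 : O ⧸ IsLocalRing.maximalIdeal O) ⊗ₜ[O] m) = 0 :=
    (congrArg (TensorProduct.quotTensorEquivQuotSMul M (IsLocalRing.maximalIdeal O)) h).trans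
      (map_zero (TensorProduct.quotTensorEquivQuotSMul M (IsLocalRing.maximalIdeal O)))
  rw [TensorProduct.quotTensorEquivQuotSMul_mk_one_tmul] at h1
  exact (Submodule.Quotient.mk_eq_zero _).1 h1

lemma exists_tmul_one_eq {M : Type*} [AddCommGroup M] [Module O M]
    (y : IsLocalRing.ResidueField O ⊗[O] M) :
    ∃ m : M, (1 : IsLocalRing.ResidueField O) ⊗ₜ[O] m = y := 
  TensorProduct.mk_surjective _ _ _ (IsLocalRing.residue_surjective) y

/-- Modulo the maximal ideal, `E` becomes a finite-dimensional algebra over the residue field, whose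
radical is nilpotent and contains the image of the radical of `E`. -/
lemma exists_jacobson_pow_le (E : Type*) [Ring E] [Algebra O E] [Module.Finite O E] :
    ∃ n, ∀ a ∈ Ring.jacobson E ^ n, a ∈ IsLocalRing.maximalIdeal O • (⊤ : Submodule O E) := by
  have : IsArtinianRing (IsLocalRing.ResidueField O ⊗[O] E) :=
    IsArtinianRing.of_finite (IsLocalRing.ResidueField O) _
  obtain ⟨n, hn⟩ := IsSemiprimaryRing.isNilpotent (R := IsLocalRing.ResidueField O ⊗[O] E)
  let f : E →+* IsLocalRing.ResidueField O ⊗[O] E :=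
    (Algebra.TensorProduct.includeRight : E →ₐ[O] _).toRingHom
  have hf : Function.Surjective f := fun y => exists_tmul_one_eq y
  have : RingHomSurjective f := ⟨hf⟩
  have key : ∀ n, ∀ a ∈ Ring.jacobson E ^ n,
      f a ∈ Ring.jacobson (IsLocalRing.ResidueField O ⊗[O] E) ^ n := by
    intro n
    induction n with
    | zero => intro a _; rw [Submodule.pow_zero]; exact ⟨f a, by simp⟩
    | succ n ih =>
      intro a ha
      rw [Submodule.pow_succ] at ha ⊢
      refine Submodule.mul_induction_on ha ?_ ?_
      · intro x hx y hy
        rw [map_mul]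
        exact Submodule.mul_mem_mul (ih x hx) (Ring.le_comap_jacobson f hy)
      · intro x y hx hy
        rw [map_add]; exact add_mem hx hy
  refine ⟨n, fun a ha => mem_smul_top_of_tmul_eq_zero ?_⟩
  have := key n a ha
  rw [hn] at this
  exact this
variable [IsNoetherianRing O]

/-- The completion of a finite module is a quotient of the completion of `O` tensored with it, and
`O` is already complete. -/
lemma isAdicComplete_of_finite [IsAdicComplete (IsLocalRing.maximalIdeal O) O]
    (M : Type*) [AddCommGroup M] [Module O M] [Module.Finite O M] :
    IsAdicComplete (IsLocalRing.maximalIdeal O) M := by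
  have hp : IsPrecomplete (IsLocalRing.maximalIdeal O) M := by
    rw [← AdicCompletion.of_surjective_iff]
    intro y
    obtain ⟨t, rfl⟩ := AdicCompletion.ofTensorProduct_surjective_of_finite
      (IsLocalRing.maximalIdeal O) M y
    induction t with
    | zero => exact ⟨0, by simp⟩
    | add a b ha hb =>
      obtain ⟨x, hx⟩ := ha
      obtain ⟨y, hy⟩ := hb
      exact ⟨x + y, by rw [map_add, map_add, hx, hy]⟩
    | tmul r m =>
      obtain ⟨r, rfl⟩ := AdicCompletion.of_surjective (IsLocalRing.maximalIdeal O) O r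
      refine ⟨r • m, ?_⟩
      rw [AdicCompletion.ofTensorProduct_tmul, map_smul]
      ext n
      rw [AdicCompletion.smul_eval]
      rfl
  exact { hp with }

/-- One-sided inverses are two-sided in a finite algebra, so each `y * a` is again a non-unit, and
locality makes `1 + y * a` a unit. -/
lemma mem_jacobson_of_not_isUnit {E : Type*} [Ring E] [IsLocalRing E] [Algebra O E]
    [Module.Finite O E] {a : E} (ha : ¬ IsUnit a) : a ∈ Ring.jacobson E := by
  rw [← Ideal.jacobson_bot, Ideal.mem_jacobson_iff]
  intro y
  have h1 : ¬ IsUnit (-(y * a)) := fun h => ha (by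
    obtain ⟨u, hu⟩ := h
    have h2 : (-(↑u⁻¹ : E) * y) * a = 1 := by
      rw [mul_assoc, neg_mul, ← mul_neg, ← hu, Units.inv_mul]
    exact ⟨⟨a, _, mul_eq_one_comm_of_finite (O := O) h2, h2⟩, rfl⟩)
  have h2 := (IsLocalRing.isUnit_or_isUnit_of_add_one (a := -(y * a)) (b := 1 + y * a) (by abel)).resolve_left h1
  obtain ⟨u, hu⟩ := h2
  refine ⟨↑u⁻¹, ?_⟩
  have : (↑u⁻¹ : E) * y * a + ↑u⁻¹ = 1 := by
    have : (↑u⁻¹ : E) * (1 + y * a) = 1 := by rw [← hu, Units.inv_mul]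
    rw [mul_add, mul_one] at this
    rw [mul_assoc, add_comm, this]
  simp [this]

variable [IsAdicComplete (IsLocalRing.maximalIdeal O) O]

/-- Fitting's lemma in a finite commutative algebra over a complete local ring. -/
lemma exists_isIdempotentElem_fitting {C : Type*} [CommRing C] [Algebra O C] [Module.Finite O C]
    (a : C) : ∃ ε b : C, ∃ n : ℕ, ε * ε = ε ∧ a * b = ε ∧
      (a * (1 - ε)) ^ n ∈ (IsLocalRing.maximalIdeal O).map (algebraMap O C) := by
  set I := (IsLocalRing.maximalIdeal O).map (algebraMap O C) with hI
  have hc : IsAdicComplete I C := by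
    have := isAdicComplete_of_finite (O := O) C
    exact { (IsHausdorff.map_algebraMap_iff (S := C)).2 this.toIsHausdorff,
      (IsPrecomplete.map_algebraMap_iff (S := C)).2 this.toIsPrecomplete with }
  have hker : ∀ c : C, (1 : IsLocalRing.ResidueField O) ⊗ₜ[O] c = 0 → c ∈ I := fun c h => by
    have h' := mem_smul_top_of_tmul_eq_zero h
    rw [Ideal.smul_top_eq_map] at h'
    exact h'
  have hjac : ∀ d ∈ I, IsUnit (1 - d) := fun d hd => by
    have h1 := (HenselianRing.jac : I ≤ _) hd
    have := Ideal.mem_jacobson_bot.1 h1 (-1)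
    rwa [mul_neg_one, neg_add_eq_sub] at this
  have : IsArtinianRing (IsLocalRing.ResidueField O ⊗[O] C) :=
    IsArtinianRing.of_finite (IsLocalRing.ResidueField O) _
  -- Modulo the maximal ideal the ideals generated by the powers of `a` become stationary, so that
  -- `a ^ n = a ^ (n + 1) * r` there.
  obtain ⟨n, r', hr'⟩ := IsArtinian.exists_pow_succ_smul_dvd
    ((1 : IsLocalRing.ResidueField O) ⊗ₜ[O] a) (1 : IsLocalRing.ResidueField O ⊗[O] C)
  obtain ⟨r, rfl⟩ := exists_tmul_one_eq r'
  have h0 : a ^ (n + 1) * r - a ^ n ∈ I := by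
    refine hker _ ?_
    rw [TensorProduct.tmul_sub, sub_eq_zero]
    simpa [Algebra.TensorProduct.tmul_pow] using hr'
  have hq : ∀ {x y : C}, x - y ∈ I ↔ Ideal.Quotient.mk I x = Ideal.Quotient.mk I y :=
    fun {x y} => (Ideal.Quotient.eq).symm
  -- `a ^ (n + 1) = a ^ (n + 1) * (a * r) ^ k` modulo `I`
  have h1 : ∀ k, Ideal.Quotient.mk I (a ^ (n + 1) * (a * r) ^ k) = Ideal.Quotient.mk I (a ^ (n + 1)) := by
    intro k
    induction k with
    | zero => simp
    | succ k ih =>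
      rw [← ih, ← hq]
      have : a ^ (n + 1) * (a * r) ^ (k + 1) - a ^ (n + 1) * (a * r) ^ k
        = (a ^ (n + 1) * r - a ^ n) * (a * (a * r) ^ k) := by ring
      rw [this]
      exact I.mul_mem_right _ h0
  -- The Fitting idempotent, so far only modulo `I`; it is lifted by Hensel's lemma for `X ^ 2 - X`.
  set ε0 := (a * r) ^ (n + 1) with hε0
  have h2 : ε0 * ε0 - ε0 ∈ I := by
    have := hq.2 (h1 (n + 1))
    have h3 : ε0 * ε0 - ε0 = (a ^ (n + 1) * (a * r) ^ (n + 1) - a ^ (n + 1)) * r ^ (n + 1) := by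
      rw [hε0]; ring
    rw [h3]; exact I.mul_mem_right _ this
  -- The derivative `2 ε0 - 1` is its own inverse modulo `I`, because its square is `1 + 4 (ε0 ^ 2 -
  -- ε0)`.
  obtain ⟨ε, hε, hεI⟩ := HenselianRing.is_henselian (I := I) (Polynomial.X ^ 2 - Polynomial.X)
    (by monicity!) ε0 (by simpa [pow_two] using h2) (by
      rw [isUnit_iff_exists_inv]
      refine ⟨Ideal.Quotient.mk I (2 * ε0 - 1), ?_⟩
      rw [← map_mul, ← map_one (Ideal.Quotient.mk I), ← hq]
      have : Polynomial.eval ε0 (Polynomial.derivative (Polynomial.X ^ 2 - Polynomial.X)) * (2 * ε0 - 1) - 1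
        = 4 * (ε0 * ε0 - ε0) := by
        simp; ring
      rw [this]
      exact I.mul_mem_left _ h2)
  have hεε : ε * ε = ε := by
    have : ε ^ 2 - ε = 0 := by simpa [Polynomial.IsRoot] using hε
    linear_combination this
  -- As `ε * (1 - ε * (ε - ε0)) = ε * ε0`, this inverse `v` gives `ε * ε0 * v = ε`; since `a`
  -- divides `ε0`, it divides `ε`.
  obtain ⟨v, hv⟩ := isUnit_iff_exists_inv.1 (hjac (ε * (ε - ε0)) (I.mul_mem_left _ hεI))
  refine ⟨ε, ε * (a ^ n * r ^ (n + 1)) * v, n + 1, hεε, ?_, ?_⟩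
  · have : a * (ε * (a ^ n * r ^ (n + 1)) * v) = ε * ε0 * v := by rw [hε0]; ring
    rw [this]
    linear_combination (-(v * ε0) + v * ε + v) * hεε + ε * hv
  · rw [mul_pow]
    have h3 : (1 - ε) ^ (n + 1) = 1 - ε :=
      IsIdempotentElem.pow_succ_eq n (IsIdempotentElem.one_sub hεε)
    rw [h3]
    have := hq.2 (h1 (n + 1))
    have h4 : a ^ (n + 1) * (1 - ε) = - (a ^ (n + 1) * (a * r) ^ (n + 1) - a ^ (n + 1))
      - a ^ (n + 1) * (ε - ε0) := by rw [hε0]; ring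
    rw [h4]
    exact I.sub_mem (I.neg_mem this) (I.mul_mem_left _ hεI)

/-- Fitting's lemma in the commutative algebra `O[a]` gives an idempotent which is `0` or `1`. If it
is `1`, then `a` is invertible; if it is `0`, then `a` is nilpotent modulo the maximal ideal and `1
- a` is invertible. -/
lemma isLocalRing_of_trivial_idempotents {E : Type*} [Ring E] [Nontrivial E] [Algebra O E]
    [Module.Finite O E] (h : ∀ e : E, e * e = e → e = 0 ∨ e = 1) : IsLocalRing E := by
  refine IsLocalRing.of_isUnit_or_isUnit_one_sub_self fun a => ?_
  have : IsNoetherian O E := isNoetherian_of_isNoetherianRing_of_finite O E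
  let C := Algebra.adjoin O {a}
  let _ : CommRing C := { (inferInstance : Ring C) with
    mul_comm := (Algebra.isMulCommutative_adjoin_singleton (R := O) a).is_comm.comm }
  let x : C := ⟨a, Algebra.self_mem_adjoin_singleton O a⟩
  have hfin : Module.Finite O C := Module.IsNoetherian.finite O (Subalgebra.toSubmodule C)
  obtain ⟨ε, b, n, h1, h2, h3⟩ := exists_isIdempotentElem_fitting (O := O) x
  have hu : ∀ y : C, IsUnit y → IsUnit (y : E) := fun y hy => hy.map C.val
  rcases h ε (congrArg Subtype.val h1) with h0 | h0
  · right
    have hε : ε = 0 := Subtype.ext h0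
    rw [hε, sub_zero, mul_one] at h3
    have hj : (IsLocalRing.maximalIdeal O).map (algebraMap O C) ≤ Ideal.jacobson ⊥ := by
      have := isAdicComplete_of_finite (O := O) C
      have hc : IsAdicComplete ((IsLocalRing.maximalIdeal O).map (algebraMap O C)) C :=
        { (IsHausdorff.map_algebraMap_iff (S := C)).2 this.toIsHausdorff,
          (IsPrecomplete.map_algebraMap_iff (S := C)).2 this.toIsPrecomplete with }
      exact IsAdicComplete.le_jacobson_bot _
    have h4 := Ideal.mem_jacobson_bot.1 (hj h3) (-1)
    rw [mul_neg_one, neg_add_eq_sub] at h4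
    have h5 : IsUnit (1 - x) := by
      refine isUnit_of_dvd_unit ?_ h4
      simpa using sub_dvd_pow_sub_pow 1 x n
    exact hu _ h5
  · left
    have hε : ε = 1 := Subtype.ext h0
    exact hu x (isUnit_iff_exists_inv.2 ⟨b, by rw [h2, hε]⟩)

end FiniteAlgebra

/-! ### The radical of the local algebra cut out by a primitive idempotent -/

section Radical

variable {O B : Type*} [CommRing O] [IsNoetherianRing O] [IsLocalRing O]
  [IsAdicComplete (IsLocalRing.maximalIdeal O) O] [Ring B] [Algebra O B]

/-- `J` is contained in `Z`, absorbs the elements of `j Z j`, is nilpotent modulo the maximal ideal,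
and contains all the elements of `j Z j` that are not invertible in `j Z j`. -/
structure IsRadicalAt (Z : Submodule O B) (j : B) (J : Submodule O B) : Prop where
  le : J ≤ Z
  left : ∀ a ∈ J, j * a = a
  right : ∀ a ∈ J, a * j = a
  mul_mem_left : ∀ a ∈ J, ∀ c ∈ Z, j * c = c → c * j = c → c * a ∈ J
  mul_mem_right : ∀ a ∈ J, ∀ c ∈ Z, j * c = c → c * j = c → a * c ∈ J
  mem_or_inv : ∀ a ∈ Z, j * a = a → a * j = a →
    a ∈ J ∨ ∃ a' ∈ Z, j * a' = a' ∧ a' * j = a' ∧ a * a' = j ∧ a' * a = j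
  pow_le : ∃ n : ℕ, J ^ (n + 1) ≤ IsLocalRing.maximalIdeal O • Z

/-- Primitivity says that the ring `j Z j`, with unit `j`, has only trivial idempotents, hence is
local; `J` is its Jacobson radical. -/
lemma exists_isRadicalAt [Module.Finite O B] {Z : Submodule O B}
    (hZ : ∀ a ∈ Z, ∀ c ∈ Z, a * c ∈ Z) {j : B} (hj : IsPrimitiveIdempotentIn Z j) :
    ∃ J : Submodule O B, IsRadicalAt Z j J := by
  obtain ⟨hjZ, hjj, hj0, hprim⟩ := hj
  let D : NonUnitalSubalgebra O B :=
    { carrier := {a | a ∈ Z ∧ j * a = a ∧ a * j = a}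
      zero_mem' := ⟨Z.zero_mem, by simp⟩
      add_mem' := fun ha hb => ⟨Z.add_mem ha.1 hb.1, by rw [mul_add, ha.2.1, hb.2.1],
        by rw [add_mul, ha.2.2, hb.2.2]⟩
      mul_mem' := fun ha hb => ⟨hZ _ ha.1 _ hb.1, by rw [← mul_assoc, ha.2.1],
        by rw [mul_assoc, hb.2.2]⟩
      smul_mem' := fun c a ha => ⟨Z.smul_mem c ha.1, by rw [mul_smul_comm, ha.2.1],
        by rw [smul_mul_assoc, ha.2.2]⟩ }
  let _ : Ring D :=
    { (inferInstance : NonUnitalRing D) with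
      one := ⟨j, hjZ, hjj, hjj⟩
      one_mul := fun a => Subtype.ext a.2.2.1
      mul_one := fun a => Subtype.ext a.2.2.2 }
  let _ : Algebra O D := Algebra.ofModule (fun r x y => smul_mul_assoc r x y)
    (fun r x y => mul_smul_comm r x y)
  have hone : ((1 : D) : B) = j := rfl
  have hmul : ∀ a c : D, ((a * c : D) : B) = a * c := fun _ _ => rfl
  have hnoeth : IsNoetherian O B := isNoetherian_of_isNoetherianRing_of_finite O B
  have hfin : Module.Finite O D := Module.IsNoetherian.finite O D.toSubmodule
  have : Nontrivial D := ⟨0, 1, fun h => hj0 (congrArg Subtype.val h).symm⟩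
  have hloc : IsLocalRing D := isLocalRing_of_trivial_idempotents (O := O) fun e he => by
    rcases hprim e e.2.1 (congrArg Subtype.val he) e.2.2.1 e.2.2.2 with h | h
    · exact Or.inl (Subtype.ext h)
    · exact Or.inr (Subtype.ext h)
  let ι : D →ₗ[O] B := D.toSubmodule.subtype
  have hι : ∀ a : D, ι a = a := fun _ => rfl
  refine ⟨((Ring.jacobson D).restrictScalars O).map ι, ?_, ?_, ?_, ?_, ?_, ?_, ?_⟩
  · rintro _ ⟨a, -, rfl⟩; exact a.2.1
  · rintro _ ⟨a, -, rfl⟩; exact a.2.2.1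
  · rintro _ ⟨a, -, rfl⟩; exact a.2.2.2
  · rintro _ ⟨a, ha, rfl⟩ c hc h1 h2
    exact ⟨⟨c, hc, h1, h2⟩ * a, (Ring.jacobson D).mul_mem_left _ ha, rfl⟩
  · rintro _ ⟨a, ha, rfl⟩ c hc h1 h2
    exact ⟨a * ⟨c, hc, h1, h2⟩, Ideal.mul_mem_right _ (Ring.jacobson D) ha, rfl⟩
  · intro a ha h1 h2
    by_cases hu : IsUnit (⟨a, ha, h1, h2⟩ : D)
    · obtain ⟨u, hu⟩ := hu
      refine Or.inr ⟨(↑u⁻¹ : D), (↑u⁻¹ : D).2.1, (↑u⁻¹ : D).2.2.1, (↑u⁻¹ : D).2.2.2, ?_, ?_⟩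
      · have := congrArg Subtype.val (u.mul_inv)
        rwa [hmul, hu] at this
      · have := congrArg Subtype.val (u.inv_mul)
        rwa [hmul, hu] at this
    · exact Or.inl ⟨_, mem_jacobson_of_not_isUnit (O := O) hu, rfl⟩
  · obtain ⟨n, hn⟩ := exists_jacobson_pow_le (O := O) D
    -- Powers formed in `B` are compared with powers of the radical of `D`. The exponents start at
    -- 1: the zeroth power in `B` is spanned by the unit of `B`, whereas the unit of `D` is `j`.
    have key : ∀ n : ℕ, ∀ a ∈ (((Ring.jacobson D).restrictScalars O).map ι) ^ (n + 1),
        ∃ c ∈ Ring.jacobson D ^ (n + 1), ι c = a := by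
      intro n
      induction n with
      | zero =>
        intro a ha
        rw [zero_add, Submodule.pow_one] at ha ⊢
        exact ha
      | succ n ih =>
        intro a ha
        rw [Submodule.pow_succ] at ha
        refine Submodule.mul_induction_on ha ?_ ?_
        · rintro x hx _ ⟨y, hy, rfl⟩
          obtain ⟨c, hc, rfl⟩ := ih x hx
          exact ⟨c * y, by rw [Submodule.pow_succ]; exact Submodule.mul_mem_mul hc hy, rfl⟩
        · rintro x y ⟨c, hc, rfl⟩ ⟨d, hd, rfl⟩
          exact ⟨c + d, add_mem hc hd, rfl⟩
    refine ⟨n, fun a ha => ?_⟩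
    obtain ⟨c, hc, rfl⟩ := key n a ha
    have hc' : c ∈ Ring.jacobson D ^ n := by
      rw [Submodule.pow_succ] at hc
      refine Submodule.mul_induction_on hc (fun x hx y _ => ?_) fun x y => add_mem
      rcases n with _ | n
      · rw [Submodule.pow_zero]; exact ⟨x * y, by simp⟩
      · rw [Submodule.pow_succ] at hx ⊢
        refine Submodule.mul_induction_on hx (fun z hz w hw => ?_) fun z w hz hw => ?_
        · rw [mul_assoc]
          exact Submodule.mul_mem_mul hz (Ideal.mul_mem_right _ _ hw)
        · rw [add_mul]; exact add_mem hz hw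
    have h1 := Submodule.mem_map_of_mem (f := ι) (hn c hc')
    rw [Submodule.map_smul''] at h1
    refine Submodule.smul_mono le_rfl ?_ h1
    rintro _ ⟨d, -, rfl⟩
    exact d.2.1

end Radical

/-! ### Idempotents modulo nilpotent submodules -/

section Submodules

variable {O B : Type*} [CommRing O] [Ring B] [Algebra O B]

/-- In the expansion, every word with at least one factor from `V` is absorbed by `V`. -/
lemma sup_pow_succ_le {X V : Submodule O B} (h1 : X * V ≤ V) (h2 : V * X ≤ V) (h3 : V * V ≤ V)
    (n : ℕ) : (X ⊔ V) ^ (n + 1) ≤ X ^ (n + 1) ⊔ V := by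
  have hX : ∀ n : ℕ, X ^ (n + 1) * V ≤ V := by
    intro n
    induction n with
    | zero => rwa [zero_add, pow_one]
    | succ n ih =>
      rw [pow_succ, mul_assoc]
      exact (mul_le_mul_right h1 _).trans ih
  induction n with
  | zero => simp
  | succ n ih =>
    rw [pow_succ]
    refine (mul_le_mul_left ih _).trans ?_
    rw [Submodule.mul_sup, Submodule.sup_mul, Submodule.sup_mul, ← pow_succ]
    refine sup_le (sup_le le_sup_left (h2.trans le_sup_right)) ?_
    exact sup_le ((hX n).trans le_sup_right) (h3.trans le_sup_right)

/-- An idempotent equals its own power, and `n + 1` factors exhaust the nilpotent summand. -/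
lemma idempotent_mem_of_mem_sup {X V : Submodule O B} (h1 : X * V ≤ V) (h2 : V * X ≤ V)
    (h3 : V * V ≤ V) {n : ℕ} (hn : X ^ (n + 1) ≤ V) {e : B} (he : e * e = e) (hmem : e ∈ X ⊔ V) :
    e ∈ V := by
  have h := sup_pow_succ_le h1 h2 h3 n (Submodule.pow_mem_pow _ hmem (n + 1))
  rw [IsIdempotentElem.pow_succ_eq n he, sup_eq_right.2 hn] at h
  exact h

/-- An idempotent of `F` that lies in `X + Y` modulo an ideal `K` of `F` lies in `K`, if `X` and `Y` are
nilpotent modulo `K` and `X` normalizes `Y`. -/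
lemma idempotent_mem_of_nilpotent {X Y K F : Submodule O B} (hFF : F * F ≤ F) (hFK : F * K ≤ K)
    (hKF : K * F ≤ K) (hX : X ≤ F) (hY : Y ≤ F) (hXY : X * Y ≤ Y) (hYX : Y * X ≤ Y) (hYY : Y * Y ≤ Y)
    {n m : ℕ} (hXn : X ^ (n + 1) ≤ K) (hYm : Y ^ (m + 1) ≤ K) {e c : B} (he : e * e = e)
    (heF : e ∈ F) (hc : c ∈ X ⊔ Y) (hec : e - c ∈ K) : e ∈ K := by
  have hpow : ∀ V ≤ F, ∀ k : ℕ, V ^ (k + 1) ≤ F := fun V hV k => by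
    induction k with
    | zero => rwa [zero_add, pow_one]
    | succ k ih => rw [pow_succ]; exact (mul_le_mul' ih hV).trans hFF
  -- `K` is not assumed to lie in `F`, so the ideal used below is `K ⊓ F`.
  have hl : ∀ V ≤ F, V * (K ⊓ F) ≤ K ⊓ F := fun V hV =>
    le_inf ((mul_le_mul' hV inf_le_left).trans hFK) ((mul_le_mul' hV inf_le_right).trans hFF)
  have hr : ∀ V ≤ F, (K ⊓ F) * V ≤ K ⊓ F := fun V hV =>
    le_inf ((mul_le_mul' inf_le_left hV).trans hKF) ((mul_le_mul' inf_le_right hV).trans hFF)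
  have hmem : e ∈ X ⊔ (Y ⊔ K ⊓ F) := by
    rw [← sup_assoc, show e = c + (e - c) by abel]
    exact Submodule.add_mem_sup hc ⟨hec, sub_mem heF (sup_le hX hY hc)⟩
  -- Two reductions: `X` is removed modulo `Y ⊔ K ⊓ F`, which it normalizes, and then `Y` modulo `K
  -- ⊓ F`.
  have h1 : e ∈ Y ⊔ K ⊓ F := by
    refine idempotent_mem_of_mem_sup ?_ ?_ ?_ ((le_inf hXn (hpow X hX n)).trans le_sup_right) he hmem
    · rw [Submodule.mul_sup]; exact sup_le_sup hXY (hl X hX)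
    · rw [Submodule.sup_mul]; exact sup_le_sup hYX (hr X hX)
    · rw [Submodule.mul_sup, Submodule.sup_mul, Submodule.sup_mul]
      exact sup_le (sup_le_sup hYY (hr Y hY))
        (sup_le ((hl Y hY).trans le_sup_right) ((hr _ inf_le_right).trans le_sup_right))
  exact (idempotent_mem_of_mem_sup (hl Y hY) (hr Y hY) (hr _ inf_le_right)
    (le_inf hYm (hpow Y hY m)) he h1).1

end Submodules

/-! ### The kernel of the Brauer map -/

section BrauerKernel

variable {O B C G G' : Type*} [CommRing O] [Ring B] [Algebra O B] [Ring C] [Algebra O C]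
  [Group G] [Group G']

lemma mem_fixedPts_iff_conj {θ : G →* Bˣ} {B₁ : Submodule O B} {H : Subgroup G} {a : B} :
    a ∈ fixedPts θ B₁ H ↔ a ∈ B₁ ∧ ∀ h ∈ H, (θ h : B) * a * ((θ h)⁻¹ : Bˣ) = a := by
  refine and_congr_right fun _ => forall₂_congr fun h _ => ?_
  rw [Units.mul_inv_eq_iff_eq_mul]

lemma fixedPts_mul_mem {θ : G →* Bˣ} {B₁ : Submodule O B} {H : Subgroup G}
    (hB₁ : ∀ a ∈ B₁, ∀ c ∈ B₁, a * c ∈ B₁) {a c : B} (ha : a ∈ fixedPts θ B₁ H)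
    (hc : c ∈ fixedPts θ B₁ H) : a * c ∈ fixedPts θ B₁ H :=
  ⟨hB₁ _ ha.1 _ hc.1, fun h hh => by
    rw [← mul_assoc, ha.2 h hh, mul_assoc, hc.2 h hh, mul_assoc]⟩

lemma relTrace_eq_finsum (θ : G →* Bˣ) {R H : Subgroup G} {R₀ : Subgroup H}
    (h : R.subgroupOf H = R₀) (a : B) :
    relTrace θ R H a = ∑ᶠ q : H ⧸ R₀, (θ (q.out : H) : B) * a * ((θ (q.out : H))⁻¹ : Bˣ) := by
  subst h; rfl

variable [IsLocalRing O]

lemma relTrace_mem_brauerKer {θ : G →* Bˣ} {B₁ : Submodule O B} {R H : Subgroup G} (hR : R < H)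
    {a : B} (ha : a ∈ fixedPts θ B₁ R) : relTrace θ R H a ∈ brauerKer θ B₁ H :=
  Submodule.mem_sup_left (Submodule.mem_iSup_of_mem R (Submodule.mem_iSup_of_mem hR
    (Submodule.subset_span ⟨a, ha, rfl⟩)))

/-- Let `H` act on `Ω` and let `F : Ω → B₁` be equivariant. Then the sum of the values of `F` at the
elements that are not fixed by `H` is a sum of proper relative traces. -/
lemma sum_not_fixed_mem_brauerKer (θ : G →* Bˣ) (B₁ : Submodule O B) (H : Subgroup G)
    {Ω : Type*} [Fintype Ω] (act : H →* Equiv.Perm Ω) (F : Ω → B) (hF₁ : ∀ ω, F ω ∈ B₁)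
    (hF : ∀ h ω, F (act h ω) = (θ h : B) * F ω * ((θ h)⁻¹ : Bˣ)) [DecidablePred fun ω => ∀ h, act h ω = ω] :
    ∑ ω with ¬ ∀ h, act h ω = ω, F ω ∈ brauerKer θ B₁ H := by
  classical
  let _ : MulAction H Ω := MulAction.compHom Ω act
  have hsmul : ∀ (h : H) (ω : Ω), h • ω = act h ω := fun _ _ => rfl
  rw [Finset.sum_filter]
  set F' : Ω → B := fun ω => if ¬ ∀ h, act h ω = ω then F ω else 0 with hF'
  have hfix : ∀ (h : H) ω, (∀ k, act k (act h ω) = act h ω) ↔ ∀ k, act k ω = ω := by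
    intro h ω
    constructor
    · intro hk k
      have h1 := hk (h * k * h⁻¹)
      rw [← Equiv.Perm.mul_apply, ← map_mul, inv_mul_cancel_right, map_mul, Equiv.Perm.mul_apply] at h1
      exact (act h).injective h1
    · intro hk k
      rw [hk h, hk k]
  have : ∀ o : Quotient (MulAction.orbitRel H Ω), Finite (H ⧸ MulAction.stabilizer H o.out) := fun o =>
    Finite.of_injective _ (MulAction.injective_ofQuotientStabilizer H o.out)
  have : ∀ o : Quotient (MulAction.orbitRel H Ω), Fintype (H ⧸ MulAction.stabilizer H o.out) := fun o =>
    Fintype.ofFinite _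
  have : Fintype (Quotient (MulAction.orbitRel H Ω)) := Fintype.ofFinite _
  -- The sum is cut into orbits. A one-point orbit contributes zero; on any other orbit the sum is
  -- the relative trace from the stabilizer, which is a proper subgroup.
  rw [← (MulAction.selfEquivSigmaOrbitsQuotientStabilizer H Ω).symm.sum_comp F', Fintype.sum_sigma]
  refine Submodule.sum_mem _ fun o _ => ?_
  have hval : ∀ q : H ⧸ MulAction.stabilizer H o.out,
      (MulAction.selfEquivSigmaOrbitsQuotientStabilizer H Ω).symm ⟨o, q⟩ = act q.out o.out := by
    intro q
    conv_lhs => rw [← q.out_eq']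
    rfl
  simp only [hval]
  by_cases ho : ∀ h, act h o.out = o.out
  · refine Submodule.sum_mem _ fun q _ => ?_
    have : F' (act q.out o.out) = 0 := by
      simp only [hF']
      rw [if_neg]
      rw [not_not]
      exact (hfix _ _).2 ho
    rw [this]; exact zero_mem _
  · have hF'' : ∀ q : H ⧸ MulAction.stabilizer H o.out, F' (act q.out o.out) =
        (θ (q.out : H) : B) * F o.out * ((θ (q.out : H))⁻¹ : Bˣ) := by
      intro q
      simp only [hF']
      rw [if_pos, hF]
      rw [hfix]; exact ho
    simp only [hF'']
    rw [← finsum_eq_sum_of_fintype,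
      ← relTrace_eq_finsum θ (R := (MulAction.stabilizer H o.out).map H.subtype)
        (Subgroup.comap_map_eq_self_of_injective H.subtype_injective _)]
    refine relTrace_mem_brauerKer (lt_of_le_of_ne ?_ ?_) ?_
    · rintro _ ⟨h, -, rfl⟩; exact h.2
    · intro heq
      refine ho fun h => ?_
      have : (h : G) ∈ (MulAction.stabilizer H o.out).map H.subtype := by rw [heq]; exact h.2
      obtain ⟨k, hk, hkh⟩ := this
      rw [← H.subtype_injective hkh]
      exact hk
    · refine mem_fixedPts_iff_conj.2 ⟨hF₁ _, ?_⟩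
      rintro _ ⟨h, hh, rfl⟩
      have h1 := hF h o.out
      have h2 : act h o.out = o.out := hh
      rw [h2] at h1
      exact h1.symm

/-- A proper relative trace is a sum over the cosets of `R` in `H`. Through the surjection `τ` the
group `H'` acts on them without fixed points, so the image is a sum over non-fixed elements. The
same statement serves for multiplication by a fixed element, for a change of group and for trace
maps. -/
lemma brauerKer_map {θ : G →* Bˣ} {B₁ : Submodule O B} {H : Subgroup G} [Finite H]
    {θ' : G' →* Cˣ} {C₁ : Submodule O C} {H' : Subgroup G'} (Φ : B →ₗ[O] C) (τ : H' →* H)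
    (hτ : Function.Surjective τ)
    (hB₁ : ∀ h ∈ H, ∀ a ∈ B₁, (θ h : B) * a * ((θ h)⁻¹ : Bˣ) ∈ B₁)
    (hΦ₁ : ∀ a ∈ B₁, Φ a ∈ C₁)
    (hΦ : ∀ (h : H') (a : B), Φ ((θ (τ h) : B) * a * ((θ (τ h))⁻¹ : Bˣ)) =
      (θ' h : C) * Φ a * ((θ' h)⁻¹ : Cˣ)) {a : B} (ha : a ∈ brauerKer θ B₁ H) :
    Φ a ∈ brauerKer θ' C₁ H' := by
  have hfixed : ∀ a ∈ fixedPts θ B₁ H, Φ a ∈ fixedPts θ' C₁ H' := fun a ha => by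
    rw [mem_fixedPts_iff_conj] at ha ⊢
    refine ⟨hΦ₁ a ha.1, fun h hh => ?_⟩
    rw [← hΦ ⟨h, hh⟩, ha.2 _ (τ _).2]
  suffices h : brauerKer θ B₁ H ≤ (brauerKer θ' C₁ H').comap Φ from h ha
  refine sup_le (iSup_le fun R => iSup_le fun hR => Submodule.span_le.2 ?_) ?_
  · rintro _ ⟨a, ha, rfl⟩
    rw [mem_fixedPts_iff_conj] at ha
    change Φ (relTrace θ R H a) ∈ brauerKer θ' C₁ H'
    have : Fintype (H ⧸ R.subgroupOf H) := Fintype.ofFinite _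
    classical
    unfold relTrace
    rw [finsum_eq_sum_of_fintype, map_sum]
    set F₀ : H ⧸ R.subgroupOf H → B := fun q => (θ (q.out : H) : B) * a * ((θ (q.out : H))⁻¹ : Bˣ)
      with hF₀
    -- The summand does not depend on the representative of the coset, since `a` is fixed by `R`.
    have hmk : ∀ h : H, F₀ (h : H ⧸ R.subgroupOf H) = (θ h : B) * a * ((θ h)⁻¹ : Bˣ) := by
      intro h
      obtain ⟨r, hr⟩ := QuotientGroup.mk_out_eq_mul (R.subgroupOf H) h
      simp only [hF₀, hr]
      have h1 := ha.2 (r : H) (Subgroup.mem_subgroupOf.1 r.2)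
      conv_rhs => rw [← h1]
      simp [mul_assoc]
    have hF₀h : ∀ (h : H) (q : H ⧸ R.subgroupOf H),
        F₀ (h • q) = (θ h : B) * F₀ q * ((θ h)⁻¹ : Bˣ) := by
      intro h q
      induction q using QuotientGroup.induction_on with
      | H k =>
        rw [MulAction.Quotient.smul_coe, hmk, hmk, smul_eq_mul]
        simp [mul_assoc]
    let act : H' →* Equiv.Perm (H ⧸ R.subgroupOf H) :=
      (MulAction.toPermHom H (H ⧸ R.subgroupOf H)).comp τ
    have h2 := sum_not_fixed_mem_brauerKer θ' C₁ H' act (fun q => Φ (F₀ q))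
      (fun q => hΦ₁ _ (hB₁ _ (q.out : H).2 _ ha.1)) (fun h q => by
        rw [← hΦ]
        exact congrArg Φ (hF₀h (τ h) q))
    rw [Finset.filter_true_of_mem] at h2
    · exact h2
    -- A coset `k R` fixed by all `k g k⁻¹` with `g ∈ H` forces `H ≤ R`.
    · rintro q - hq
      refine hR.not_ge fun g hg => ?_
      obtain ⟨k, rfl⟩ := QuotientGroup.mk_surjective q
      obtain ⟨h, hh⟩ := hτ (k * ⟨g, hg⟩ * k⁻¹)
      have h3 : τ h • (k : H ⧸ R.subgroupOf H) = k := hq h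
      rw [hh, MulAction.Quotient.smul_coe, smul_eq_mul, inv_mul_cancel_right, eq_comm,
        QuotientGroup.eq, inv_mul_cancel_left] at h3
      exact h3
  · rw [← Submodule.map_le_iff_le_comap, Submodule.map_smul'']
    refine le_sup_of_le_right (Submodule.smul_mono le_rfl ?_)
    rintro _ ⟨a, ha, rfl⟩
    exact hfixed a ha

lemma smul_fixedPts_le_brauerKer (θ : G →* Bˣ) (B₁ : Submodule O B) (H : Subgroup G) :
    IsLocalRing.maximalIdeal O • fixedPts θ B₁ H ≤ brauerKer θ B₁ H := le_sup_right

/-- Multiplication by a fixed element is equivariant. With its right-hand counterpart this makes the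
Brauer kernel stable under multiplication by fixed elements on both sides. -/
lemma mul_mem_brauerKer_left {θ : G →* Bˣ} {B₁ : Submodule O B} {H : Subgroup G} [Finite H]
    (hmul : ∀ a ∈ B₁, ∀ c ∈ B₁, a * c ∈ B₁)
    (hconj : ∀ h ∈ H, ∀ a ∈ B₁, (θ h : B) * a * ((θ h)⁻¹ : Bˣ) ∈ B₁) {a c : B}
    (hc : c ∈ fixedPts θ B₁ H) (ha : a ∈ brauerKer θ B₁ H) :
    c * a ∈ brauerKer θ B₁ H :=
  brauerKer_map (LinearMap.mulLeft O c) (MonoidHom.id H) Function.surjective_id hconj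
    (fun a ha => hmul _ hc.1 _ ha) (fun h a => by
      simp only [MonoidHom.id_apply, LinearMap.mulLeft_apply, ← mul_assoc]
      rw [hc.2 h h.2]) ha

lemma mul_mem_brauerKer_right {θ : G →* Bˣ} {B₁ : Submodule O B} {H : Subgroup G} [Finite H]
    (hmul : ∀ a ∈ B₁, ∀ c ∈ B₁, a * c ∈ B₁)
    (hconj : ∀ h ∈ H, ∀ a ∈ B₁, (θ h : B) * a * ((θ h)⁻¹ : Bˣ) ∈ B₁) {a c : B}
    (hc : c ∈ fixedPts θ B₁ H) (ha : a ∈ brauerKer θ B₁ H) :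
    a * c ∈ brauerKer θ B₁ H :=
  brauerKer_map (LinearMap.mulRight O c) (MonoidHom.id H) Function.surjective_id hconj
    (fun a ha => hmul _ ha _ hc.1) (fun h a => by
      simp only [MonoidHom.id_apply, LinearMap.mulRight_apply]
      have h1 := (mem_fixedPts_iff_conj.1 hc).2 h h.2
      have h2 : (((θ h)⁻¹ : Bˣ) : B) * c = c * ((θ h)⁻¹ : Bˣ) := by
        rw [Units.inv_mul_eq_iff_eq_mul, ← mul_assoc, h1]
      rw [mul_assoc _ _ c, h2]
      simp only [mul_assoc]) ha

end BrauerKernel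

/-! ### Homogeneous components and coefficients in `O G` and `S ⊗ O G` -/

noncomputable section

section GradeComp

variable {O G Γ : Type*} [CommRing O] [Group G] [Group Γ] {ω : G →* Γ}

lemma of_mem_gradeComp {g : G} {x : Γ} (h : ω g = x) : MonoidAlgebra.of O G g ∈ gradeComp O ω x :=
  Submodule.subset_span ⟨g, h, rfl⟩

lemma one_mem_gradeComp : (1 : MonoidAlgebra O G) ∈ gradeComp O ω 1 := by
  rw [← map_one (MonoidAlgebra.of O G)]
  exact of_mem_gradeComp (map_one ω)

lemma gradeComp_mul {x y : Γ} {a c : MonoidAlgebra O G} (ha : a ∈ gradeComp O ω x)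
    (hc : c ∈ gradeComp O ω y) : a * c ∈ gradeComp O ω (x * y) := by
  have h : gradeComp O ω x * gradeComp O ω y ≤ gradeComp O ω (x * y) := by
    rw [gradeComp, gradeComp, Submodule.span_mul_span, Submodule.span_le]
    rintro _ ⟨_, ⟨g, hg, rfl⟩, _, ⟨k, hk, rfl⟩, rfl⟩
    rw [Set.mem_ofPred_eq] at hg hk
    change MonoidAlgebra.of O G g * MonoidAlgebra.of O G k ∈ _
    rw [← map_mul]
    exact of_mem_gradeComp (by rw [map_mul, hg, hk])
  exact h (Submodule.mul_mem_mul ha hc)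

lemma coeff_eq_zero_of_mem_gradeComp {x : Γ} {a : MonoidAlgebra O G} (ha : a ∈ gradeComp O ω x)
    {g : G} (hg : ω g ≠ x) : a.coeff g = 0 := by
  refine Submodule.span_induction ?_ (by simp) (fun a c _ _ h1 h2 => by simp [h1, h2])
    (fun r a _ h => by simp [h]) ha
  rintro _ ⟨k, hk, rfl⟩
  have : k ≠ g := fun h => hg (h ▸ hk)
  simp [MonoidAlgebra.of_apply, this]

lemma sum_coeff_smul_of [Fintype G] (a : MonoidAlgebra O G) :
    ∑ g, a.coeff g • MonoidAlgebra.of O G g = a := by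
  classical
  ext k
  simp [MonoidAlgebra.of_apply, MonoidAlgebra.coeff_sum]

lemma groupUnits_val (g : G) : (groupUnits O G g : MonoidAlgebra O G) = MonoidAlgebra.of O G g := rfl

lemma groupUnits_inv_val (g : G) :
    ((groupUnits O G g)⁻¹ : (MonoidAlgebra O G)ˣ).val = MonoidAlgebra.of O G g⁻¹ := by
  rw [← map_inv]; rfl

lemma conj_mem_gradeComp (g : G) {x : Γ} {a : MonoidAlgebra O G} (ha : a ∈ gradeComp O ω x) :
    (groupUnits O G g : MonoidAlgebra O G) * a * ((groupUnits O G g)⁻¹ : (MonoidAlgebra O G)ˣ) ∈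
      gradeComp O ω (ω g * x * (ω g)⁻¹) := by
  rw [groupUnits_val, groupUnits_inv_val, ← map_inv]
  exact gradeComp_mul (gradeComp_mul (of_mem_gradeComp rfl) ha) (of_mem_gradeComp rfl)

end GradeComp

section TensorCoeff

variable {O S G Γ : Type*} [CommRing O] [Ring S] [Algebra O S] [Group G] [Group Γ] {ω : G →* Γ}

variable (O S) in
/-- The component `S ⊗ (O G)_x` of `S ⊗ O G`. -/
def tensorGradeComp (ω : G →* Γ) (x : Γ) : Submodule O (S ⊗[O] MonoidAlgebra O G) :=
  LinearMap.range ((gradeComp O ω x).subtype.lTensor S)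

lemma tmul_mem_tensorGradeComp (s : S) {x : Γ} {a : MonoidAlgebra O G} (ha : a ∈ gradeComp O ω x) :
    s ⊗ₜ[O] a ∈ tensorGradeComp O S ω x :=
  ⟨s ⊗ₜ ⟨a, ha⟩, by simp⟩

lemma tensorGradeComp_le {x : Γ} {V : Submodule O (S ⊗[O] MonoidAlgebra O G)}
    (h : ∀ s : S, ∀ a ∈ gradeComp O ω x, s ⊗ₜ[O] a ∈ V) : tensorGradeComp O S ω x ≤ V := by
  rintro _ ⟨t, rfl⟩
  induction t with
  | zero => simp
  | add a c ha hc => rw [map_add]; exact add_mem ha hc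
  | tmul s a => exact h s a a.2

lemma tensorGradeComp_mul {x y : Γ} {a c : S ⊗[O] MonoidAlgebra O G}
    (ha : a ∈ tensorGradeComp O S ω x) (hc : c ∈ tensorGradeComp O S ω y) :
    a * c ∈ tensorGradeComp O S ω (x * y) := by
  have h1 : ∀ s : S, ∀ a ∈ gradeComp O ω x, ∀ c ∈ tensorGradeComp O S ω y,
      s ⊗ₜ[O] a * c ∈ tensorGradeComp O S ω (x * y) := fun s a ha c hc => by
    refine tensorGradeComp_le (V := (tensorGradeComp O S ω (x * y)).comap
      (LinearMap.mulLeft O (s ⊗ₜ[O] a))) (fun s' a' ha' => ?_) hc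
    rw [Submodule.mem_comap, LinearMap.mulLeft_apply, Algebra.TensorProduct.tmul_mul_tmul]
    exact tmul_mem_tensorGradeComp _ (gradeComp_mul ha ha')
  exact tensorGradeComp_le (V := (tensorGradeComp O S ω (x * y)).comap (LinearMap.mulRight O c))
    (fun s a ha => h1 s a ha c hc) ha

/-- The coefficient in `S` of `g ∈ G` in an element of `S ⊗ O G`. -/
def tensorCoeff (g : G) : S ⊗[O] MonoidAlgebra O G →ₗ[O] S :=
  (TensorProduct.rid O S).toLinearMap ∘ₗ
    ((Finsupp.lapply g ∘ₗ (MonoidAlgebra.coeffLinearEquiv O).toLinearMap).lTensor S)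

@[simp]
lemma tensorCoeff_tmul (g : G) (s : S) (a : MonoidAlgebra O G) :
    tensorCoeff g (s ⊗ₜ[O] a) = a.coeff g • s := by
  simp only [tensorCoeff, LinearMap.comp_apply, LinearMap.lTensor_tmul, LinearEquiv.coe_coe,
    TensorProduct.rid_tmul]
  rfl

lemma sum_tensorCoeff [Fintype G] (y : S ⊗[O] MonoidAlgebra O G) :
    ∑ g, tensorCoeff g y ⊗ₜ[O] MonoidAlgebra.of O G g = y := by
  induction y with
  | zero => simp
  | add a c ha hc =>
    simp only [map_add, TensorProduct.add_tmul, Finset.sum_add_distrib, ha, hc]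
  | tmul s a =>
    simp only [tensorCoeff_tmul, TensorProduct.smul_tmul]
    rw [← TensorProduct.tmul_sum, sum_coeff_smul_of]

lemma tensorCoeff_eq_zero {x : Γ} {y : S ⊗[O] MonoidAlgebra O G} (hy : y ∈ tensorGradeComp O S ω x)
    {g : G} (hg : ω g ≠ x) : tensorCoeff g y = 0 :=
  tensorGradeComp_le (V := LinearMap.ker (tensorCoeff g)) (fun s a ha => by
    rw [LinearMap.mem_ker, tensorCoeff_tmul, coeff_eq_zero_of_mem_gradeComp ha hg, zero_smul]) hy

lemma tensorCoeff_mul_left (s : S) (k g : G) (y : S ⊗[O] MonoidAlgebra O G) :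
    tensorCoeff (k * g) ((s ⊗ₜ[O] MonoidAlgebra.of O G k) * y) = s * tensorCoeff g y := by
  induction y with
  | zero => simp
  | add a c ha hc => simp only [mul_add, map_add, ha, hc]
  | tmul t a =>
    rw [Algebra.TensorProduct.tmul_mul_tmul, tensorCoeff_tmul, tensorCoeff_tmul,
      MonoidAlgebra.of_apply, MonoidAlgebra.coeff_single_mul_apply, inv_mul_cancel_left, one_mul,
      mul_smul_comm]

lemma tensorCoeff_mul_right (s : S) (k g : G) (y : S ⊗[O] MonoidAlgebra O G) :
    tensorCoeff (g * k) (y * (s ⊗ₜ[O] MonoidAlgebra.of O G k)) = tensorCoeff g y * s := by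
  induction y with
  | zero => simp
  | add a c ha hc => simp only [add_mul, map_add, ha, hc]
  | tmul t a =>
    rw [Algebra.TensorProduct.tmul_mul_tmul, tensorCoeff_tmul, tensorCoeff_tmul,
      MonoidAlgebra.of_apply, MonoidAlgebra.coeff_mul_single_apply, mul_inv_cancel_right, mul_one,
      smul_mul_assoc]

variable {H : Type*} [Group H]

/-- The structural map of the `H`-interior algebra `S ⊗ O G`, for `H → Sˣ` and `H → G`. -/
def tensorInterior (κ : H →* Sˣ) (σ : H →* G) : H →* (S ⊗[O] MonoidAlgebra O G)ˣ :=
  MonoidHom.toHomUnits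
    { toFun := fun u => (κ u : S) ⊗ₜ[O] MonoidAlgebra.of O G (σ u)
      map_one' := by rw [map_one, map_one, map_one, Units.val_one, Algebra.TensorProduct.one_def]
      map_mul' := fun u v => by
        rw [map_mul, map_mul, map_mul, Units.val_mul, Algebra.TensorProduct.tmul_mul_tmul] }

lemma tensorInterior_val (κ : H →* Sˣ) (σ : H →* G) (u : H) :
    (tensorInterior (O := O) κ σ u).val = (κ u : S) ⊗ₜ[O] MonoidAlgebra.of O G (σ u) := rfl

lemma tensorInterior_inv_val (κ : H →* Sˣ) (σ : H →* G) (u : H) :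
    ((tensorInterior (O := O) κ σ u)⁻¹).val =
      ((κ u)⁻¹ : Sˣ).val ⊗ₜ[O] MonoidAlgebra.of O G (σ u)⁻¹ := by
  rw [← map_inv, ← map_inv, ← map_inv]; rfl

lemma conj_mem_tensorGradeComp_one (κ : H →* Sˣ) (σ : H →* G) (u : H) {a : S ⊗[O] MonoidAlgebra O G}
    (ha : a ∈ tensorGradeComp O S ω 1) :
    (tensorInterior (O := O) κ σ u).val * a * ((tensorInterior (O := O) κ σ u)⁻¹).val ∈
      tensorGradeComp O S ω 1 := by
  rw [tensorInterior_val, tensorInterior_inv_val]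
  have h := tensorGradeComp_mul (tensorGradeComp_mul
    (tmul_mem_tensorGradeComp ((κ u : S)) (of_mem_gradeComp (ω := ω) (O := O) (g := σ u) rfl)) ha)
    (tmul_mem_tensorGradeComp ((κ u)⁻¹ : Sˣ).val (of_mem_gradeComp (ω := ω) (O := O) (g := (σ u)⁻¹) rfl))
  simpa using h

end TensorCoeff

/-! ## Conjugacy of idempotents -/

section Conjugacy

variable {R : Type*} [Ring R]

/-- Idempotents `e`, `f` with `e f = e` and `f e = f` are conjugate by `1 - e + f`. -/
lemma conj_of_mul_eq_left {e f : R} (h1 : e * f = e) (h2 : f * e = f) :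
    (1 - e + f) * (1 + e - f) = 1 ∧ (1 + e - f) * (1 - e + f) = 1 ∧
      (1 - e + f) * e * (1 + e - f) = f := by
  have h3 : e * e = e := calc
    e * e = e * f * e := by rw [h1]
    _ = e := by rw [mul_assoc, h2, h1]
  have h4 : f * f = f := calc
    f * f = f * e * f := by rw [h2]
    _ = f := by rw [mul_assoc, h1, h2]
  refine ⟨?_, ?_, ?_⟩ <;> simp only [mul_add, add_mul, mul_sub, sub_mul, one_mul, mul_one, h1, h2, h3, h4] <;> abel

/-- Idempotents `e`, `f` with `e f = f` and `f e = e` are conjugate by `1 - e + f`. -/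
lemma conj_of_mul_eq_right {e f : R} (h1 : e * f = f) (h2 : f * e = e) :
    (1 - e + f) * (1 + e - f) = 1 ∧ (1 + e - f) * (1 - e + f) = 1 ∧
      (1 - e + f) * f * (1 + e - f) = e := by
  have h3 : e * e = e := calc
    e * e = e * (f * e) := by rw [h2]
    _ = e := by rw [← mul_assoc, h1, h2]
  have h4 : f * f = f := calc
    f * f = f * (e * f) := by rw [h1]
    _ = f := by rw [← mul_assoc, h2, h1]
  refine ⟨?_, ?_, ?_⟩ <;> simp only [mul_add, add_mul, mul_sub, sub_mul, one_mul, mul_one, h1, h2, h3, h4] <;> abel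

end Conjugacy
end

/-! ### Submodules of tensor products and fixed Peirce corners -/

noncomputable section

section TensorSubmodules

variable {O S A : Type*} [CommRing O] [Ring S] [Algebra O S] [Ring A] [Algebra O A]

variable (O) in
/-- The submodule of `S ⊗ A` spanned by the `s ⊗ a` with `s ∈ V`, `a ∈ W`. -/
def tmulSpan (V : Submodule O S) (W : Submodule O A) : Submodule O (S ⊗[O] A) :=
  Submodule.map₂ (TensorProduct.mk O S A) V W

variable {V V' V'' : Submodule O S} {W W' W'' : Submodule O A}

lemma tmul_mem_tmulSpan {s : S} {a : A} (hs : s ∈ V) (ha : a ∈ W) : s ⊗ₜ[O] a ∈ tmulSpan O V W :=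
  Submodule.apply_mem_map₂ _ hs ha

lemma tmulSpan_le {Z : Submodule O (S ⊗[O] A)} (h : ∀ s ∈ V, ∀ a ∈ W, s ⊗ₜ[O] a ∈ Z) :
    tmulSpan O V W ≤ Z :=
  Submodule.map₂_le.2 h

lemma tmulSpan_mul_le (hV : V * V' ≤ V'') (hW : W * W' ≤ W'') :
    tmulSpan O V W * tmulSpan O V' W' ≤ tmulSpan O V'' W'' := by
  rw [tmulSpan, tmulSpan, Submodule.map₂_eq_span_image2, Submodule.map₂_eq_span_image2,
    Submodule.span_mul_span, Submodule.span_le]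
  rintro _ ⟨_, ⟨s, hs, a, ha, rfl⟩, _, ⟨s', hs', a', ha', rfl⟩, rfl⟩
  change s ⊗ₜ[O] a * s' ⊗ₜ[O] a' ∈ tmulSpan O V'' W''
  rw [Algebra.TensorProduct.tmul_mul_tmul]
  exact tmul_mem_tmulSpan (hV (Submodule.mul_mem_mul hs hs')) (hW (Submodule.mul_mem_mul ha ha'))

/-- Nilpotency of one tensor factor passes to the product as soon as the other factor is closed
under multiplication. -/
lemma tmulSpan_pow_le_left (hW : W * W ≤ W) (n : ℕ) :
    tmulSpan O V W ^ (n + 1) ≤ tmulSpan O (V ^ (n + 1)) W := by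
  induction n with
  | zero => simp
  | succ n ih =>
    rw [pow_succ]
    exact (mul_le_mul_left ih _).trans (tmulSpan_mul_le (pow_succ V (n + 1)).ge hW)

lemma tmulSpan_pow_le_right (hV : V * V ≤ V) (n : ℕ) :
    tmulSpan O V W ^ (n + 1) ≤ tmulSpan O V (W ^ (n + 1)) := by
  induction n with
  | zero => simp
  | succ n ih =>
    rw [pow_succ]
    exact (mul_le_mul_left ih _).trans (tmulSpan_mul_le hV (pow_succ W (n + 1)).ge)

lemma tmulSpan_mono (hV : V ≤ V') (hW : W ≤ W') : tmulSpan O V W ≤ tmulSpan O V' W' :=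
  Submodule.map₂_le_map₂ hV hW

lemma tmulSpan_smul_left (I : Ideal O) : tmulSpan O (I • V) W ≤ I • tmulSpan O V W := by
  refine tmulSpan_le fun s hs a ha => ?_
  refine Submodule.smul_induction_on hs (fun r hr t ht => ?_) fun t t' h h' => ?_
  · rw [← TensorProduct.smul_tmul']
    exact Submodule.smul_mem_smul hr (tmul_mem_tmulSpan ht ha)
  · rw [TensorProduct.add_tmul]; exact add_mem h h'

lemma tmulSpan_smul_right (I : Ideal O) : tmulSpan O V (I • W) ≤ I • tmulSpan O V W := by
  refine tmulSpan_le fun s hs a ha => ?_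
  refine Submodule.smul_induction_on ha (fun r hr t ht => ?_) fun t t' h h' => ?_
  · rw [TensorProduct.tmul_smul]
    exact Submodule.smul_mem_smul hr (tmul_mem_tmulSpan hs ht)
  · rw [TensorProduct.tmul_add]; exact add_mem h h'

end TensorSubmodules

section PeirceFixed

variable {O B G : Type*} [CommRing O] [Ring B] [Algebra O B] [Group G]

/-- The submodule `j B₁ ^ H j`. -/
def peirceFixed (θ : G →* Bˣ) (B₁ : Submodule O B) (H : Subgroup G) (j : B) : Submodule O B :=
  fixedPts θ B₁ H ⊓ peirceComp O j j

variable {θ : G →* Bˣ} {B₁ : Submodule O B} {H : Subgroup G} {j : B}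

lemma peirceFixed_mul (hB₁ : ∀ a ∈ B₁, ∀ c ∈ B₁, a * c ∈ B₁) :
    peirceFixed θ B₁ H j * peirceFixed θ B₁ H j ≤ peirceFixed θ B₁ H j :=
  Submodule.mul_le.2 fun a ha c hc => ⟨fixedPts_mul_mem hB₁ ha.1 hc.1, by
    rw [← mul_assoc, ha.2.1], by rw [mul_assoc, hc.2.2]⟩

variable [IsLocalRing O] {J : Submodule O B}

lemma IsRadicalAt.le_peirceFixed (hJ : IsRadicalAt (fixedPts θ B₁ H) j J) :
    J ≤ peirceFixed θ B₁ H j :=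
  fun a ha => ⟨hJ.le ha, hJ.left a ha, hJ.right a ha⟩

lemma IsRadicalAt.mul_peirceFixed (hJ : IsRadicalAt (fixedPts θ B₁ H) j J) :
    J * peirceFixed θ B₁ H j ≤ J :=
  Submodule.mul_le.2 fun a ha c hc => hJ.mul_mem_right a ha c hc.1 hc.2.1 hc.2.2

lemma IsRadicalAt.peirceFixed_mul (hJ : IsRadicalAt (fixedPts θ B₁ H) j J) :
    peirceFixed θ B₁ H j * J ≤ J :=
  Submodule.mul_le.2 fun c hc a ha => hJ.mul_mem_left a ha c hc.1 hc.2.1 hc.2.2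

end PeirceFixed
end

/-! ### Idempotents of `(S ⊗ (O G)_1) ^ H` and the Brauer map -/

noncomputable section

section Transfer

variable {O S G Γ H : Type*} [CommRing O] [Ring S] [Algebra O S] [Group G] [Group Γ] [Group H]
  {ω : G →* Γ} {κ : H →* Sˣ} {σ : H →* G}

variable (O κ ω σ) in
/-- The algebra `(S ⊗ (O G)_1) ^ H`. -/
abbrev tensorFixed : Submodule O (S ⊗[O] MonoidAlgebra O G) :=
  fixedPts (tensorInterior κ σ) (tensorGradeComp O S ω 1) ⊤

variable (O κ ω σ) in
/-- The kernel of the Brauer map on `(S ⊗ (O G)_1) ^ H`. -/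
abbrev tensorBrauerKer [IsLocalRing O] : Submodule O (S ⊗[O] MonoidAlgebra O G) :=
  brauerKer (tensorInterior κ σ) (tensorGradeComp O S ω 1) ⊤

variable (O ω σ) in
/-- The algebra `(O G)_1 ^ H`. -/
abbrev groupFixed : Submodule O (MonoidAlgebra O G) :=
  fixedPts ((groupUnits O G).comp σ) (gradeComp O ω 1) ⊤

lemma groupFixed_comm {a : MonoidAlgebra O G} (ha : a ∈ groupFixed O ω σ) (u : H) :
    MonoidAlgebra.of O G (σ u) * a = a * MonoidAlgebra.of O G (σ u) :=
  ha.2 u trivial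

lemma mem_groupFixed {a : MonoidAlgebra O G} (h1 : a ∈ gradeComp O ω 1)
    (h2 : ∀ u, MonoidAlgebra.of O G (σ u) * a = a * MonoidAlgebra.of O G (σ u)) :
    a ∈ groupFixed O ω σ := ⟨h1, fun u _ => h2 u⟩

lemma gradeComp_one_mul {a c : MonoidAlgebra O G} (ha : a ∈ gradeComp O ω 1)
    (hc : c ∈ gradeComp O ω 1) : a * c ∈ gradeComp O ω 1 := by
  simpa using gradeComp_mul ha hc

lemma tensorGradeComp_one_mul {a c : S ⊗[O] MonoidAlgebra O G} (ha : a ∈ tensorGradeComp O S ω 1)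
    (hc : c ∈ tensorGradeComp O S ω 1) : a * c ∈ tensorGradeComp O S ω 1 := by
  have h := tensorGradeComp_mul ha hc
  rwa [one_mul] at h

lemma tensorFixed_mul {a c : S ⊗[O] MonoidAlgebra O G} (ha : a ∈ tensorFixed O ω κ σ)
    (hc : c ∈ tensorFixed O ω κ σ) : a * c ∈ tensorFixed O ω κ σ := by
  refine fixedPts_mul_mem ?_ ha hc
  exact fun _ h _ h' => tensorGradeComp_one_mul h h'

lemma tmul_mem_tensorFixed {s : S} {a : MonoidAlgebra O G}
    (hs : s ∈ fixedPts (O := O) κ ⊤ ⊤) (ha : a ∈ groupFixed O ω σ) :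
    s ⊗ₜ[O] a ∈ tensorFixed O ω κ σ :=
  ⟨tmul_mem_tensorGradeComp s ha.1, fun u hu => by
    rw [tensorInterior_val, Algebra.TensorProduct.tmul_mul_tmul, Algebra.TensorProduct.tmul_mul_tmul,
      hs.2 u hu, groupFixed_comm ha]⟩

variable [IsLocalRing O] [Finite H]

lemma mul_tensorBrauerKer {a c : S ⊗[O] MonoidAlgebra O G} (hc : c ∈ tensorFixed O ω κ σ)
    (ha : a ∈ tensorBrauerKer O ω κ σ) : c * a ∈ tensorBrauerKer O ω κ σ := by
  refine mul_mem_brauerKer_left ?_ ?_ hc ha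
  · exact fun _ h _ h' => tensorGradeComp_one_mul h h'
  · exact fun u _ _ h => conj_mem_tensorGradeComp_one κ σ u h

lemma tensorBrauerKer_mul {a c : S ⊗[O] MonoidAlgebra O G} (hc : c ∈ tensorFixed O ω κ σ)
    (ha : a ∈ tensorBrauerKer O ω κ σ) : a * c ∈ tensorBrauerKer O ω κ σ := by
  refine mul_mem_brauerKer_right ?_ ?_ hc ha
  · exact fun _ h _ h' => tensorGradeComp_one_mul h h'
  · exact fun u _ _ h => conj_mem_tensorGradeComp_one κ σ u h

/-- An idempotent of `(S ⊗ (O G)_1) ^ H` that lies in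
`J_S ⊗ j (O G)_1^H j + l S^H l ⊗ J` modulo the kernel of the Brauer map lies in this kernel. -/
lemma mem_tensorBrauerKer_of_radical {l : S} {j : MonoidAlgebra O G} {JS : Submodule O S}
    {J : Submodule O (MonoidAlgebra O G)}
    (hJS : IsRadicalAt (fixedPts (O := O) κ ⊤ ⊤) l JS) (hJ : IsRadicalAt (groupFixed O ω σ) j J)
    {e : S ⊗[O] MonoidAlgebra O G} (hee : e * e = e) (he : e ∈ tensorFixed O ω κ σ)
    {c : S ⊗[O] MonoidAlgebra O G}
    (hc : c ∈ tmulSpan O JS (peirceFixed ((groupUnits O G).comp σ) (gradeComp O ω 1) ⊤ j) ⊔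
      tmulSpan O (peirceFixed κ (⊤ : Submodule O S) ⊤ l) J)
    (hec : e - c ∈ tensorBrauerKer O ω κ σ) : e ∈ tensorBrauerKer O ω κ σ := by
  have hZA : peirceFixed ((groupUnits O G).comp σ) (gradeComp O ω 1) ⊤ j *
      peirceFixed ((groupUnits O G).comp σ) (gradeComp O ω 1) ⊤ j ≤
      peirceFixed ((groupUnits O G).comp σ) (gradeComp O ω 1) ⊤ j :=
    peirceFixed_mul fun _ h _ h' => gradeComp_one_mul h h'
  have hZS : peirceFixed κ (⊤ : Submodule O S) ⊤ l * peirceFixed κ (⊤ : Submodule O S) ⊤ l ≤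
      peirceFixed κ (⊤ : Submodule O S) ⊤ l := peirceFixed_mul fun _ _ _ _ => trivial
  have hsub : ∀ V ≤ fixedPts (O := O) κ ⊤ ⊤, ∀ W ≤ groupFixed O ω σ,
      tmulSpan O V W ≤ tensorFixed O ω κ σ := fun V hV W hW =>
    tmulSpan_le fun s hs a ha => tmul_mem_tensorFixed (hV hs) (hW ha)
  have hm : IsLocalRing.maximalIdeal O •
      tmulSpan O (fixedPts (O := O) κ ⊤ ⊤) (groupFixed O ω σ) ≤ tensorBrauerKer O ω κ σ :=
    (Submodule.smul_mono le_rfl (hsub _ le_rfl _ le_rfl)).trans (smul_fixedPts_le_brauerKer _ _ _)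
  obtain ⟨n, hn⟩ := hJS.pow_le
  obtain ⟨m, hm'⟩ := hJ.pow_le
  -- The roles of `X` and `Y` are played by `J_S ⊗ j (O G)_1^H j` and `l S^H l ⊗ J`. Each is
  -- nilpotent modulo the maximal ideal because one tensor factor is, and `X` normalizes `Y` because
  -- `J` is an ideal of `j (O G)_1^H j`.
  exact idempotent_mem_of_nilpotent (F := tensorFixed O ω κ σ)
    (Submodule.mul_le.2 fun _ ha _ hb => tensorFixed_mul ha hb)
    (Submodule.mul_le.2 fun _ ha _ hb => mul_tensorBrauerKer ha hb)
    (Submodule.mul_le.2 fun _ hb _ ha => tensorBrauerKer_mul ha hb)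
    (hsub _ hJS.le _ inf_le_left) (hsub _ inf_le_left _ hJ.le)
    (tmulSpan_mul_le ((mul_le_mul' hJS.le_peirceFixed le_rfl).trans hZS) hJ.peirceFixed_mul)
    (tmulSpan_mul_le ((mul_le_mul' le_rfl hJS.le_peirceFixed).trans hZS) hJ.mul_peirceFixed)
    (tmulSpan_mul_le hZS ((mul_le_mul' le_rfl hJ.le_peirceFixed).trans hJ.mul_peirceFixed))
    (((tmulSpan_pow_le_left hZA n).trans
      ((tmulSpan_mono hn inf_le_left).trans (tmulSpan_smul_left _))).trans hm)
    (((tmulSpan_pow_le_right hZS m).trans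
      ((tmulSpan_mono inf_le_left hm').trans (tmulSpan_smul_right _))).trans hm)
    hee he hc hec

end Transfer
end

/-! ### From one-sided inverses to units of `S` and elements of `G` -/

noncomputable section

section Realize

variable {O S G Γ H : Type*} [CommRing O] [Ring S] [Algebra O S] [Group G] [Group Γ] [Group H]
  {ω : G →* Γ} {κ : H →* Sˣ} {σ : H →* G}

/-- The unit is `c + (1 - l)`. A right inverse of `c` in `l S l` is enough, because one-sided
inverses in the finite algebra `S` are two-sided. -/
lemma exists_unit_conj [IsNoetherianRing O] [Module.Finite O S] {l c d : S} {φ : MulAut H}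
    (hl : ∀ u, (κ u : S) * l = l * κ u) (hll : l * l = l)
    (hlc : l * c = c) (hcl : c * l = c) (hld : l * d = d) (hcd : c * d = l)
    (hc : ∀ u, (κ (φ u) : S) * c = c * κ u) :
    ∃ s : Sˣ, ∀ u, (s : S) * (κ u * l) * (s⁻¹ : Sˣ) = κ (φ u) * l := by
  have h1 : (c + (1 - l)) * (d + (1 - l)) = 1 := by
    simp only [mul_add, add_mul, mul_sub, sub_mul, mul_one, one_mul, hcl, hld, hll, hcd]
    abel
  refine ⟨⟨c + (1 - l), d + (1 - l), h1, mul_eq_one_comm_of_finite (O := O) h1⟩, fun u => ?_⟩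
  rw [Units.mul_inv_eq_iff_eq_mul]
  change (c + (1 - l)) * (κ u * l) = κ (φ u) * l * (c + (1 - l))
  have h2 : (1 - l) * (κ u * l) = 0 := by
    rw [hl, ← mul_assoc, sub_mul, one_mul, hll, sub_self, zero_mul]
  have h3 : l * (c + (1 - l)) = c := by rw [mul_add, mul_sub, mul_one, hlc, hll, sub_self, add_zero]
  rw [add_mul, h2, add_zero, mul_assoc _ l, h3, hl, ← mul_assoc, hcl, hc]

/-- Primitivity of `j` upgrades the right inverse `d` to `d g j = j`. Then `z = g d` is an
idempotent that satisfies `j z = j`, `z j = z`, and also `(g j g⁻¹) z = z`, `z (g j g⁻¹) = g j g⁻¹`.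
So `z` links `j` to `g j g⁻¹` by two elementary conjugations with fixed units. -/
lemma fixedConj_of_right_inv {j : MonoidAlgebra O G}
    (hj : IsPrimitiveIdempotentIn (groupFixed O ω σ) j) {φ : MulAut H} {x : Γ} {g : G}
    (hg : ω g = x) (hgσ : ∀ u, σ (φ u) * g = g * σ u) {d : MonoidAlgebra O G}
    (hd : d ∈ gradeComp O ω x⁻¹) (hdσ : ∀ u, MonoidAlgebra.of O G (σ u) * d =
      d * MonoidAlgebra.of O G (σ (φ u))) (hjd : j * d = d) (hdj : d * j = d)
    (hgd : j * MonoidAlgebra.of O G g * d = j) :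
    FixedConj ((groupUnits O G).comp σ) (gradeComp O ω 1) ⊤ j
      (MonoidAlgebra.of O G g * j * MonoidAlgebra.of O G g⁻¹) := by
  obtain ⟨hjF, hjj, hj0, hprim⟩ := hj
  set γ := MonoidAlgebra.of O G g with hγ
  set γ' := MonoidAlgebra.of O G g⁻¹ with hγ'
  have hγγ' : γ * γ' = 1 := by rw [hγ, hγ', ← map_mul, mul_inv_cancel, map_one]
  have hγ'γ : γ' * γ = 1 := by rw [hγ, hγ', ← map_mul, inv_mul_cancel, map_one]
  have hcomm : ∀ u, MonoidAlgebra.of O G (σ (φ u)) * γ = γ * MonoidAlgebra.of O G (σ u) :=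
    fun u => by rw [hγ, ← map_mul, ← map_mul, hgσ]
  have hcomm' : ∀ u, MonoidAlgebra.of O G (σ u) * γ' = γ' * MonoidAlgebra.of O G (σ (φ u)) :=
    fun u => by
      rw [hγ', ← map_mul, ← map_mul]
      congr 1
      rw [eq_inv_mul_iff_mul_eq, ← mul_assoc, ← hgσ, mul_inv_cancel_right]
  have hγx : γ ∈ gradeComp O ω x := of_mem_gradeComp hg
  have hγ'x : γ' ∈ gradeComp O ω x⁻¹ := of_mem_gradeComp (by rw [map_inv, hg])
  have hjσ := groupFixed_comm hjF
  -- the idempotent `d g j` of `j (O G)_1 ^ H j` is equal to `j`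
  have hjgd : ∀ y, j * (γ * (d * y)) = j * y := fun y => by
    rw [← mul_assoc γ, ← mul_assoc, ← mul_assoc j γ d, hgd]
  have e0 : d * γ * j = j := by
    have h1 : d * γ * j ∈ groupFixed O ω σ := by
      refine mem_groupFixed ?_ fun u => ?_
      · have := gradeComp_mul (gradeComp_mul hd hγx) hjF.1
        simpa using this
      · rw [mul_assoc, ← mul_assoc, hdσ, mul_assoc d, ← mul_assoc _ γ, hcomm, mul_assoc γ, hjσ]
        simp only [mul_assoc]
    have h2 : d * γ * j * (d * γ * j) = d * γ * j := by
      have h : d * γ * d = d := by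
        have := congrArg (d * ·) hgd
        simp only [← mul_assoc, hdj] at this
        exact this
      rw [mul_assoc (d * γ), ← mul_assoc j, ← mul_assoc j, hjd, ← mul_assoc, ← mul_assoc, h]
    rcases hprim _ h1 h2 (by rw [← mul_assoc, ← mul_assoc, hjd]) (by rw [mul_assoc, hjj]) with h | h
    · exfalso
      -- If `d g j` vanished, then so would `j g j`, and hence `j = j g j d`.
      have h3 : j * γ * j * (d * γ * j) = j * γ * j := by
        rw [mul_assoc _ j, ← mul_assoc j (d * γ), ← mul_assoc j d, hjd]
        simp only [mul_assoc]
        rw [hjgd]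
      rw [h, mul_zero] at h3
      have h4 : j * γ * j * d = j := by rw [mul_assoc _ j, hjd, hgd]
      rw [← h3, zero_mul] at h4
      exact hj0 h4.symm
    · exact h
  set z := γ * d with hz
  set j₁ := γ * j * γ' with hj₁
  have hzj : z * j = z := by rw [hz, mul_assoc, hdj]
  have hjz : j * z = j := by rw [hz, ← mul_assoc, hgd]
  have hj₁z : j₁ * z = z := by
    rw [hj₁, hz, mul_assoc _ γ', ← mul_assoc γ' γ, hγ'γ, one_mul, mul_assoc, hjd]
  have hzj₁ : z * j₁ = j₁ := by
    rw [hj₁, hz, mul_assoc γ d, ← mul_assoc d, ← mul_assoc d, e0, ← mul_assoc]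
  have hzF : z ∈ groupFixed O ω σ := by
    refine mem_groupFixed (by simpa using gradeComp_mul hγx hd) fun u => ?_
    obtain ⟨v, rfl⟩ := φ.surjective u
    rw [hz, ← mul_assoc, hcomm, mul_assoc, hdσ, mul_assoc]
  have hj₁F : j₁ ∈ groupFixed O ω σ := by
    refine mem_groupFixed (by simpa using gradeComp_mul (gradeComp_mul hγx hjF.1) hγ'x) fun u => ?_
    obtain ⟨v, rfl⟩ := φ.surjective u
    rw [hj₁, ← mul_assoc, ← mul_assoc, hcomm, mul_assoc γ, hjσ, mul_assoc, mul_assoc, hcomm']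
    simp only [mul_assoc]
  have h1F : (1 : MonoidAlgebra O G) ∈ groupFixed O ω σ :=
    mem_groupFixed one_mem_gradeComp fun u => by rw [one_mul, mul_one]
  -- The first unit takes `j` to `z` and the second takes `g j g⁻¹` to `z`; the required unit is the
  -- first followed by the inverse of the second.
  obtain ⟨a1, a2, a3⟩ := conj_of_mul_eq_left (e := j) (f := z) hjz hzj
  obtain ⟨b1, b2, b3⟩ := conj_of_mul_eq_right (e := z) (f := j₁) hzj₁ hj₁z
  have hmul : ∀ a ∈ groupFixed O ω σ, ∀ c ∈ groupFixed O ω σ, a * c ∈ groupFixed O ω σ :=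
    fun a ha c hc => fixedPts_mul_mem (fun _ h _ h' => gradeComp_one_mul h h') ha hc
  refine ⟨⟨(1 + z - j₁) * (1 - j + z), (1 + j - z) * (1 - z + j₁), ?_, ?_⟩, ?_, ?_, ?_⟩
  · rw [mul_assoc, ← mul_assoc (1 - j + z), a1, one_mul, b2]
  · rw [mul_assoc, ← mul_assoc (1 - z + j₁), b1, one_mul, a2]
  · exact hmul _ (sub_mem (add_mem h1F hzF) hj₁F) _ (add_mem (sub_mem h1F hjF) hzF)
  · exact hmul _ (sub_mem (add_mem h1F hjF) hzF) _ (add_mem (sub_mem h1F hzF) hj₁F)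
  · change j₁ = (1 + z - j₁) * (1 - j + z) * j * ((1 + j - z) * (1 - z + j₁))
    have : (1 + z - j₁) * (1 - j + z) * j * ((1 + j - z) * (1 - z + j₁)) =
      (1 + z - j₁) * ((1 - j + z) * j * (1 + j - z)) * (1 - z + j₁) := by simp only [mul_assoc]
    rw [this, a3]
    have h := congrArg (fun t => (1 + z - j₁) * t * (1 - z + j₁)) b3
    refine Eq.trans ?_ h
    have : (1 + z - j₁) * ((1 - z + j₁) * j₁ * (1 + z - j₁)) * (1 - z + j₁) =
      ((1 + z - j₁) * (1 - z + j₁)) * j₁ * ((1 + z - j₁) * (1 - z + j₁)) := by simp only [mul_assoc]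
    rw [this, b2, one_mul, mul_one]

end Realize
end

/-! ### Expansion over pairs of group elements -/

noncomputable section

section Realize

variable {O S G Γ H : Type*} [CommRing O] [Ring S] [Algebra O S] [Group G] [Group Γ] [Group H]
  {ω : G →* Γ} {κ : H →* Sˣ} {σ : H →* G}

/-- The action `u • (g, h) = (σ(u) g σ(φ⁻¹(u))⁻¹, σ(φ⁻¹(u)) h σ(u)⁻¹)` of `H` on `G × G`. -/
def twistedPairAction (σ : H →* G) (φ : MulAut H) : H →* Equiv.Perm (G × G) :=
  MonoidHom.toHomPerm
    { toFun := fun u q => (σ u * q.1 * (σ (φ⁻¹ u))⁻¹, σ (φ⁻¹ u) * q.2 * (σ u)⁻¹)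
      map_one' := by
        funext q
        change (_, _) = q
        simp
      map_mul' := fun u v => by
        funext q
        change (_, _) = (σ u * (σ v * q.1 * (σ (φ⁻¹ v))⁻¹) * (σ (φ⁻¹ u))⁻¹,
          σ (φ⁻¹ u) * (σ (φ⁻¹ v) * q.2 * (σ v)⁻¹) * (σ u)⁻¹)
        simp only [map_mul, mul_inv_rev, mul_assoc] }

lemma twistedPairAction_apply (φ : MulAut H) (u : H) (q : G × G) :
    twistedPairAction σ φ u q = (σ u * q.1 * (σ (φ⁻¹ u))⁻¹, σ (φ⁻¹ u) * q.2 * (σ u)⁻¹) := rfl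

/-- Both sides are the coefficient at `σ u * g` of the same element, computed once from the left and
once from the right. -/
lemma tensorCoeff_twist {y : S ⊗[O] MonoidAlgebra O G} {u v : H}
    (h : (tensorInterior (O := O) κ σ u).val * y = y * (tensorInterior (O := O) κ σ v).val) (g : G) :
    tensorCoeff (σ u * g * (σ v)⁻¹) y * κ v = κ u * tensorCoeff g y := by
  rw [tensorInterior_val, tensorInterior_val] at h
  rw [← tensorCoeff_mul_left (κ u : S) (σ u) g y, h, ← tensorCoeff_mul_right (κ v : S) (σ v),
    inv_mul_cancel_right]

/-- Stated in an arbitrary ring because it is used in both tensor factors: for coefficients in `S`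
with `l`, and for group elements with `j`. -/
lemma corner_mul_twist {R : Type*} [Ring R] {l a b s₁ s₂ t₁ t₂ : R} (ha : a * l = l * a)
    (hb : b * l = l * b) (h₁ : t₁ * b = a * s₁) (h₂ : t₂ * a = b * s₂) :
    l * t₁ * l * (l * t₂ * l) * a = a * (l * s₁ * l * (l * s₂ * l)) := by
  calc _ = l * t₁ * l * (l * (t₂ * a) * l) := by simp only [mul_assoc, ha]
    _ = l * (t₁ * b) * l * (l * s₂ * l) := by
      rw [h₂]
      simp only [mul_assoc]
      rw [← mul_assoc l b, ← hb, mul_assoc, ← mul_assoc l b, ← hb]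
      simp only [mul_assoc]
    _ = _ := by
      rw [h₁]
      simp only [← mul_assoc, ha]

/-- Compressing the expansion by `l ⊗ j` does not change `y`, and it puts each term into the two
corners where primitivity can be applied. -/
lemma sum_tensorCoeff_corner [Fintype G] {l : S} {j : MonoidAlgebra O G}
    {y : S ⊗[O] MonoidAlgebra O G} (h1 : l ⊗ₜ[O] j * y = y) (h2 : y * l ⊗ₜ[O] j = y) :
    ∑ g, (l * tensorCoeff g y * l) ⊗ₜ[O] (j * MonoidAlgebra.of O G g * j) = y := by
  conv_rhs => rw [← h1, ← h2, ← sum_tensorCoeff y]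
  rw [Finset.sum_mul, Finset.mul_sum]
  refine Finset.sum_congr rfl fun g _ => ?_
  rw [Algebra.TensorProduct.tmul_mul_tmul, Algebra.TensorProduct.tmul_mul_tmul, mul_assoc, mul_assoc]

/-- The term of `(l ⊗ j) y (l ⊗ j) y' (l ⊗ j)` at a pair of elements of `G`. -/
def cornerTerm (l : S) (j : MonoidAlgebra O G) (y y' : S ⊗[O] MonoidAlgebra O G) (q : G × G) :
    S ⊗[O] MonoidAlgebra O G :=
  ((l * tensorCoeff q.1 y * l) * (l * tensorCoeff q.2 y' * l)) ⊗ₜ[O]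
    ((j * MonoidAlgebra.of O G q.1 * j) * (j * MonoidAlgebra.of O G q.2 * j))

lemma sum_cornerTerm [Fintype G] {l : S} {j : MonoidAlgebra O G}
    {y y' : S ⊗[O] MonoidAlgebra O G}
    (h1 : l ⊗ₜ[O] j * y = y) (h2 : y * l ⊗ₜ[O] j = y)
    (h1' : l ⊗ₜ[O] j * y' = y') (h2' : y' * l ⊗ₜ[O] j = y') :
    ∑ q, cornerTerm l j y y' q = y * y' := by
  conv_rhs => rw [← sum_tensorCoeff_corner h1 h2, ← sum_tensorCoeff_corner h1' h2']
  rw [Fintype.sum_mul_sum, Fintype.sum_prod_type]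
  refine Finset.sum_congr rfl fun g _ => Finset.sum_congr rfl fun h _ => ?_
  rw [Algebra.TensorProduct.tmul_mul_tmul]
  rfl

lemma cornerTerm_eq_zero {l : S} {j : MonoidAlgebra O G} {x : Γ}
    {y y' : S ⊗[O] MonoidAlgebra O G} (hy : y ∈ tensorGradeComp O S ω x)
    (hy' : y' ∈ tensorGradeComp O S ω x⁻¹) {q : G × G} (hq : ¬ (ω q.1 = x ∧ ω q.2 = x⁻¹)) :
    cornerTerm l j y y' q = 0 := by
  rcases not_and_or.1 hq with hg | hh
  · rw [cornerTerm, tensorCoeff_eq_zero hy hg, mul_zero, zero_mul, zero_mul, TensorProduct.zero_tmul]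
  · rw [cornerTerm, tensorCoeff_eq_zero hy' hh, mul_zero, zero_mul, mul_zero, TensorProduct.zero_tmul]

lemma corner_of_mul_mem {j : MonoidAlgebra O G} (hj : j ∈ gradeComp O ω 1) {x : Γ} {g h : G}
    (hg : ω g = x) (hh : ω h = x⁻¹) :
    (j * MonoidAlgebra.of O G g * j) * (j * MonoidAlgebra.of O G h * j) ∈ gradeComp O ω 1 := by
  have h3 := gradeComp_mul (gradeComp_mul (gradeComp_mul hj (of_mem_gradeComp (O := O) hg)) hj)
    (gradeComp_mul (gradeComp_mul hj (of_mem_gradeComp (O := O) hh)) hj)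
  rwa [one_mul, mul_one, one_mul, mul_one, mul_inv_cancel] at h3

lemma cornerTerm_mem {l : S} {j : MonoidAlgebra O G} (hj : j ∈ gradeComp O ω 1) {x : Γ}
    {y y' : S ⊗[O] MonoidAlgebra O G} (hy : y ∈ tensorGradeComp O S ω x)
    (hy' : y' ∈ tensorGradeComp O S ω x⁻¹) (q : G × G) :
    cornerTerm l j y y' q ∈ tensorGradeComp O S ω 1 := by
  by_cases hq : ω q.1 = x ∧ ω q.2 = x⁻¹
  · exact tmul_mem_tensorGradeComp _ (corner_of_mul_mem hj hq.1 hq.2)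
  · rw [cornerTerm_eq_zero hy hy' hq]
    exact Submodule.zero_mem _

/-- The twist by `φ` in `y` and the opposite twist in `y'` cancel in the product, so that the action
on pairs corresponds to genuine conjugation by `H`. -/
lemma cornerTerm_act {l : S} {j : MonoidAlgebra O G}
    (hl : ∀ u, (κ u : S) * l = l * κ u) (hj : j ∈ groupFixed O ω σ)
    {φ : MulAut H} {y y' : S ⊗[O] MonoidAlgebra O G}
    (hφ : ∀ u, (tensorInterior (O := O) κ σ (φ u)).val * y = y * (tensorInterior (O := O) κ σ u).val)
    (hφ' : ∀ u, (tensorInterior (O := O) κ σ u).val * y' =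
      y' * (tensorInterior (O := O) κ σ (φ u)).val) (u : H) (q : G × G) :
    cornerTerm l j y y' (twistedPairAction σ φ u q) =
      (tensorInterior (O := O) κ σ u).val * cornerTerm l j y y' q *
        (tensorInterior (O := O) κ σ u)⁻¹.val := by
  obtain ⟨v, rfl⟩ := φ.surjective u
  rw [Units.eq_mul_inv_iff_mul_eq, twistedPairAction_apply, MulAut.inv_apply_self, tensorInterior_val,
    cornerTerm, cornerTerm, Algebra.TensorProduct.tmul_mul_tmul, Algebra.TensorProduct.tmul_mul_tmul,
    corner_mul_twist (hl _) (hl v) (tensorCoeff_twist (hφ v) q.1) (tensorCoeff_twist (hφ' v) q.2)]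
  have s1 : ∀ a b c : G, MonoidAlgebra.of O G (a * b * c⁻¹) * MonoidAlgebra.of O G c =
      MonoidAlgebra.of O G a * MonoidAlgebra.of O G b := fun a b c => by
    rw [← map_mul, inv_mul_cancel_right, map_mul]
  rw [corner_mul_twist (groupFixed_comm hj _) (groupFixed_comm hj v) (s1 _ _ _) (s1 _ _ _)]

end Realize
end

/-! ### The realization theorem -/

noncomputable section

/-- Modulo the Brauer kernel, an equivariant sum keeps only its terms at fixed points. -/
lemma exists_mem_sub_mem_brauerKer {O B G : Type*} [CommRing O] [IsLocalRing O] [Ring B] [Algebra O B]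
    [Group G] (θ : G →* Bˣ) (B₁ : Submodule O B)
    {Ω : Type*} [Fintype Ω] (act : G →* Equiv.Perm Ω) (F : Ω → B) (hF₁ : ∀ ω, F ω ∈ B₁)
    (hF : ∀ h ω, F (act h ω) = (θ h : B) * F ω * ((θ h)⁻¹ : Bˣ)) {e : B} (he : ∑ ω, F ω = e)
    {V : Submodule O B} (hV : ∀ ω, (∀ h, act h ω = ω) → F ω ∈ V) :
    ∃ c ∈ V, e - c ∈ brauerKer θ B₁ ⊤ := by
  classical
  refine ⟨∑ ω with ∀ h, act h ω = ω, F ω,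
    Submodule.sum_mem _ fun ω hω => hV ω (Finset.mem_filter.1 hω).2, ?_⟩
  have h := sum_not_fixed_mem_brauerKer θ B₁ ⊤ (act.comp (⊤ : Subgroup G).subtype) F hF₁
    (fun h ω => hF h ω)
  rw [← he, ← Finset.sum_filter_add_sum_filter_not Finset.univ (fun ω => ∀ h, act h ω = ω) F,
    add_sub_cancel_left]
  refine Eq.subst (motive := fun z => z ∈ brauerKer θ B₁ ⊤) (Finset.sum_congr ?_ fun _ _ => rfl) h
  ext ω
  simp

section Realize

variable {O S G Γ H : Type*} [CommRing O] [Ring S] [Algebra O S]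
  [Group G] [Group Γ] [Group H] {ω : G →* Γ} {κ : H →* Sˣ} {σ : H →* G}

/-- Being fixed under the twisted action means precisely that conjugation by the first component
realizes `φ` on the image of `σ`, and that the second realizes its inverse. -/
lemma twisted_of_fixed {φ : MulAut H} {q : G × G}
    (hq : ∀ u, twistedPairAction σ φ u q = q) (v : H) :
    σ (φ v) * q.1 = q.1 * σ v ∧ σ v * q.2 = q.2 * σ (φ v) := by
  have h := hq (φ v)
  rw [twistedPairAction_apply, MulAut.inv_apply_self] at h
  have h1 := congrArg Prod.fst h
  have h2 := congrArg Prod.snd h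
  exact ⟨mul_inv_eq_iff_eq_mul.1 h1, mul_inv_eq_iff_eq_mul.1 h2⟩

lemma mul_twist {R : Type*} [Ring R] {l a b s : R} (ha : a * l = l * a)
    (hb : b * l = l * b) (h : a * s = s * b) : a * (l * s * l) = l * s * l * b := by
  rw [← mul_assoc, ← mul_assoc, ha, mul_assoc l, h, mul_assoc (l * s), ← hb]
  simp only [mul_assoc]

lemma corner_fixed {R : Type*} [Ring R] {a b c d : R} (h1 : a * c = c * b) (h2 : b * d = d * a) :
    a * (c * d) = c * d * a := by
  rw [← mul_assoc, h1, mul_assoc, h2, mul_assoc]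

lemma exists_sub_mem_tensorBrauerKer [IsLocalRing O] [Fintype G] {l : S} {j : MonoidAlgebra O G}
    {y y' : S ⊗[O] MonoidAlgebra O G} {φ : MulAut H} {x : Γ}
    (hl : ∀ u, (κ u : S) * l = l * κ u) (hj : j ∈ groupFixed O ω σ)
    (hy : y ∈ tensorGradeComp O S ω x) (hy' : y' ∈ tensorGradeComp O S ω x⁻¹)
    (h1 : l ⊗ₜ[O] j * y = y) (h2 : y * l ⊗ₜ[O] j = y)
    (h1' : l ⊗ₜ[O] j * y' = y') (h2' : y' * l ⊗ₜ[O] j = y')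
    (hφ : ∀ u, (tensorInterior (O := O) κ σ (φ u)).val * y = y * (tensorInterior (O := O) κ σ u).val)
    (hφ' : ∀ u, (tensorInterior (O := O) κ σ u).val * y' =
      y' * (tensorInterior (O := O) κ σ (φ u)).val)
    {V : Submodule O (S ⊗[O] MonoidAlgebra O G)}
    (hV : ∀ q, (∀ u, twistedPairAction σ φ u q = q) → cornerTerm l j y y' q ∈ V) :
    ∃ c ∈ V, y * y' - c ∈ tensorBrauerKer O ω κ σ := by
  have key := exists_mem_sub_mem_brauerKer (O := O) (Ω := G × G) (tensorInterior (O := O) κ σ)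
    (tensorGradeComp O S ω 1) (twistedPairAction σ φ) (cornerTerm l j y y')
  have h := key (fun q => cornerTerm_mem hj.1 hy hy' q) (fun u q => cornerTerm_act hl hj hφ hφ' u q)
    (e := y * y') (sum_cornerTerm h1 h2 h1' h2') (V := V) hV
  exact h

variable [IsLocalRing O] [Finite G] [Finite H]

/-- Otherwise each surviving term has one of its two tensor factors in a radical, and `e` would lie
in the Brauer kernel by `mem_tensorBrauerKer_of_radical`. Terms with degrees other than `(x, x⁻¹)`
vanish. -/
lemma exists_fixed_pair {l : S} {j : MonoidAlgebra O G} {JS : Submodule O S}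
    {J : Submodule O (MonoidAlgebra O G)}
    (hJS : IsRadicalAt (fixedPts (O := O) κ ⊤ ⊤) l JS) (hJ : IsRadicalAt (groupFixed O ω σ) j J)
    (hl : ∀ u, (κ u : S) * l = l * κ u) (hj : j ∈ groupFixed O ω σ)
    {y y' e : S ⊗[O] MonoidAlgebra O G} {φ : MulAut H} {x : Γ}
    (hee : e * e = e) (heF : e ∈ tensorFixed O ω κ σ) (he : e ∉ tensorBrauerKer O ω κ σ)
    (hy : y ∈ tensorGradeComp O S ω x) (hy' : y' ∈ tensorGradeComp O S ω x⁻¹)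
    (h1 : l ⊗ₜ[O] j * y = y) (h2 : y * l ⊗ₜ[O] j = y)
    (h1' : l ⊗ₜ[O] j * y' = y') (h2' : y' * l ⊗ₜ[O] j = y') (hyy' : y * y' = e)
    (hφ : ∀ u, (tensorInterior (O := O) κ σ (φ u)).val * y = y * (tensorInterior (O := O) κ σ u).val)
    (hφ' : ∀ u, (tensorInterior (O := O) κ σ u).val * y' =
      y' * (tensorInterior (O := O) κ σ (φ u)).val)
    (hcF : ∀ q : G × G, (∀ u, twistedPairAction σ φ u q = q) →
      (l * tensorCoeff q.1 y * l) * (l * tensorCoeff q.2 y' * l) ∈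
        peirceFixed κ (⊤ : Submodule O S) ⊤ l)
    (hdF : ∀ q : G × G, ω q.1 = x ∧ ω q.2 = x⁻¹ → (∀ u, twistedPairAction σ φ u q = q) →
      (j * MonoidAlgebra.of O G q.1 * j) * (j * MonoidAlgebra.of O G q.2 * j) ∈
        peirceFixed ((groupUnits O G).comp σ) (gradeComp O ω 1) ⊤ j) :
    ∃ q : G × G, (∀ u, twistedPairAction σ φ u q = q) ∧ (ω q.1 = x ∧ ω q.2 = x⁻¹) ∧
      (l * tensorCoeff q.1 y * l) * (l * tensorCoeff q.2 y' * l) ∉ JS ∧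
      (j * MonoidAlgebra.of O G q.1 * j) * (j * MonoidAlgebra.of O G q.2 * j) ∉ J := by
  classical
  have := Fintype.ofFinite G
  by_contra hno
  obtain ⟨c, hc, hker⟩ := exists_sub_mem_tensorBrauerKer hl hj hy hy' h1 h2 h1' h2' hφ hφ'
    (V := tmulSpan O JS (peirceFixed ((groupUnits O G).comp σ) (gradeComp O ω 1) ⊤ j) ⊔
      tmulSpan O (peirceFixed κ (⊤ : Submodule O S) ⊤ l) J) (fun q hq => by
    by_cases hqx : ω q.1 = x ∧ ω q.2 = x⁻¹
    · by_cases hcq : (l * tensorCoeff q.1 y * l) * (l * tensorCoeff q.2 y' * l) ∈ JS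
      · exact Submodule.mem_sup_left (tmul_mem_tmulSpan hcq (hdF q hqx hq))
      · refine Submodule.mem_sup_right (tmul_mem_tmulSpan (hcF q hq) ?_)
        by_contra hdq
        exact hno ⟨q, hq, hqx, hcq, hdq⟩
    · rw [cornerTerm_eq_zero hy hy' hqx]
      exact Submodule.zero_mem _)
  rw [hyy'] at hker
  exact he (mem_tensorBrauerKer_of_radical hJS hJ hee heF hc hker)

variable [IsNoetherianRing O] [IsAdicComplete (IsLocalRing.maximalIdeal O) O] [Module.Finite O S]

/-- Units of an idempotent of `S ⊗ O G` below `l ⊗ j` that realize an automorphism `φ` in degree `x`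
give an element of `G` that realizes `φ` on the point of `j`, and a unit of `S` that realizes `φ`
on the point of `l`. -/
theorem exists_realization {l : S} {j : MonoidAlgebra O G} {e y y' : S ⊗[O] MonoidAlgebra O G}
    {φ : MulAut H} {x : Γ}
    (hl : IsPrimitiveIdempotentIn (fixedPts (O := O) κ ⊤ ⊤) l)
    (hj : IsPrimitiveIdempotentIn (groupFixed O ω σ) j)
    (hee : e * e = e) (heF : e ∈ tensorFixed O ω κ σ) (he : e ∉ tensorBrauerKer O ω κ σ)
    (hy : y ∈ tensorGradeComp O S ω x) (hy' : y' ∈ tensorGradeComp O S ω x⁻¹)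
    (h1 : l ⊗ₜ[O] j * y = y) (h2 : y * l ⊗ₜ[O] j = y)
    (h1' : l ⊗ₜ[O] j * y' = y') (h2' : y' * l ⊗ₜ[O] j = y') (hyy' : y * y' = e)
    (hφ : ∀ u, (tensorInterior (O := O) κ σ (φ u)).val * y = y * (tensorInterior (O := O) κ σ u).val)
    (hφ' : ∀ u, (tensorInterior (O := O) κ σ u).val * y' =
      y' * (tensorInterior (O := O) κ σ (φ u)).val) :
    ∃ g : G, ω g = x ∧ (∀ u, σ (φ u) * g = g * σ u) ∧
      FixedConj ((groupUnits O G).comp σ) (gradeComp O ω 1) ⊤ j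
        (MonoidAlgebra.of O G g * j * MonoidAlgebra.of O G g⁻¹) ∧
      ∃ s : Sˣ, ∀ u, (s : S) * (κ u * l) * (s⁻¹ : Sˣ) = κ (φ u) * l := by
  have hfin : Module.Finite O (MonoidAlgebra O G) := inferInstance
  obtain ⟨JS, hJS⟩ := exists_isRadicalAt (O := O) (Z := fixedPts (O := O) κ ⊤ ⊤)
    (fun a ha c hc => fixedPts_mul_mem (fun _ _ _ _ => Submodule.mem_top) ha hc) hl
  obtain ⟨J, hJ⟩ := exists_isRadicalAt (O := O) (Z := groupFixed O ω σ)
    (fun a ha c hc => fixedPts_mul_mem (fun _ h _ h' => gradeComp_one_mul h h') ha hc) hj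
  have hlσ : ∀ u, (κ u : S) * l = l * κ u := fun u => hl.1.2 u trivial
  have hjσ := groupFixed_comm hj.1
  have hll := hl.2.1
  have hjj := hj.2.1
  set c : G × G → S := fun q => (l * tensorCoeff q.1 y * l) * (l * tensorCoeff q.2 y' * l) with hc
  set d : G × G → MonoidAlgebra O G := fun q =>
    (j * MonoidAlgebra.of O G q.1 * j) * (j * MonoidAlgebra.of O G q.2 * j) with hd
  have hlc : ∀ q, l * c q = c q := fun q => by simp only [hc, ← mul_assoc, hll]
  have hcl : ∀ q, c q * l = c q := fun q => by simp only [hc, mul_assoc, hll]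
  have hjd : ∀ q, j * d q = d q := fun q => by simp only [hd, ← mul_assoc, hjj]
  have hdj : ∀ q, d q * j = d q := fun q => by simp only [hd, mul_assoc, hjj]
  -- twisted commutation at the fixed pairs
  have hs1 : ∀ q : G × G, (∀ u, twistedPairAction σ φ u q = q) → ∀ v,
      (κ (φ v) : S) * tensorCoeff q.1 y = tensorCoeff q.1 y * κ v := fun q hq v => by
    have h := tensorCoeff_twist (hφ v) q.1
    rw [(twisted_of_fixed hq v).1, mul_inv_cancel_right] at h
    exact h.symm
  have hs2 : ∀ q : G × G, (∀ u, twistedPairAction σ φ u q = q) → ∀ v,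
      (κ v : S) * tensorCoeff q.2 y' = tensorCoeff q.2 y' * κ (φ v) := fun q hq v => by
    have h := tensorCoeff_twist (hφ' v) q.2
    rw [(twisted_of_fixed hq v).2, mul_inv_cancel_right] at h
    exact h.symm
  have ht1 : ∀ q : G × G, (∀ u, twistedPairAction σ φ u q = q) → ∀ v,
      MonoidAlgebra.of O G (σ (φ v)) * MonoidAlgebra.of O G q.1 =
        MonoidAlgebra.of O G q.1 * MonoidAlgebra.of O G (σ v) := fun q hq v => by
    rw [← map_mul, ← map_mul, (twisted_of_fixed hq v).1]
  have ht2 : ∀ q : G × G, (∀ u, twistedPairAction σ φ u q = q) → ∀ v,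
      MonoidAlgebra.of O G (σ v) * MonoidAlgebra.of O G q.2 =
        MonoidAlgebra.of O G q.2 * MonoidAlgebra.of O G (σ (φ v)) := fun q hq v => by
    rw [← map_mul, ← map_mul, (twisted_of_fixed hq v).2]
  have hcF : ∀ q, (∀ u, twistedPairAction σ φ u q = q) → c q ∈ fixedPts (O := O) κ ⊤ ⊤ := by
    refine fun q hq => ⟨trivial, fun u _ => ?_⟩
    obtain ⟨v, rfl⟩ := φ.surjective u
    exact corner_fixed (mul_twist (hlσ _) (hlσ v) (hs1 q hq v)) (mul_twist (hlσ v) (hlσ _) (hs2 q hq v))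
  have hdF : ∀ q : G × G, ω q.1 = x ∧ ω q.2 = x⁻¹ → (∀ u, twistedPairAction σ φ u q = q) →
      d q ∈ groupFixed O ω σ := by
    refine fun q hq' hq => mem_groupFixed (corner_of_mul_mem hj.1.1 hq'.1 hq'.2) fun u => ?_
    obtain ⟨v, rfl⟩ := φ.surjective u
    exact corner_fixed (mul_twist (hjσ _) (hjσ v) (ht1 q hq v)) (mul_twist (hjσ v) (hjσ _) (ht2 q hq v))
  obtain ⟨q, hq, hqx, hcq, hdq⟩ := exists_fixed_pair hJS hJ hlσ hj.1 hee heF he hy hy' h1 h2 h1' h2' hyy'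
    hφ hφ' (fun q hq => ⟨hcF q hq, hlc q, hcl q⟩) (fun q hqx hq => ⟨hdF q hqx hq, hjd q, hdj q⟩)
  -- Outside the radical of a local ring means invertible. Since `c q` and `d q` are products, their
  -- inverses provide right inverses of their first factors, which is all that is needed below.
  obtain ⟨r, hrF, hlr, hrl, hcr, -⟩ := (hJS.mem_or_inv _ (hcF q hq) (hlc q) (hcl q)).resolve_left hcq
  obtain ⟨r', hr'F, hjr', hr'j, hdr', -⟩ :=
    (hJ.mem_or_inv _ (hdF q hqx hq) (hjd q) (hdj q)).resolve_left hdq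
  refine ⟨q.1, hqx.1, fun u => (twisted_of_fixed hq u).1, ?_, ?_⟩
  · refine fixedConj_of_right_inv hj hqx.1 (fun u => (twisted_of_fixed hq u).1)
      (d := j * MonoidAlgebra.of O G q.2 * j * r') ?_ ?_ ?_ ?_ ?_
    · have h3 := gradeComp_mul (gradeComp_mul (gradeComp_mul hj.1.1
        (of_mem_gradeComp (O := O) hqx.2)) hj.1.1) hr'F.1
      rwa [one_mul, mul_one, mul_one] at h3
    · intro u
      rw [← mul_assoc, mul_twist (hjσ u) (hjσ _) (ht2 q hq u), mul_assoc, groupFixed_comm hr'F,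
        ← mul_assoc]
    · simp only [← mul_assoc, hjj]
    · rw [mul_assoc, hr'j]
    · refine Eq.trans ?_ hdr'
      simp only [hd, mul_assoc]
      rw [← mul_assoc j j, hjj]
  · refine exists_unit_conj (O := O) hlσ hll (c := l * tensorCoeff q.1 y * l)
      (d := l * tensorCoeff q.2 y' * l * r) ?_ ?_ ?_ ?_ fun u => ?_
    · simp only [← mul_assoc, hll]
    · simp only [mul_assoc, hll]
    · simp only [← mul_assoc, hll]
    · rw [← mul_assoc]; exact hcr
    · exact mul_twist (hlσ _) (hlσ u) (hs1 q hq u)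

end Realize
end

/-! ### Twisted units and twisted isomorphisms -/

noncomputable section

section TwistedUnits

variable {O B G H Γ : Type*} [CommRing O] [Ring B] [Algebra O B] [Group G] [Group H] [Group Γ]

/-- `a` is an invertible element of `j B j`, homogeneous of degree `x`, with `a u = φ(u) a` for
`u ∈ H`; its inverse is `a'`. -/
structure IsTwistedUnit (θ : H →* Bˣ) (𝓑 : Γ → Submodule O B) (j : B) (φ : MulAut H) (x : Γ)
    (a a' : B) : Prop where
  mem : a ∈ 𝓑 x
  mem' : a' ∈ 𝓑 x⁻¹
  left : j * a = a
  right : a * j = a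
  left' : j * a' = a'
  right' : a' * j = a'
  mul_eq : a * a' = j
  mul_eq' : a' * a = j
  twist : ∀ u, (θ (φ u) : B) * a = a * θ u

/-- The twist of the inverse is not part of the structure: it follows by conjugating the relation
for `a`. -/
lemma IsTwistedUnit.twist' {θ : H →* Bˣ} {𝓑 : Γ → Submodule O B} {j : B} {φ : MulAut H} {x : Γ}
    {a a' : B} (h : IsTwistedUnit θ 𝓑 j φ x a a') (hj : ∀ u, (θ u : B) * j = j * θ u) (u : H) :
    (θ u : B) * a' = a' * θ (φ u) := by
  calc (θ u : B) * a' = j * θ u * a' := by rw [← hj, mul_assoc, h.left']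
    _ = a' * (a * θ u) * a' := by rw [← h.mul_eq', mul_assoc a']
    _ = a' * θ (φ u) * (a * a') := by rw [← h.twist]; simp only [mul_assoc]
    _ = a' * θ (φ u) := by rw [h.mul_eq, mul_assoc, hj, ← mul_assoc, h.right']

/-- This carries the identification of `Q̈` with `Q` and `Q'`. -/
lemma IsTwistedUnit.congr {H' : Type*} [Group H'] {θ : H →* Bˣ} {θ' : H' →* Bˣ}
    {𝓑 : Γ → Submodule O B} {j : B} (s : H ≃* H') (hs : ∀ u, θ' (s u) = θ u) {φ : MulAut H} {x : Γ}
    {a a' : B} : IsTwistedUnit θ' 𝓑 j (MulAut.congr s φ) x a a' ↔ IsTwistedUnit θ 𝓑 j φ x a a' := by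
  have key : (∀ u, (θ' (MulAut.congr s φ u) : B) * a = a * θ' u) ↔
      ∀ u, (θ (φ u) : B) * a = a * θ u := by
    refine ⟨fun h u => ?_, fun h u => ?_⟩
    · have := h (s u)
      rw [MulAut.congr_apply] at this
      simpa [hs] using this
    · obtain ⟨v, rfl⟩ := s.surjective u
      simpa [MulAut.congr_apply, hs] using h v
  exact ⟨fun h => ⟨h.1, h.2, h.3, h.4, h.5, h.6, h.7, h.8, key.1 h.9⟩,
    fun h => ⟨h.1, h.2, h.3, h.4, h.5, h.6, h.7, h.8, key.2 h.9⟩⟩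

variable {θ : G →* Bˣ} {𝓑 : Γ → Submodule O B} {Q : Subgroup G} {i j : B}

/-- Isomorphisms `(i B j)_φ ≃ i B j` of degree `x` are right multiplications by twisted units, provided
that `j` is equivalent to an idempotent of `i B i`. -/
lemma hasTwistedIso_iff (h𝓑 : ∀ {x y a c}, a ∈ 𝓑 x → c ∈ 𝓑 y → a * c ∈ 𝓑 (x * y))
    (hj : ∀ u ∈ Q, (θ u : B) * j = j * θ u) {p q : B} (hip : i * p = p) (hpj : p * j = p)
    (hqi : q * i = q) (hjq : j * q = q) (hqp : q * p = j) (hp : p ∈ 𝓑 1) (hq : q ∈ 𝓑 1)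
    (hpu : ∀ u ∈ Q, (θ u : B) * p = p * θ u) (hqu : ∀ u ∈ Q, (θ u : B) * q = q * θ u)
    {φ : MulAut Q} {x : Γ} :
    HasTwistedIso θ 𝓑 Q i j φ x ↔ ∃ a a', IsTwistedUnit (θ.comp Q.subtype) 𝓑 j φ x a a' := by
  constructor
  · rintro ⟨h, h1, h2, h3⟩
    let P : peirceComp O i j := ⟨p, hip, hpj⟩
    have hmq : ∀ m : peirceComp O i j, (m : B) * q ∈ corner O i := fun m =>
      ⟨by rw [← mul_assoc, m.2.1], by rw [mul_assoc, hqi]⟩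
    have hmqp : ∀ m : peirceComp O i j, (m : B) = m * q * p := fun m => by
      rw [mul_assoc, hqp, m.2.2]
    -- Every `m` equals `(m q) p` with `m q ∈ i B i`, so left linearity makes `h` the right
    -- multiplication by `q * h P`.
    have e1 : ∀ m, (h m : B) = m * (q * h P) := fun m => by
      rw [h1 _ (hmq m) P m (hmqp m), mul_assoc]
    have e2 : ∀ m, (h.symm m : B) = m * (q * h.symm P) := fun m => by
      have hmem : (m : B) * q * h.symm P ∈ peirceComp O i j :=
        ⟨by rw [← mul_assoc, (hmq m).1], by rw [mul_assoc, (h.symm P).2.2]⟩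
      have h4 := h1 _ (hmq m) (h.symm P) ⟨_, hmem⟩ rfl
      rw [h.apply_symm_apply, ← hmqp m] at h4
      have h5 : h ⟨_, hmem⟩ = m := Subtype.ext h4
      rw [← mul_assoc, ← h5, h.symm_apply_apply, h5]
    refine ⟨q * h P, q * h.symm P, ?_, ?_, ?_, ?_, ?_, ?_, ?_, ?_, fun u => ?_⟩
    · simpa using h𝓑 hq ((h3 1 P).1 hp)
    · have h4 := (h3 x⁻¹ (h.symm P)).2 (by rw [h.apply_symm_apply, inv_mul_cancel]; exact hp)
      simpa using h𝓑 hq h4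
    · rw [← mul_assoc, hjq]
    · rw [mul_assoc, (h P).2.2]
    · rw [← mul_assoc, hjq]
    · rw [mul_assoc, (h.symm P).2.2]
    · rw [mul_assoc, ← e2, h.symm_apply_apply, hqp]
    · rw [mul_assoc, ← e1, h.apply_symm_apply, hqp]
    · have hmem : p * (θ (φ u : Q) : B) ∈ peirceComp O i j :=
        ⟨by rw [← mul_assoc, hip], by rw [mul_assoc, hj _ (φ u).2, ← mul_assoc, hpj]⟩
      have h4 := h2 u P ⟨_, hmem⟩ rfl
      have h6 : θ (φ u : Q) * p * (q * h P) = h P * θ u := by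
        rw [hpu _ (φ u).2, ← h4]
        exact (e1 ⟨_, hmem⟩).symm
      have h5 := congrArg (q * ·) h6
      simp only [← mul_assoc, ← hqu _ (φ u).2] at h5
      rw [mul_assoc _ q p, hqp, mul_assoc _ j q, hjq] at h5
      rw [← mul_assoc]
      exact h5
  · rintro ⟨a, a', ha⟩
    refine ⟨LinearEquiv.ofLinearMap
      ((LinearMap.mulRight O a).restrict fun m hm =>
        ⟨by rw [LinearMap.mulRight_apply, ← mul_assoc, hm.1],
          by rw [LinearMap.mulRight_apply, mul_assoc, ha.right]⟩)
      ((LinearMap.mulRight O a').restrict fun m hm =>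
        ⟨by rw [LinearMap.mulRight_apply, ← mul_assoc, hm.1],
          by rw [LinearMap.mulRight_apply, mul_assoc, ha.right']⟩)
      (LinearMap.ext fun m => Subtype.ext ?_) (LinearMap.ext fun m => Subtype.ext ?_), ?_, ?_, ?_⟩
    · change (m : B) * a' * a = m
      rw [mul_assoc, ha.mul_eq', m.2.2]
    · change (m : B) * a * a' = m
      rw [mul_assoc, ha.mul_eq, m.2.2]
    · intro c _ m m' hm
      change (m' : B) * a = c * (m * a)
      rw [hm, mul_assoc]
    · intro u m m' hm
      change (m' : B) * a = m * a * θ u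
      have h4 := ha.twist u
      rw [hm, mul_assoc, mul_assoc]
      exact congrArg ((m : B) * ·) h4
    · intro y m
      change (m : B) ∈ 𝓑 y ↔ (m : B) * a ∈ 𝓑 (y * x)
      refine ⟨fun hm => h𝓑 hm ha.mem, fun hm => ?_⟩
      have h4 := h𝓑 hm ha.mem'
      rwa [mul_assoc, mul_assoc, ha.mul_eq, m.2.2, mul_inv_cancel, mul_one] at h4

/-- If `j` is conjugate to an idempotent of `i B i`, then it is equivalent to this idempotent. -/
lemma hasTwistedIso_iff_of_fixedConj (h𝓑 : ∀ {x y a c}, a ∈ 𝓑 x → c ∈ 𝓑 y → a * c ∈ 𝓑 (x * y))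
    (hj : j ∈ fixedPts θ (𝓑 1) Q) (hjj : j * j = j) {j₀ : B} (hj₀ : j₀ ∈ corner O i)
    (hconj : FixedConj θ (𝓑 1) Q j₀ j) {φ : MulAut Q} {x : Γ} :
    HasTwistedIso θ 𝓑 Q i j φ x ↔ ∃ a a', IsTwistedUnit (θ.comp Q.subtype) 𝓑 j φ x a a' := by
  obtain ⟨w, hw, hw', hjw⟩ := hconj
  have hwj : j * w = w * j₀ := by rw [hjw, Units.inv_mul_cancel_right]
  have hjw' : (w⁻¹ : Bˣ) * j = j₀ * (w⁻¹ : Bˣ) := by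
    rw [hjw, mul_assoc, Units.inv_mul_cancel_left]
  have hmul := fun a ha c hc => fixedPts_mul_mem (θ := θ) (B₁ := 𝓑 1) (H := Q)
    (fun a ha c hc => by simpa using h𝓑 ha hc) (a := a) (c := c) ha hc
  have h1 := hmul _ hw' _ hj
  have h2 := hmul _ hj _ hw
  -- With `j = w j₀ w⁻¹`, the elements `w⁻¹ j = j₀ w⁻¹` and `j w = w j₀` link `j` to `j₀` inside `i
  -- B j` and `j B i`.
  refine hasTwistedIso_iff h𝓑 hj.2 (p := (w⁻¹ : Bˣ) * j) (q := j * w) ?_ ?_ ?_ ?_ ?_ h1.1 h2.1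
    h1.2 h2.2
  · rw [hjw', ← mul_assoc, hj₀.1]
  · rw [mul_assoc, hjj]
  · rw [hwj, mul_assoc, hj₀.2]
  · rw [← mul_assoc, hjj]
  · rw [mul_assoc, Units.mul_inv_cancel_left, hjj]

end TwistedUnits

/-! ### Conjugacy in `B₁ ^ Q`, points and their stabilizers -/

section FixedConj

variable {O B G : Type*} [CommRing O] [Ring B] [Algebra O B] [Group G]
  {θ : G →* Bˣ} {B₁ : Submodule O B} {Q : Subgroup G}

lemma FixedConj.symm {a c : B} (h : FixedConj θ B₁ Q a c) : FixedConj θ B₁ Q c a := by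
  obtain ⟨w, hw, hw', rfl⟩ := h
  exact ⟨w⁻¹, hw', by rwa [inv_inv], by simp [mul_assoc]⟩

lemma FixedConj.trans (hB₁ : ∀ a ∈ B₁, ∀ c ∈ B₁, a * c ∈ B₁) {a c d : B}
    (h : FixedConj θ B₁ Q a c) (h' : FixedConj θ B₁ Q c d) : FixedConj θ B₁ Q a d := by
  obtain ⟨w, hw, hw', rfl⟩ := h
  obtain ⟨v, hv, hv', rfl⟩ := h'
  refine ⟨v * w, ?_, ?_, by simp [mul_assoc]⟩
  · rw [Units.val_mul]
    exact fixedPts_mul_mem hB₁ hv hw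
  · rw [mul_inv_rev, Units.val_mul]
    exact fixedPts_mul_mem hB₁ hw' hv'

/-- Conjugation by `w ∈ B₁^Q` preserves primitivity. -/
lemma FixedConj.isPrimitiveIdempotentIn (hB₁ : ∀ a ∈ B₁, ∀ c ∈ B₁, a * c ∈ B₁) {a c : B}
    (h : FixedConj θ B₁ Q a c) (ha : IsPrimitiveIdempotentIn (fixedPts θ B₁ Q) a) :
    IsPrimitiveIdempotentIn (fixedPts θ B₁ Q) c := by
  obtain ⟨w, hw, hw', rfl⟩ := h
  obtain ⟨h1, h2, h3, h4⟩ := ha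
  refine ⟨fixedPts_mul_mem hB₁ (fixedPts_mul_mem hB₁ hw h1) hw', ?_, ?_, ?_⟩
  · calc _ = w * (a * a) * (w⁻¹ : Bˣ) := by simp [mul_assoc]
      _ = _ := by rw [h2]
  · intro h0
    refine h3 ?_
    have := congrArg (fun z : B => (w⁻¹ : Bˣ) * z * w) h0
    simpa [mul_assoc] using this
  · intro e he hee h5 h6
    have h5' : (w⁻¹ : Bˣ) * (w * a * (w⁻¹ : Bˣ) * e) * w = (w⁻¹ : Bˣ) * e * w := by rw [h5]
    have h6' : (w⁻¹ : Bˣ) * (e * (w * a * (w⁻¹ : Bˣ))) * w = (w⁻¹ : Bˣ) * e * w := by rw [h6]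
    have h7 : ((w⁻¹ : Bˣ) * e * w) * ((w⁻¹ : Bˣ) * e * w) = (w⁻¹ : Bˣ) * e * w := by
      calc _ = (w⁻¹ : Bˣ) * (e * e) * w := by simp [mul_assoc]
        _ = _ := by rw [hee]
    rcases h4 _ (fixedPts_mul_mem hB₁ (fixedPts_mul_mem hB₁ hw' he) hw) h7
      (by rw [← h5']; simp [mul_assoc, ← mul_assoc a a, h2])
      (by rw [← h6']; simp [mul_assoc, h2]) with h | h
    · left
      have := congrArg (fun z : B => w * z * (w⁻¹ : Bˣ)) h
      simpa [mul_assoc] using this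
    · right
      rw [← h]; simp [mul_assoc]

lemma IsPoint.isPrimitiveIdempotentIn (hB₁ : ∀ a ∈ B₁, ∀ c ∈ B₁, a * c ∈ B₁) {δ : Set B}
    (hδ : IsPoint θ B₁ Q δ) {j : B} (hj : j ∈ δ) : IsPrimitiveIdempotentIn (fixedPts θ B₁ Q) j := by
  obtain ⟨i, hi, rfl⟩ := hδ
  exact FixedConj.isPrimitiveIdempotentIn hB₁ hj hi

lemma IsPoint.nonempty (h1 : (1 : B) ∈ B₁) {δ : Set B} (hδ : IsPoint θ B₁ Q δ) : δ.Nonempty := by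
  obtain ⟨i, hi, rfl⟩ := hδ
  have h : (1 : B) ∈ fixedPts θ B₁ Q := ⟨h1, fun u _ => by rw [one_mul, mul_one]⟩
  refine ⟨i, 1, h, ?_, by simp⟩
  rwa [inv_one]

lemma IsPoint.fixedConj (hB₁ : ∀ a ∈ B₁, ∀ c ∈ B₁, a * c ∈ B₁) {δ : Set B}
    (hδ : IsPoint θ B₁ Q δ) {j k : B} (hj : j ∈ δ) (hk : k ∈ δ) : FixedConj θ B₁ Q j k := by
  obtain ⟨i, hi, rfl⟩ := hδ
  exact FixedConj.trans hB₁ (FixedConj.symm hj) hk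

lemma IsPoint.mem_iff (hB₁ : ∀ a ∈ B₁, ∀ c ∈ B₁, a * c ∈ B₁) {δ : Set B}
    (hδ : IsPoint θ B₁ Q δ) {j : B} (hj : j ∈ δ) {k : B} : k ∈ δ ↔ FixedConj θ B₁ Q j k := by
  refine ⟨hδ.fixedConj hB₁ hj, fun h => ?_⟩
  obtain ⟨i, hi, rfl⟩ := hδ
  exact FixedConj.trans hB₁ hj h

/-- Conjugation by an element of the normalizer of `Q` preserves the relation of conjugacy in `B₁ ^ Q`. -/
lemma FixedConj.conj (hB₁ : ∀ g, ∀ a ∈ B₁, (θ g : B) * a * ((θ g)⁻¹ : Bˣ) ∈ B₁)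
    {g : G} (hg : g ∈ Subgroup.normalizer (Q : Set G)) {a c : B} (h : FixedConj θ B₁ Q a c) :
    FixedConj θ B₁ Q ((θ g : B) * a * ((θ g)⁻¹ : Bˣ)) ((θ g : B) * c * ((θ g)⁻¹ : Bˣ)) := by
  have key : ∀ a ∈ fixedPts θ B₁ Q, (θ g : B) * a * ((θ g)⁻¹ : Bˣ) ∈ fixedPts θ B₁ Q := by
    refine fun a ha => ⟨hB₁ g a ha.1, fun u hu => ?_⟩
    have hu' : g⁻¹ * u * g ∈ Q := by
      have := (Subgroup.mem_normalizer_iff.1 (inv_mem hg) u).1 hu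
      simpa using this
    have h1 : (θ u : B) * θ g = θ g * θ (g⁻¹ * u * g) := by
      rw [← Units.val_mul, ← Units.val_mul, ← map_mul, ← map_mul]; simp [mul_assoc]
    have h2 : ((θ g)⁻¹ : Bˣ) * (θ u : B) = θ (g⁻¹ * u * g) * ((θ g)⁻¹ : Bˣ) := by
      rw [← map_inv, ← Units.val_mul, ← Units.val_mul, ← map_mul, ← map_mul]; simp [mul_assoc]
    rw [← mul_assoc, ← mul_assoc, h1, mul_assoc (θ g : B), ha.2 _ hu', mul_assoc _ _ (θ u : B), h2]
    simp only [mul_assoc]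
  obtain ⟨w, hw, hw', rfl⟩ := h
  refine ⟨θ g * w * (θ g)⁻¹, key _ hw, ?_, ?_⟩
  · have := key _ hw'
    simpa [mul_assoc] using this
  · simp [mul_assoc]

/-- A point is a single conjugacy class, and conjugation by an element that normalizes `Q` respects
conjugacy; so one representative decides. -/
lemma IsPoint.mem_conjStabilizer (hB₁ : ∀ a ∈ B₁, ∀ c ∈ B₁, a * c ∈ B₁)
    (hB₁' : ∀ g, ∀ a ∈ B₁, (θ g : B) * a * ((θ g)⁻¹ : Bˣ) ∈ B₁) {δ : Set B} (hδ : IsPoint θ B₁ Q δ)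
    {j : B} (hj : j ∈ δ) {g : G} (hg : g ∈ Subgroup.normalizer (Q : Set G))
    (h : FixedConj θ B₁ Q j ((θ g : B) * j * ((θ g)⁻¹ : Bˣ))) : g ∈ conjStabilizer θ δ := by
  intro c
  rw [hδ.mem_iff hB₁ hj, hδ.mem_iff hB₁ hj]
  refine ⟨fun h' => h.trans hB₁ (h'.conj hB₁' hg), fun h' => ?_⟩
  have h1 := (h.symm.trans hB₁ h').conj hB₁' (inv_mem hg)
  simpa [mul_assoc] using h1

/-- Surjectivity of `φ` supplies the reverse inclusion. -/
lemma mem_normalizer_of_conj_eq {φ : MulAut Q} {g : G} (hφ : ∀ u : Q, ((φ u : Q) : G) = g * u * g⁻¹) :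
    g ∈ Subgroup.normalizer (Q : Set G) := by
  refine Subgroup.mem_normalizer_iff.2 fun u => ⟨fun hu => ?_, fun hu => ?_⟩
  · rw [← hφ ⟨u, hu⟩]
    exact (φ ⟨u, hu⟩).2
  · have h := hφ (φ⁻¹ ⟨_, hu⟩)
    rw [MulAut.apply_inv_self] at h
    have : ((φ⁻¹ ⟨_, hu⟩ : Q) : G) = u := by simpa using h.symm
    rw [← this]
    exact (φ⁻¹ ⟨_, hu⟩).2

/-- Points of `Q` can be studied with an abstract group `H` acting through `σ`; this is what allows
one group to act on `O G`, `S` and `O G'` at once. -/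
lemma fixedPts_comp {H : Type*} [Group H] {σ : H →* G} (hσ : σ.range = Q) :
    fixedPts (θ.comp σ) B₁ ⊤ = fixedPts θ B₁ Q := by
  subst hσ
  ext a
  refine and_congr_right fun _ => ⟨?_, fun h u _ => h _ ⟨u, rfl⟩⟩
  rintro h _ ⟨u, rfl⟩
  exact h u trivial

lemma fixedConj_comp {H : Type*} [Group H] {σ : H →* G} (hσ : σ.range = Q) {a c : B} :
    FixedConj (θ.comp σ) B₁ ⊤ a c ↔ FixedConj θ B₁ Q a c := by
  rw [FixedConj, FixedConj, fixedPts_comp hσ]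

/-- Brauer kernels involve proper subgroups, so here `σ` has to be an isomorphism onto `Q`, not
merely surjective. -/
lemma brauerKer_comp_le [IsLocalRing O] {H : Type*} [Group H] [Finite H] {σ : H →* G}
    (s : H ≃* Q) (hs : ∀ u, (s u : G) = σ u)
    (hB₁ : ∀ g, ∀ a ∈ B₁, (θ g : B) * a * ((θ g)⁻¹ : Bˣ) ∈ B₁) :
    brauerKer (θ.comp σ) B₁ ⊤ ≤ brauerKer θ B₁ Q := by
  intro a ha
  refine brauerKer_map (Φ := LinearMap.id) (θ := θ.comp σ) (H := ⊤) (C₁ := B₁)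
    (s.symm.trans Subgroup.topEquiv.symm).toMonoidHom
    (MulEquiv.surjective _) (fun u _ a ha => hB₁ (σ u) a ha) (fun _ h => h) (fun u a => ?_) ha
  have : σ (s.symm u) = u := by rw [← hs, MulEquiv.apply_symm_apply]
  change (θ (σ (s.symm u)) : B) * a * ((θ (σ (s.symm u)))⁻¹ : Bˣ) = _
  rw [this]; rfl

lemma brauerKer_top_map [IsLocalRing O] {C : Type*} [Ring C] [Algebra O C] [Finite G]
    {θ' : G →* Cˣ} {C₁ : Submodule O C} (Φ : B →ₗ[O] C)
    (hB₁ : ∀ g, ∀ a ∈ B₁, (θ g : B) * a * ((θ g)⁻¹ : Bˣ) ∈ B₁)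
    (hΦ₁ : ∀ a ∈ B₁, Φ a ∈ C₁)
    (hΦ : ∀ (g : G) (a : B), Φ ((θ g : B) * a * ((θ g)⁻¹ : Bˣ)) =
      (θ' g : C) * Φ a * ((θ' g)⁻¹ : Cˣ)) {a : B} (ha : a ∈ brauerKer θ B₁ ⊤) :
    Φ a ∈ brauerKer θ' C₁ ⊤ :=
  brauerKer_map Φ (MonoidHom.id _) Function.surjective_id (fun g _ => hB₁ g) hΦ₁ (fun g => hΦ g) ha

end FixedConj
end

/-! ### The case `S = O`: fusions in the group algebra -/

noncomputable section

section GroupFusions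

variable {O G Γ : Type*} [CommRing O] [Group G] [Group Γ] {ω : G →* Γ} {Q : Subgroup G}
  {j : MonoidAlgebra O G}

/-- A domain has only trivial idempotents; this is the point of `S = O` used to specialize the
realization theorem to `O G`. -/
lemma isPrimitiveIdempotentIn_one [IsDomain O] {H : Type*} [Group H] :
    IsPrimitiveIdempotentIn (fixedPts (O := O) (B := O) (1 : H →* Oˣ) ⊤ ⊤) 1 := by
  refine ⟨⟨trivial, fun u _ => mul_comm _ _⟩, one_mul 1, one_ne_zero, fun e _ he _ _ => ?_⟩
  exact IsIdempotentElem.iff_eq_zero_or_one.1 he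

lemma conj_mem_gradeComp_one (g : G) {a : MonoidAlgebra O G} (ha : a ∈ gradeComp O ω 1) :
    (groupUnits O G g : MonoidAlgebra O G) * a * ((groupUnits O G g)⁻¹ : (MonoidAlgebra O G)ˣ) ∈
      gradeComp O ω 1 := by
  have h := conj_mem_gradeComp g ha
  rwa [mul_one, mul_inv_cancel] at h

/-- The isomorphism `O ⊗ O G ≃ O G` is equivariant and preserves degree 1, so a failure of locality
would be carried back to `j`. -/
lemma one_tmul_notMem_tensorBrauerKer [IsLocalRing O] [Finite G]
    (hloc : j ∉ brauerKer (groupUnits O G) (gradeComp O ω 1) Q) :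
    (1 : O) ⊗ₜ[O] j ∉ tensorBrauerKer O ω (S := O) (1 : Q →* Oˣ) Q.subtype := by
  intro hker
  refine hloc (brauerKer_comp_le (θ := groupUnits O G) (B₁ := gradeComp O ω 1)
    (MulEquiv.refl Q) (σ := Q.subtype) (fun u => rfl) (fun g a h => conj_mem_gradeComp_one g h) ?_)
  have h := brauerKer_top_map (θ := tensorInterior (O := O) (1 : Q →* Oˣ) Q.subtype)
    (B₁ := tensorGradeComp O O ω 1)
    (θ' := (groupUnits O G).comp Q.subtype) (C₁ := gradeComp O ω 1)
    (TensorProduct.lid O (MonoidAlgebra O G)).toLinearMap ?_ ?_ ?_ hker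
  · rw [LinearEquiv.coe_coe, TensorProduct.lid_tmul, one_smul] at h
    exact h
  · exact fun u a h => conj_mem_tensorGradeComp_one (O := O) (1 : Q →* Oˣ) Q.subtype u h
  · refine fun a h => tensorGradeComp_le (V := (gradeComp O ω 1).comap
      (TensorProduct.lid O (MonoidAlgebra O G)).toLinearMap) (fun s c hc => ?_) h
    exact Submodule.smul_mem _ s hc
  · intro u c
    induction c with
    | zero => rw [mul_zero, zero_mul, map_zero, mul_zero, zero_mul]
    | add c d hc hd => rw [mul_add, add_mul, map_add, hc, hd, map_add, mul_add, add_mul]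
    | tmul s c =>
      rw [tensorInterior_val, tensorInterior_inv_val, Algebra.TensorProduct.tmul_mul_tmul,
        Algebra.TensorProduct.tmul_mul_tmul, MonoidHom.comp_apply, groupUnits_val,
        groupUnits_inv_val, LinearEquiv.coe_coe, TensorProduct.lid_tmul, TensorProduct.lid_tmul,
        mul_smul_comm, smul_mul_assoc]
      simp

lemma IsTwistedUnit.one_tmul {H : Type*} [Group H] {σ : H →* G} {φ : MulAut H} {x : Γ}
    {a a' : MonoidAlgebra O G}
    (ha : IsTwistedUnit ((groupUnits O G).comp σ) (gradeComp O ω) j φ x a a') :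
    IsTwistedUnit (tensorInterior (O := O) (1 : H →* Oˣ) σ) (tensorGradeComp O O ω) (1 ⊗ₜ[O] j) φ x
      (1 ⊗ₜ[O] a) (1 ⊗ₜ[O] a') where
  mem := tmul_mem_tensorGradeComp 1 ha.mem
  mem' := tmul_mem_tensorGradeComp 1 ha.mem'
  left := by rw [Algebra.TensorProduct.tmul_mul_tmul, ha.left, one_mul]
  right := by rw [Algebra.TensorProduct.tmul_mul_tmul, ha.right, one_mul]
  left' := by rw [Algebra.TensorProduct.tmul_mul_tmul, ha.left', one_mul]
  right' := by rw [Algebra.TensorProduct.tmul_mul_tmul, ha.right', one_mul]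
  mul_eq := by rw [Algebra.TensorProduct.tmul_mul_tmul, ha.mul_eq, one_mul]
  mul_eq' := by rw [Algebra.TensorProduct.tmul_mul_tmul, ha.mul_eq', one_mul]
  twist u := by
    rw [tensorInterior_val, tensorInterior_val, Algebra.TensorProduct.tmul_mul_tmul,
      Algebra.TensorProduct.tmul_mul_tmul]
    exact congrArg₂ (· ⊗ₜ[O] ·) (mul_comm _ _) (ha.twist u)

variable [IsLocalRing O] [IsNoetherianRing O]
  [IsAdicComplete (IsLocalRing.maximalIdeal O) O] [Finite G]

/-- A twisted unit of the corner at `e` is also absorbed by `l ⊗ j`, since `e` is below it. -/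
lemma exists_realization_of_isTwistedUnit {S H : Type*} [Ring S] [Algebra O S] [Module.Finite O S]
    [Group H] [Finite H] {κ : H →* Sˣ} {σ : H →* G} {l : S} {e y y' : S ⊗[O] MonoidAlgebra O G}
    {φ : MulAut H} {x : Γ}
    (hl : IsPrimitiveIdempotentIn (fixedPts (O := O) κ ⊤ ⊤) l)
    (hj : IsPrimitiveIdempotentIn (groupFixed O ω σ) j)
    (hee : e * e = e) (heF : e ∈ tensorFixed O ω κ σ) (he : e ∉ tensorBrauerKer O ω κ σ)
    (hle : l ⊗ₜ[O] j * e = e) (hel : e * l ⊗ₜ[O] j = e)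
    (hy : IsTwistedUnit (tensorInterior (O := O) κ σ) (tensorGradeComp O S ω) e φ x y y') :
    ∃ g : G, ω g = x ∧ (∀ u, σ (φ u) * g = g * σ u) ∧
      FixedConj ((groupUnits O G).comp σ) (gradeComp O ω 1) ⊤ j
        (MonoidAlgebra.of O G g * j * MonoidAlgebra.of O G g⁻¹) ∧
      ∃ s : Sˣ, ∀ u, (s : S) * (κ u * l) * (s⁻¹ : Sˣ) = κ (φ u) * l := by
  have h1 : l ⊗ₜ[O] j * y = y := by rw [← hy.left, ← mul_assoc, hle]
  have h2 : y * l ⊗ₜ[O] j = y := by rw [← hy.right, mul_assoc, hel]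
  have h3 : l ⊗ₜ[O] j * y' = y' := by rw [← hy.left', ← mul_assoc, hle]
  have h4 : y' * l ⊗ₜ[O] j = y' := by rw [← hy.right', mul_assoc, hel]
  have h5 := hy.twist' (fun u => heF.2 u trivial)
  exact exists_realization hl hj hee heF he hy.mem hy.mem' h1 h2 h3 h4 hy.mul_eq hy.twist h5

variable [IsDomain O]

/-- A twisted unit of degree `x` at a local point `Q_δ` is realized by an element of `G` of
degree `x` that normalizes `Q_δ`. -/
lemma exists_conj_of_isTwistedUnit
    (hj : IsPrimitiveIdempotentIn (fixedPts (groupUnits O G) (gradeComp O ω 1) Q) j)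
    (hloc : j ∉ brauerKer (groupUnits O G) (gradeComp O ω 1) Q) {φ : MulAut Q} {x : Γ}
    {a a' : MonoidAlgebra O G}
    (ha : IsTwistedUnit ((groupUnits O G).comp Q.subtype) (gradeComp O ω) j φ x a a') :
    ∃ g : G, ω g = x ∧ (∀ u : Q, ((φ u : Q) : G) = g * u * g⁻¹) ∧
      FixedConj (groupUnits O G) (gradeComp O ω 1) Q j
        (MonoidAlgebra.of O G g * j * MonoidAlgebra.of O G g⁻¹) := by
  have hj' : IsPrimitiveIdempotentIn (groupFixed O ω Q.subtype) j := by
    rwa [groupFixed, fixedPts_comp Q.range_subtype]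
  have hee : (1 : O) ⊗ₜ[O] j * 1 ⊗ₜ[O] j = 1 ⊗ₜ[O] j := by
    rw [Algebra.TensorProduct.tmul_mul_tmul, hj.2.1, one_mul]
  have h1 := tmul_mem_tensorFixed (isPrimitiveIdempotentIn_one (O := O) (H := Q)).1 hj'.1
  obtain ⟨g, hg, hgσ, hconj, -⟩ := exists_realization_of_isTwistedUnit
    (isPrimitiveIdempotentIn_one (H := Q)) hj' hee h1 (one_tmul_notMem_tensorBrauerKer hloc) hee hee
    ha.one_tmul
  exact ⟨g, hg, fun u => eq_mul_inv_iff_mul_eq.2 (hgσ u), (fixedConj_comp Q.range_subtype).1 hconj⟩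

end GroupFusions
end

/-! ### Fusions and the normalizer of a local pointed group -/

noncomputable section

section FusionGroup

variable {O G Γ : Type*} [CommRing O] [Group G] [Group Γ] {ω : G →* Γ}
  {Q : Subgroup G} {δ : Set (MonoidAlgebra O G)} {i j j₀ : MonoidAlgebra O G}

/-- The idempotent `i` disappears: it enters only through the existence of `j₀` in the point and in
the corner of `i`. -/
lemma mem_gradedFusionGroup_iff [IsLocalRing O]
    (hδ : IsLocalPoint (groupUnits O G) (gradeComp O ω 1) Q δ) (hj : j ∈ δ) (hj₀δ : j₀ ∈ δ)
    (hj₀ : j₀ ∈ corner O i) {φ : MulAut Q} {x : Γ} :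
    (φ, x) ∈ gradedFusionGroup ω (groupUnits O G) (gradeComp O ω) Q i j (hδ.1.commute hj) ↔
      φ ∈ gradedAut ω Q ∧
        ∃ a a', IsTwistedUnit ((groupUnits O G).comp Q.subtype) (gradeComp O ω) j φ x a a' := by
  have hB₁ : ∀ a ∈ gradeComp O ω 1, ∀ c ∈ gradeComp O ω 1, a * c ∈ gradeComp O ω 1 :=
    fun a ha c hc => gradeComp_one_mul ha hc
  have hprim := hδ.1.isPrimitiveIdempotentIn hB₁ hj
  exact and_congr_right fun _ => hasTwistedIso_iff_of_fixedConj (fun h h' => gradeComp_mul h h')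
    hprim.1 hprim.2.1 hj₀ (hδ.1.fixedConj hB₁ hj₀δ hj)

/-- From `g j g⁻¹ = w j w⁻¹` with `w` fixed by `Q` and of degree 1, the element `w⁻¹ g` commutes
with `j`. The twisted unit is `w⁻¹ g j`, with inverse `j g⁻¹ w`. -/
lemma exists_isTwistedUnit_of_mem_conjStabilizer
    (hδ : IsPoint (groupUnits O G) (gradeComp O ω 1) Q δ) (hj : j ∈ δ) {φ : MulAut Q}
    {g : G} (hφ : ∀ u : Q, ((φ u : Q) : G) = g * u * g⁻¹)
    (hg : g ∈ conjStabilizer (groupUnits O G) δ) :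
    ∃ a a', IsTwistedUnit ((groupUnits O G).comp Q.subtype) (gradeComp O ω) j φ (ω g) a a' := by
  have hB₁ : ∀ a ∈ gradeComp O ω 1, ∀ c ∈ gradeComp O ω 1, a * c ∈ gradeComp O ω 1 :=
    fun a ha c hc => gradeComp_one_mul ha hc
  have hprim := hδ.isPrimitiveIdempotentIn hB₁ hj
  obtain ⟨w, hw, hw', hgj⟩ := hδ.fixedConj hB₁ hj ((hg j).1 hj)
  have hjj := hprim.2.1
  rw [groupUnits_inv_val, groupUnits_val] at hgj
  have hinv : MonoidAlgebra.of O G g⁻¹ * MonoidAlgebra.of O G g = 1 := by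
    rw [← map_mul, inv_mul_cancel, map_one]
  have h1 : MonoidAlgebra.of O G g * j = w * j * (w⁻¹ : (MonoidAlgebra O G)ˣ) *
      MonoidAlgebra.of O G g := by rw [← hgj, mul_assoc, hinv, mul_one]
  have h2 : j * MonoidAlgebra.of O G g⁻¹ = MonoidAlgebra.of O G g⁻¹ *
      (w * j * (w⁻¹ : (MonoidAlgebra O G)ˣ)) := by
    rw [← hgj, ← mul_assoc, ← mul_assoc, hinv, one_mul]
  have h3 : ((w⁻¹ : (MonoidAlgebra O G)ˣ) : MonoidAlgebra O G) * (MonoidAlgebra.of O G g * j) =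
      j * ((w⁻¹ : (MonoidAlgebra O G)ˣ) * MonoidAlgebra.of O G g) := by
    rw [h1, ← mul_assoc, ← mul_assoc, ← mul_assoc, Units.inv_mul, one_mul, mul_assoc]
  have h4 : j * MonoidAlgebra.of O G g⁻¹ * w = MonoidAlgebra.of O G g⁻¹ * w * j := by
    rw [h2, mul_assoc, mul_assoc _ _ (w : MonoidAlgebra O G), Units.inv_mul, mul_one, mul_assoc]
  refine ⟨(w⁻¹ : (MonoidAlgebra O G)ˣ) * (MonoidAlgebra.of O G g * j),
    j * MonoidAlgebra.of O G g⁻¹ * w, ?_, ?_, ?_, ?_, ?_, ?_, ?_, ?_, fun u => ?_⟩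
  · simpa using gradeComp_mul hw'.1 (gradeComp_mul (of_mem_gradeComp (O := O) (ω := ω) rfl) hprim.1.1)
  · have h5 := gradeComp_mul (gradeComp_mul hprim.1.1
      (of_mem_gradeComp (O := O) (ω := ω) (g := g⁻¹) (map_inv _ _))) hw.1
    rwa [one_mul, mul_one] at h5
  · rw [h3, ← mul_assoc, hjj]
  · rw [mul_assoc, mul_assoc, hjj]
  · rw [← mul_assoc, ← mul_assoc, hjj]
  · rw [h4, mul_assoc, hjj]
  · have : (w⁻¹ : (MonoidAlgebra O G)ˣ) * (MonoidAlgebra.of O G g * j) *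
        (j * MonoidAlgebra.of O G g⁻¹ * w) = (w⁻¹ : (MonoidAlgebra O G)ˣ) *
        (MonoidAlgebra.of O G g * (j * j) * MonoidAlgebra.of O G g⁻¹) * w := by
      simp only [mul_assoc]
    rw [this, hjj, hgj]
    rw [mul_assoc (w : MonoidAlgebra O G), Units.inv_mul_cancel_left, Units.inv_mul_cancel_right]
  · have : j * MonoidAlgebra.of O G g⁻¹ * w *
        ((w⁻¹ : (MonoidAlgebra O G)ˣ) * (MonoidAlgebra.of O G g * j)) =
        j * (MonoidAlgebra.of O G g⁻¹ * MonoidAlgebra.of O G g) * j := by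
      simp only [mul_assoc]
      rw [Units.mul_inv_cancel_left]
    rw [this, hinv, mul_one, hjj]
  · have h5 : MonoidAlgebra.of O G ((φ u : Q) : G) * MonoidAlgebra.of O G g =
        MonoidAlgebra.of O G g * MonoidAlgebra.of O G (u : G) := by
      rw [← map_mul, ← map_mul, hφ, inv_mul_cancel_right]
    change MonoidAlgebra.of O G ((φ u : Q) : G) * _ = _ * MonoidAlgebra.of O G (u : G)
    have h6 := hw'.2 _ (φ u).2
    have h7 := hprim.1.2 _ u.2
    rw [groupUnits_val] at h6 h7
    rw [← mul_assoc, h6, mul_assoc, ← mul_assoc _ _ j, h5, mul_assoc, h7]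
    simp only [mul_assoc]

/-- The homomorphism `g ↦ (u ↦ g u g⁻¹, ω g)` on `N_G^K(Q_δ)`. -/
def normalizerToFusion [IsLocalRing O]
    (hδ : IsLocalPoint (groupUnits O G) (gradeComp O ω 1) Q δ) (hj : j ∈ δ) (hj₀δ : j₀ ∈ δ)
    (hj₀ : j₀ ∈ corner O i) :
    gradedPointNormalizer ω (groupUnits O G) Q δ →*
      gradedFusionGroup ω (groupUnits O G) (gradeComp O ω) Q i j (hδ.1.commute hj) :=
  MonoidHom.codRestrict
    ((Q.normalizerMonoidHom.comp (Subgroup.inclusion (by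
      rintro g ⟨⟨k, -, rfl⟩, -⟩; exact k.2))).prod
      (ω.comp (gradedPointNormalizer ω (groupUnits O G) Q δ).subtype)) _ fun g => by
    refine (mem_gradedFusionGroup_iff hδ hj hj₀δ hj₀).2 ⟨?_,
      exists_isTwistedUnit_of_mem_conjStabilizer hδ.1 hj (fun u => rfl) g.2.2⟩
    obtain ⟨⟨k, hk, hkg⟩, -⟩ := g.2
    intro u
    have h := hk u
    change ω (g * u * (g : G)⁻¹) = ω u
    rw [← hkg]
    exact h

/-- An element of `C_N(Q)` is itself a unit of `(O N)^Q`, so it stabilizes every point of `Q`, and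
it acts trivially on `Q`. -/
theorem centralizerInKer_le (hδ : IsPoint (groupUnits O G) (gradeComp O ω 1) Q δ) :
    centralizerInKer ω Q ≤ gradedPointNormalizer ω (groupUnits O G) Q δ := by
  rintro g ⟨hg, hgQ⟩
  have hcomm : ∀ u ∈ Q, g * u * g⁻¹ = u := fun u hu => by
    rw [← Subgroup.mem_centralizer_iff.1 hgQ u hu, mul_inv_cancel_right]
  have hφ : ∀ u : Q, (((1 : MulAut Q) u : Q) : G) = g * u * g⁻¹ := fun u => (hcomm u u.2).symm
  have hgN := mem_normalizer_of_conj_eq hφ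
  refine ⟨⟨⟨g, hgN⟩, fun u => ?_, rfl⟩, ?_⟩
  · change ω (g * u * g⁻¹) = ω u
    rw [hcomm u u.2]
  · obtain ⟨j, hj⟩ := hδ.nonempty one_mem_gradeComp
    have hB₁ : ∀ a ∈ gradeComp O ω 1, ∀ c ∈ gradeComp O ω 1, a * c ∈ gradeComp O ω 1 :=
      fun a ha c hc => gradeComp_one_mul ha hc
    have hF : ∀ k, ω k = 1 → k ∈ Subgroup.centralizer (Q : Set G) →
        MonoidAlgebra.of O G k ∈ fixedPts (groupUnits O G) (gradeComp O ω 1) Q := fun k hk hkQ => by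
      refine ⟨of_mem_gradeComp hk, fun u hu => ?_⟩
      rw [groupUnits_val, ← map_mul, ← map_mul, Subgroup.mem_centralizer_iff.1 hkQ u hu]
    refine hδ.mem_conjStabilizer hB₁ (fun g a h => conj_mem_gradeComp_one g h)
      hj hgN ⟨groupUnits O G g, hF g hg hgQ, ?_, rfl⟩
    rw [groupUnits_inv_val]
    exact hF g⁻¹ (by rw [map_inv, hg, inv_one]) (inv_mem hgQ)

variable [IsDomain O] [IsLocalRing O] [IsNoetherianRing O]
  [IsAdicComplete (IsLocalRing.maximalIdeal O) O] [Finite G]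

lemma exists_mem_conjStabilizer_of_isTwistedUnit
    (hδ : IsLocalPoint (groupUnits O G) (gradeComp O ω 1) Q δ) (hj : j ∈ δ) {φ : MulAut Q} {x : Γ}
    {a a' : MonoidAlgebra O G}
    (ha : IsTwistedUnit ((groupUnits O G).comp Q.subtype) (gradeComp O ω) j φ x a a') :
    ∃ g : G, ω g = x ∧ (∀ u : Q, ((φ u : Q) : G) = g * u * g⁻¹) ∧
      g ∈ conjStabilizer (groupUnits O G) δ := by
  have hB₁ : ∀ a ∈ gradeComp O ω 1, ∀ c ∈ gradeComp O ω 1, a * c ∈ gradeComp O ω 1 :=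
    fun a ha c hc => gradeComp_one_mul ha hc
  have hprim := hδ.1.isPrimitiveIdempotentIn hB₁ hj
  obtain ⟨g, hg, hφ, hconj⟩ := exists_conj_of_isTwistedUnit hprim (hδ.2 j hj) ha
  refine ⟨g, hg, hφ, hδ.1.mem_conjStabilizer hB₁ ?_ hj (mem_normalizer_of_conj_eq hφ) ?_⟩
  · exact fun g a h => conj_mem_gradeComp_one g h
  · rwa [groupUnits_inv_val]

/-- The first isomorphism theorem. Recording the degree makes the kernel exactly `C_N(Q)`;
surjectivity is the realization of twisted units by group elements. -/
theorem exists_normalizer_quotient_equiv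
    (hδ : IsLocalPoint (groupUnits O G) (gradeComp O ω 1) Q δ) (hj : j ∈ δ) (hj₀δ : j₀ ∈ δ)
    (hj₀ : j₀ ∈ corner O i) :
    ∃ e : (gradedPointNormalizer ω (groupUnits O G) Q δ ⧸
            (centralizerInKer ω Q).subgroupOf (gradedPointNormalizer ω (groupUnits O G) Q δ)) ≃*
          gradedFusionGroup ω (groupUnits O G) (gradeComp O ω) Q i j (hδ.1.commute hj),
      ∀ g : gradedPointNormalizer ω (groupUnits O G) Q δ,
        (∀ u : Q, (((e g).1.1 u : Q) : G) = g * u * (g : G)⁻¹) ∧ (e g).1.2 = ω g := by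
  let F := normalizerToFusion hδ hj hj₀δ hj₀
  have hker : F.ker = (centralizerInKer ω Q).subgroupOf (gradedPointNormalizer ω (groupUnits O G) Q δ) := by
    ext g
    rw [MonoidHom.mem_ker, Subgroup.mem_subgroupOf]
    constructor
    · intro h
      have h1 := congrArg (fun q => q.1.1) h
      have h2 := congrArg (fun q => q.1.2) h
      refine ⟨h2, Subgroup.mem_centralizer_iff.2 fun u hu => ?_⟩
      have h3 : (g : G) * u * (g : G)⁻¹ = u := congrArg (fun f : MulAut Q => ((f ⟨u, hu⟩ : Q) : G)) h1
      exact (mul_inv_eq_iff_eq_mul.1 h3).symm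
    · rintro ⟨h1, h2⟩
      refine Subtype.ext (Prod.ext (MulEquiv.ext fun u => Subtype.ext ?_) h1)
      change (g : G) * u * (g : G)⁻¹ = u
      rw [mul_inv_eq_iff_eq_mul, Subgroup.mem_centralizer_iff.1 h2 u u.2]
  have hsurj : Function.Surjective F := by
    rintro ⟨⟨φ, x⟩, hφx⟩
    obtain ⟨hφ, a, a', ha⟩ := (mem_gradedFusionGroup_iff hδ hj hj₀δ hj₀).1 hφx
    obtain ⟨g, hg, hφg, hgδ⟩ := exists_mem_conjStabilizer_of_isTwistedUnit hδ hj ha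
    have hφeq : Q.normalizerMonoidHom ⟨g, mem_normalizer_of_conj_eq hφg⟩ = φ :=
      MulEquiv.ext fun u => Subtype.ext (hφg u).symm
    refine ⟨⟨g, ⟨⟨⟨g, mem_normalizer_of_conj_eq hφg⟩, ?_, rfl⟩, hgδ⟩⟩, ?_⟩
    · change Q.normalizerMonoidHom _ ∈ gradedAut ω Q
      rw [hφeq]
      exact hφ
    · exact Subtype.ext (Prod.ext hφeq hg)
  exact ⟨(QuotientGroup.quotientMulEquivOfEq hker.symm).trans
    (QuotientGroup.quotientKerEquivOfSurjective F hsurj), fun g => ⟨fun u => rfl, rfl⟩⟩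

end FusionGroup
end

/-! ### Embeddings as equivalences of corners -/

noncomputable section

section Corners

variable {O B C H Γ : Type*} [CommRing O] [Ring B] [Algebra O B] [Ring C] [Algebra O C]
  [Group H] {Γ : Type*}

/-- Linear maps `T : B → C` and `ψ : C → B` that vanish off the corners `j B j` and `e C e` and
restrict to mutually inverse isomorphisms of graded `H`-interior algebras between them. -/
structure IsCornerEquiv (θ : H →* Bˣ) (𝓑 : Γ → Submodule O B) (θ' : H →* Cˣ)
    (𝓒 : Γ → Submodule O C) (j : B) (e : C) (T : B →ₗ[O] C) (ψ : C →ₗ[O] B) : Prop where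
  map_self : T j = e
  inv_map : ∀ a, ψ (T a) = j * a * j
  map_inv : ∀ c, T (ψ c) = e * c * e
  map_mul : ∀ a b, T a * T b = T (a * j * b)
  left : ∀ a, e * T a = T a
  right : ∀ a, T a * e = T a
  inv_left : ∀ c, j * ψ c = ψ c
  inv_right : ∀ c, ψ c * j = ψ c
  interior_left : ∀ u a, T (θ u * a) = θ' u * T a
  interior_right : ∀ u a, T (a * θ u) = T a * θ' u
  graded : ∀ x, ∀ a ∈ 𝓑 x, T a ∈ 𝓒 x
  inv_graded : ∀ x, ∀ c ∈ 𝓒 x, ψ c ∈ 𝓑 x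

namespace IsCornerEquiv

variable {θ : H →* Bˣ} {𝓑 : Γ → Submodule O B} {θ' : H →* Cˣ} {𝓒 : Γ → Submodule O C} {j : B} {e : C}
  {T : B →ₗ[O] C} {ψ : C →ₗ[O] B}

/-- Identities for `ψ` are verified after applying `T`, for which the multiplicative and interior
properties are given. -/
lemma injective_of_mem (h : IsCornerEquiv θ 𝓑 θ' 𝓒 j e T ψ) {a b : B} (ha : j * a * j = a)
    (hb : j * b * j = b) (hab : T a = T b) : a = b := by
  rw [← ha, ← hb, ← h.inv_map, ← h.inv_map, hab]

lemma idem (h : IsCornerEquiv θ 𝓑 θ' 𝓒 j e T ψ) : e * e = e := by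
  have := h.left j
  rwa [h.map_self] at this

lemma inv_self (h : IsCornerEquiv θ 𝓑 θ' 𝓒 j e T ψ) (hjj : j * j = j) : ψ e = j := by
  rw [← h.map_self, h.inv_map, hjj, hjj]

lemma inv_mul (h : IsCornerEquiv θ 𝓑 θ' 𝓒 j e T ψ) (c d : C) : ψ c * ψ d = ψ (c * e * d) := by
  refine h.injective_of_mem (by rw [← mul_assoc, h.inv_left, mul_assoc, h.inv_right])
    (by rw [h.inv_left, h.inv_right]) ?_
  have h1 := h.map_mul (ψ c) (ψ d)
  rw [h.inv_right] at h1
  rw [← h1, h.map_inv, h.map_inv, h.map_inv]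
  simp only [mul_assoc]
  rw [← mul_assoc e e, h.idem]

lemma inv_corner_left (h : IsCornerEquiv θ 𝓑 θ' 𝓒 j e T ψ) (c : C) : ψ (e * c) = ψ c := by
  refine h.injective_of_mem (by rw [h.inv_left, h.inv_right]) (by rw [h.inv_left, h.inv_right]) ?_
  rw [h.map_inv, h.map_inv, ← mul_assoc, h.idem]

lemma comm (h : IsCornerEquiv θ 𝓑 θ' 𝓒 j e T ψ) (hj : ∀ u, (θ u : B) * j = j * θ u) (u : H) :
    (θ' u : C) * e = e * θ' u := by
  have h1 := h.interior_left u j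
  rw [hj, h.interior_right, h.map_self] at h1
  exact h1.symm

lemma inv_interior_left (h : IsCornerEquiv θ 𝓑 θ' 𝓒 j e T ψ) (hj : ∀ u, (θ u : B) * j = j * θ u)
    (u : H) (c : C) : ψ (θ' u * c) = θ u * ψ c := by
  refine h.injective_of_mem (by rw [h.inv_left, h.inv_right])
    (by rw [← mul_assoc, ← hj, mul_assoc (θ u : B), h.inv_left, mul_assoc, h.inv_right]) ?_
  rw [h.map_inv, h.interior_left, h.map_inv, ← mul_assoc, ← h.comm hj]
  simp only [mul_assoc]

lemma inv_interior_right (h : IsCornerEquiv θ 𝓑 θ' 𝓒 j e T ψ) (hj : ∀ u, (θ u : B) * j = j * θ u)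
    (u : H) (c : C) : ψ (c * θ' u) = ψ c * θ u := by
  refine h.injective_of_mem (by rw [h.inv_left, h.inv_right])
    (by rw [← mul_assoc, h.inv_left, mul_assoc, hj, ← mul_assoc, h.inv_right]) ?_
  rw [h.map_inv, h.interior_right, h.map_inv]
  simp only [mul_assoc]
  rw [h.comm hj]

lemma isTwistedUnit [Group Γ] (h : IsCornerEquiv θ 𝓑 θ' 𝓒 j e T ψ) {φ : MulAut H} {x : Γ} {a a' : B}
    (ha : IsTwistedUnit θ 𝓑 j φ x a a') : IsTwistedUnit θ' 𝓒 e φ x (T a) (T a') where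
  mem := h.graded _ _ ha.mem
  mem' := h.graded _ _ ha.mem'
  left := h.left a
  right := h.right a
  left' := h.left a'
  right' := h.right a'
  mul_eq := by rw [h.map_mul, ha.right, ha.mul_eq, h.map_self]
  mul_eq' := by rw [h.map_mul, ha.right', ha.mul_eq', h.map_self]
  twist u := by rw [← h.interior_left, ha.twist, h.interior_right]

/-- The equivariant map `ψ` sends `e` back to `j`, so it would carry a failure of locality from `e`
to `j`. -/
lemma notMem_brauerKer [Group Γ] [IsLocalRing O] [Finite H] (h : IsCornerEquiv θ 𝓑 θ' 𝓒 j e T ψ)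
    (hj : ∀ u, (θ u : B) * j = j * θ u) (hjj : j * j = j)
    (h𝓒 : ∀ u, ∀ c ∈ 𝓒 1, (θ' u : C) * c * ((θ' u)⁻¹ : Cˣ) ∈ 𝓒 1)
    (hloc : j ∉ brauerKer θ (𝓑 1) ⊤) : e ∉ brauerKer θ' (𝓒 1) ⊤ := by
  intro he
  refine hloc ?_
  rw [← h.inv_self hjj]
  refine brauerKer_top_map ψ h𝓒 (h.inv_graded 1) (fun u c => ?_) he
  rw [← _root_.map_inv, ← _root_.map_inv, h.inv_interior_right hj, h.inv_interior_left hj]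

end IsCornerEquiv

variable [Group Γ]

/-- An embedding of interior algebras gives an equivalence of corners. -/
lemma exists_isCornerEquiv {P : Type*} [Group P] {θ : P →* Bˣ} {𝓑 : Γ → Submodule O B} {θ' : P →* Cˣ}
    {𝓒 : Γ → Submodule O C} {Q : Subgroup P} {j : B} {c : C} {t : corner O j →ₙₐ[O] corner O c}
    (ht : IsGradedEmbedding θ 𝓑 θ' 𝓒 Q j c t)
    (h𝓑 : ∀ {x y a c}, a ∈ 𝓑 x → c ∈ 𝓑 y → a * c ∈ 𝓑 (x * y))
    (h𝓒 : ∀ {x y a c}, a ∈ 𝓒 x → c ∈ 𝓒 y → a * c ∈ 𝓒 (x * y))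
    (hrefl : ∀ x, ∀ a : corner O j, (t a : C) ∈ 𝓒 x → (a : B) ∈ 𝓑 x)
    (hj1 : j ∈ 𝓑 1) (hju : ∀ u ∈ Q, (θ u : B) * j = j * θ u) (J : corner O j) (hJ : (J : B) = j) :
    ∃ T ψ, IsCornerEquiv (θ.comp Q.subtype) 𝓑 (θ'.comp Q.subtype) 𝓒 j (t J : C) T ψ := by
  have hjj : j * j = j := by
    have := J.2.1
    rwa [hJ] at this
  have hcor : ∀ a : B, j * a * j ∈ corner O j := fun a =>
    ⟨by rw [← mul_assoc, ← mul_assoc, hjj], by rw [mul_assoc, hjj]⟩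
  let K : B →ₗ[O] corner O j :=
    { toFun := fun a => ⟨j * a * j, hcor a⟩
      map_add' := fun a b => Subtype.ext (by simp [mul_add, add_mul])
      map_smul' := fun r a => Subtype.ext (by simp) }
  have hK : ∀ a : corner O j, K a = a := fun a => Subtype.ext (by
    change j * (a : B) * j = a
    rw [a.2.1, a.2.2])
  set e : C := (t J : C) with he
  have hJl : ∀ a, J * a = a := fun a => Subtype.ext (by
    change (J : B) * a = a
    rw [hJ, a.2.1])
  have hJr : ∀ a, a * J = a := fun a => Subtype.ext (by
    change (a : B) * J = a
    rw [hJ, a.2.2])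
  have hel : ∀ a, e * (t a : C) = t a := fun a => by
    have := congrArg t (hJl a)
    rw [map_mul] at this
    exact congrArg Subtype.val this
  have her : ∀ a, (t a : C) * e = t a := fun a => by
    have := congrArg t (hJr a)
    rw [map_mul] at this
    exact congrArg Subtype.val this
  have hee : e * e = e := hel J
  have hcoe : c * e = e := (t J).2.1
  have hcoe' : e * c = e := (t J).2.2
  have hex : ∀ d : C, ∃ a : corner O j, (t a : C) = e * d * e := by
    intro d
    have hd : e * d * e ∈ corner O c :=
      ⟨by rw [← mul_assoc, ← mul_assoc, hcoe], by rw [mul_assoc, hcoe']⟩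
    have : (⟨_, hd⟩ : corner O c) ∈ Set.range t := by
      rw [ht.image J hJ]
      refine Subtype.ext ?_
      change e * (e * d * e) * e = e * d * e
      rw [← mul_assoc, ← mul_assoc, hee, mul_assoc _ e e, hee]
    obtain ⟨a, ha⟩ := this
    exact ⟨a, congrArg Subtype.val ha⟩
  -- The inverse is a choice of preimages of `e * d * e`; its linearity follows from the injectivity
  -- of `t`.
  choose ψ hψ using hex
  have hinj : ∀ a b : corner O j, (t a : C) = t b → a = b := fun a b h => ht.injective (Subtype.ext h)
  let T' : B →ₗ[O] C :=
    { toFun := fun a => (t (K a) : C)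
      map_add' := fun a b => by rw [map_add, map_add]; rfl
      map_smul' := fun r a => by rw [map_smul, map_smul]; rfl }
  let ψ' : C →ₗ[O] B :=
    { toFun := fun d => (ψ d : B)
      map_add' := fun d d' => by
        have : ψ (d + d') = ψ d + ψ d' := hinj _ _ (by
          rw [map_add]
          change (t (ψ (d + d')) : C) = (t (ψ d) : C) + t (ψ d')
          rw [hψ, hψ, hψ, mul_add, add_mul])
        rw [this]; rfl
      map_smul' := fun r d => by
        have : ψ (r • d) = r • ψ d := hinj _ _ (by
          rw [map_smul]
          change (t (ψ (r • d)) : C) = r • (t (ψ d) : C)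
          rw [hψ, hψ, mul_smul_comm, smul_mul_assoc])
        rw [this]; rfl }
  have hT' : ∀ a : corner O j, T' a = t a := fun a => by
    change (t (K a) : C) = t a
    rw [hK]
  refine ⟨T', ψ', ?_, ?_, ?_, ?_, ?_, ?_, ?_, ?_, ?_, ?_, ?_, ?_⟩
  · rw [← hJ, hT']
  · intro a
    exact congrArg Subtype.val (hinj (ψ (T' a)) (K a) (by
      rw [hψ]
      change e * (t (K a) : C) * e = _
      rw [hel, her]))
  · intro d
    rw [← hψ d]
    exact hT' (ψ d)
  · intro a b
    have h1 : K (a * j * b) = K a * K b := Subtype.ext (by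
      change j * (a * j * b) * j = j * a * j * (j * b * j)
      have : j * a * j * (j * b * j) = j * a * (j * j) * b * j := by simp only [mul_assoc]
      rw [this, hjj]; simp only [mul_assoc])
    change (t (K a) : C) * t (K b) = t (K (a * j * b))
    rw [h1, map_mul]; rfl
  · exact fun a => hel (K a)
  · exact fun a => her (K a)
  · exact fun d => (ψ d).2.1
  · exact fun d => (ψ d).2.2
  · intro u a
    refine ht.interior_left u u.2 (K a) (K (θ u * a)) ?_
    change j * (θ u * a) * j = θ u * (j * a * j)
    rw [← mul_assoc, ← hju u u.2]
    simp only [mul_assoc]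
  · intro u a
    refine ht.interior_right u u.2 (K a) (K (a * θ u)) ?_
    change j * (a * θ u) * j = j * a * j * θ u
    rw [mul_assoc, mul_assoc, hju u u.2]
    simp only [mul_assoc]
  · intro x a ha
    refine ht.graded x (K a) ?_
    have := h𝓑 (h𝓑 hj1 ha) hj1
    rwa [one_mul, mul_one] at this
  · intro x d hd
    refine hrefl x (ψ d) ?_
    rw [hψ]
    have he1 : e ∈ 𝓒 1 := ht.graded 1 J (by rwa [hJ])
    have := h𝓒 (h𝓒 he1 hd) he1
    rwa [one_mul, mul_one] at this

/-- Conjugates of the restriction of an embedding to a smaller corner are embeddings. -/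
lemma exists_isGradedEmbedding {P : Type*} [Group P] {θ : P →* Bˣ} {𝓑 : Γ → Submodule O B}
    {θ' : P →* Cˣ} {𝓒 : Γ → Submodule O C} {Q : Subgroup P} {i j j₁ : B} {c d : C}
    {f : corner O i →ₙₐ[O] corner O c} (hf : IsGradedEmbedding θ 𝓑 θ' 𝓒 ⊤ i c f)
    (h𝓑 : ∀ {x y a c}, a ∈ 𝓑 x → c ∈ 𝓑 y → a * c ∈ 𝓑 (x * y))
    (h𝓒 : ∀ {x y a c}, a ∈ 𝓒 x → c ∈ 𝓒 y → a * c ∈ 𝓒 (x * y)) (hii : i * i = i)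
    (J₁ : corner O i) (hJ₁ : (J₁ : B) = j₁) (hj₁ : j₁ * j₁ = j₁)
    (hconj : FixedConj θ (𝓑 1) Q j₁ j) {e : C} (hed : e ∈ corner O d)
    (hconj' : FixedConj θ' (𝓒 1) Q (f J₁ : C) e) :
    ∃ t : corner O j →ₙₐ[O] corner O d, IsGradedEmbedding θ 𝓑 θ' 𝓒 Q j d t ∧
      ∀ J : corner O j, (J : B) = j → (t J : C) = e := by
  obtain ⟨w, hw, hw', rfl⟩ := hconj
  obtain ⟨z, hz, hz', rfl⟩ := hconj'
  subst hJ₁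
  have hji : ∀ {a : B}, a ∈ corner O (w * (J₁ : B) * (w⁻¹ : Bˣ)) →
      (J₁ : B) * ((w⁻¹ : Bˣ) * a * w) = (w⁻¹ : Bˣ) * a * w ∧
        ((w⁻¹ : Bˣ) * a * w) * J₁ = (w⁻¹ : Bˣ) * a * w := fun {a} ha => by
    constructor
    · conv_rhs => rw [← ha.1]
      simp [mul_assoc]
    · conv_rhs => rw [← ha.2]
      simp [mul_assoc]
  have hcor : ∀ {a : B}, a ∈ corner O (w * (J₁ : B) * (w⁻¹ : Bˣ)) →
      (w⁻¹ : Bˣ) * a * w ∈ corner O i := fun {a} ha =>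
    ⟨by rw [← (hji ha).1, ← mul_assoc, J₁.2.1], by rw [← (hji ha).2, mul_assoc, J₁.2.2]⟩
  -- Conjugation by `w⁻¹` moves the corner at `j` into the corner of `i`; the embedding sought is `a
  -- ↦ z f(w⁻¹ a w) z⁻¹`.
  let K : corner O (w * (J₁ : B) * (w⁻¹ : Bˣ)) → corner O i := fun a => ⟨(w⁻¹ : Bˣ) * a * w, hcor a.2⟩
  have hKl : ∀ a, (f J₁ : C) * f (K a) = f (K a) := fun a => by
    have : J₁ * K a = K a := Subtype.ext (hji a.2).1
    have h := congrArg (fun y => (f y : C)) this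
    simpa using h
  have hKr : ∀ a, (f (K a) : C) * f J₁ = f (K a) := fun a => by
    have : K a * J₁ = K a := Subtype.ext (hji a.2).2
    have h := congrArg (fun y => (f y : C)) this
    simpa using h
  have hel : ∀ a, z * (f J₁ : C) * (z⁻¹ : Cˣ) * (z * f (K a) * (z⁻¹ : Cˣ)) = z * f (K a) * (z⁻¹ : Cˣ) :=
    fun a => by
    conv_rhs => rw [← hKl a]
    simp [mul_assoc]
  have her : ∀ a, z * (f (K a) : C) * (z⁻¹ : Cˣ) * (z * (f J₁ : C) * (z⁻¹ : Cˣ)) =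
      z * f (K a) * (z⁻¹ : Cˣ) :=
    fun a => by
    conv_rhs => rw [← hKr a]
    simp [mul_assoc]
  have hcorC : ∀ a, z * (f (K a) : C) * (z⁻¹ : Cˣ) ∈ corner O d := fun a =>
    ⟨by rw [← hel, ← mul_assoc, hed.1], by rw [← her, mul_assoc, hed.2]⟩
  let t : corner O (w * (J₁ : B) * (w⁻¹ : Bˣ)) →ₙₐ[O] corner O d :=
    { toFun := fun a => ⟨z * f (K a) * (z⁻¹ : Cˣ), hcorC a⟩
      map_smul' := fun r a => Subtype.ext (by
        have : K (r • a) = r • K a := Subtype.ext (by simp [K])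
        change z * (f (K (r • a)) : C) * (z⁻¹ : Cˣ) = r • (z * (f (K a) : C) * (z⁻¹ : Cˣ))
        rw [this, map_smul]
        simp)
      map_zero' := Subtype.ext (by
        have : K 0 = 0 := Subtype.ext (by simp [K])
        change z * (f (K 0) : C) * (z⁻¹ : Cˣ) = 0
        rw [this, map_zero]
        simp)
      map_add' := fun a b => Subtype.ext (by
        have : K (a + b) = K a + K b := Subtype.ext (by simp [K, mul_add, add_mul])
        change z * (f (K (a + b)) : C) * (z⁻¹ : Cˣ) =
          z * (f (K a) : C) * (z⁻¹ : Cˣ) + z * (f (K b) : C) * (z⁻¹ : Cˣ)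
        rw [this, map_add]
        simp [mul_add, add_mul])
      map_mul' := fun a b => Subtype.ext (by
        have : K (a * b) = K a * K b := Subtype.ext (by simp [K, mul_assoc])
        change z * (f (K (a * b)) : C) * (z⁻¹ : Cˣ) =
          z * (f (K a) : C) * (z⁻¹ : Cˣ) * (z * (f (K b) : C) * (z⁻¹ : Cˣ))
        rw [this, map_mul]
        simp [mul_assoc]) }
  have ht : ∀ a, (t a : C) = z * f (K a) * (z⁻¹ : Cˣ) := fun _ => rfl
  have hK1 : ∀ J : corner O (w * (J₁ : B) * (w⁻¹ : Bˣ)), (J : B) = w * (J₁ : B) * (w⁻¹ : Bˣ) → K J = J₁ :=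
    fun J hJ => Subtype.ext (by
      change (w⁻¹ : Bˣ) * (J : B) * w = J₁
      rw [hJ]; simp [mul_assoc])
  have hwu : ∀ u ∈ Q, (w : B) * θ u = θ u * w := fun u hu => (hw.2 u hu).symm
  have hwu' : ∀ u ∈ Q, ((w⁻¹ : Bˣ) : B) * θ u = θ u * (w⁻¹ : Bˣ) := fun u hu => (hw'.2 u hu).symm
  refine ⟨t, ⟨?_, ?_, ?_, ?_, ?_⟩, fun J hJ => by rw [ht, hK1 J hJ]⟩
  · intro a b hab
    have h1 : z * (f (K a) : C) * (z⁻¹ : Cˣ) = z * (f (K b) : C) * (z⁻¹ : Cˣ) := congrArg Subtype.val hab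
    have h2 : (f (K a) : C) = f (K b) := by
      rwa [Units.mul_left_inj, Units.mul_right_inj] at h1
    have h3 : (w⁻¹ : Bˣ) * (a : B) * w = (w⁻¹ : Bˣ) * (b : B) * w :=
      congrArg Subtype.val (hf.injective (Subtype.ext h2))
    rw [Units.mul_left_inj, Units.mul_right_inj] at h3
    exact Subtype.ext h3
  · intro ε hε
    have hεt : (t ε : C) = z * (f J₁ : C) * (z⁻¹ : Cˣ) := by rw [ht, hK1 ε hε]
    refine Set.Subset.antisymm ?_ ?_
    · rintro _ ⟨a, rfl⟩
      refine Subtype.ext ?_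
      change (t ε : C) * t a * t ε = t a
      rw [hεt, ht, hel, her]
    · intro c' hc'
      have hc1 : (t ε : C) * c' * t ε = c' := congrArg Subtype.val hc'
      rw [hεt] at hc1
      have hff : (f J₁ : C) * f J₁ = f J₁ := by
        have : J₁ * J₁ = J₁ := Subtype.ext hj₁
        have h := congrArg (fun y => (f y : C)) this
        simpa using h
      set y : C := (z⁻¹ : Cˣ) * c' * z with hy
      have hyl : (f J₁ : C) * y = y := by
        rw [hy, ← hc1]; simp only [mul_assoc, Units.inv_mul_cancel_left]; rw [← mul_assoc (f J₁ : C), hff]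
      have hyr : y * (f J₁ : C) = y := by
        rw [hy, ← hc1]; simp only [mul_assoc, Units.inv_mul_cancel_left, Units.inv_mul, mul_one]; rw [hff]
      have hyc : y ∈ corner O c := ⟨by rw [← hyl, ← mul_assoc, (f J₁).2.1],
        by rw [← hyr, mul_assoc, (f J₁).2.2]⟩
      -- The range of `f` is known only as the corner of `f(i)`; it contains `y` because `f(J₁)` is
      -- below `f(i)`.
      let I : corner O i := ⟨i, hii, hii⟩
      have hIl : (f I : C) * f J₁ = f J₁ := by
        have : I * J₁ = J₁ := Subtype.ext J₁.2.1
        have h := congrArg (fun y => (f y : C)) this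
        simpa using h
      have hIr : (f J₁ : C) * f I = f J₁ := by
        have : J₁ * I = J₁ := Subtype.ext J₁.2.2
        have h := congrArg (fun y => (f y : C)) this
        simpa using h
      have hmem : (⟨y, hyc⟩ : corner O c) ∈ Set.range f := by
        rw [hf.image I rfl]
        refine Subtype.ext ?_
        change (f I : C) * y * f I = y
        rw [← hyl, ← mul_assoc, hIl, hyl, ← hyr, mul_assoc, hIr]
      obtain ⟨a, ha⟩ := hmem
      have ha' : (f a : C) = y := congrArg Subtype.val ha
      have hJa : J₁ * a * J₁ = a := hf.injective (Subtype.ext (by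
        rw [map_mul, map_mul]
        change (f J₁ : C) * f a * f J₁ = f a
        rw [ha', hyl, hyr]))
      have hJa' : (J₁ : B) * a * J₁ = a := congrArg Subtype.val hJa
      have haw : w * (a : B) * (w⁻¹ : Bˣ) ∈ corner O (w * (J₁ : B) * (w⁻¹ : Bˣ)) := by
        constructor
        · rw [← hJa']
          simp only [mul_assoc, Units.inv_mul_cancel_left]
          rw [← mul_assoc (J₁ : B) J₁, hj₁]
        · rw [← hJa']
          simp only [mul_assoc, Units.inv_mul_cancel_left]
          rw [← mul_assoc (J₁ : B) J₁, hj₁]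
      refine ⟨⟨_, haw⟩, Subtype.ext ?_⟩
      have hKa : K ⟨_, haw⟩ = a := Subtype.ext (by
        change (w⁻¹ : Bˣ) * (w * (a : B) * (w⁻¹ : Bˣ)) * w = a
        simp [mul_assoc])
      rw [ht, hKa, ha', hy]
      simp [mul_assoc]
  · intro u hu a a' haa
    have h1 := hf.interior_left u trivial (K a) (K a') (by
      change (w⁻¹ : Bˣ) * (a' : B) * w = θ u * ((w⁻¹ : Bˣ) * (a : B) * w)
      rw [haa, ← mul_assoc, hwu' u hu]
      simp only [mul_assoc])
    rw [ht, ht, h1, ← mul_assoc, ← hz.2 u hu]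
    simp only [mul_assoc]
  · intro u hu a a' haa
    have h1 := hf.interior_right u trivial (K a) (K a') (by
      change (w⁻¹ : Bˣ) * (a' : B) * w = (w⁻¹ : Bˣ) * (a : B) * w * θ u
      rw [haa, mul_assoc _ _ (θ u : B), hwu u hu]
      simp only [mul_assoc])
    rw [ht, ht, h1, mul_assoc _ _ (θ' u : C), ← hz'.2 u hu]
    simp only [mul_assoc]
  · intro x a ha
    have h1 := hf.graded x (K a) (by
      have := h𝓑 (h𝓑 hw'.1 ha) hw.1
      rwa [one_mul, mul_one] at this)
    have := h𝓒 (h𝓒 hz.1 h1) hz'.1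
    rwa [one_mul, mul_one] at this

end Corners
end

/-! ### Graded embeddings reflect degrees -/

noncomputable section

section Reflect

variable {O S G G' Γ : Type*} [CommRing O] [Ring S] [Algebra O S] [Group G] [Group G'] [Group Γ]
  {ω : G →* Γ} {ω' : G' →* Γ}

lemma sum_gradeComp_injective [Fintype Γ] {b c : Γ → MonoidAlgebra O G}
    (hb : ∀ y, b y ∈ gradeComp O ω y) (hc : ∀ y, c y ∈ gradeComp O ω y)
    (h : ∑ y, b y = ∑ y, c y) : b = c := by
  have key : ∀ d : Γ → MonoidAlgebra O G, (∀ y, d y ∈ gradeComp O ω y) → ∀ g,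
      (∑ y, d y).coeff g = (d (ω g)).coeff g := fun d hd g => by
    rw [MonoidAlgebra.coeff_sum, Finset.sum_apply']
    refine Finset.sum_eq_single _ (fun y _ hy => ?_) (fun h => absurd (Finset.mem_univ _) h)
    exact coeff_eq_zero_of_mem_gradeComp (hd y) (Ne.symm hy)
  funext y
  ext g
  by_cases hg : ω g = y
  · subst hg
    rw [← key b hb, h, key c hc]
  · rw [coeff_eq_zero_of_mem_gradeComp (hb y) hg, coeff_eq_zero_of_mem_gradeComp (hc y) hg]

lemma exists_sum_gradeComp [Fintype Γ] [Finite G] (a : MonoidAlgebra O G) :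
    ∃ b : Γ → MonoidAlgebra O G, (∀ y, b y ∈ gradeComp O ω y) ∧ ∑ y, b y = a := by
  classical
  have := Fintype.ofFinite G
  refine ⟨fun y => ∑ g with ω g = y, a.coeff g • MonoidAlgebra.of O G g, fun y => ?_, ?_⟩
  · refine Submodule.sum_mem _ fun g hg => Submodule.smul_mem _ _ (of_mem_gradeComp ?_)
    exact (Finset.mem_filter.1 hg).2
  · exact (Finset.sum_fiberwise _ _ _).trans (sum_coeff_smul_of a)

lemma eq_zero_of_sum_mem_tensorGradeComp [Fintype Γ] [Finite G'] {c : Γ → S ⊗[O] MonoidAlgebra O G'}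
    (hc : ∀ y, c y ∈ tensorGradeComp O S ω' y) {x y : Γ} {d : S ⊗[O] MonoidAlgebra O G'}
    (hd : d ∈ tensorGradeComp O S ω' x) (h : ∑ y, c y = d) (hxy : y ≠ x) : c y = 0 := by
  have := Fintype.ofFinite G'
  have key : ∀ g, tensorCoeff g (c (ω' g)) = tensorCoeff g d := fun g => by
    have h1 := map_sum (tensorCoeff (O := O) (S := S) g) c Finset.univ
    rw [h] at h1
    rw [h1]
    symm
    refine Finset.sum_eq_single (ω' g) (fun z _ hz => ?_) (fun h => absurd (Finset.mem_univ _) h)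
    exact tensorCoeff_eq_zero (hc z) (Ne.symm hz)
  rw [← sum_tensorCoeff (c y)]
  refine Finset.sum_eq_zero fun g _ => ?_
  by_cases hg : ω' g = y
  · subst hg
    rw [key, tensorCoeff_eq_zero hd hxy, TensorProduct.zero_tmul]
  · rw [tensorCoeff_eq_zero (hc y) hg, TensorProduct.zero_tmul]

/-- An injective graded map on a corner of `O G` reflects degrees. -/
lemma mem_gradeComp_of_map_mem [Finite Γ] [Finite G] [Finite G'] {j : MonoidAlgebra O G}
    (hj : j ∈ gradeComp O ω 1) (hjj : j * j = j)
    (t : corner O j → S ⊗[O] MonoidAlgebra O G') (ht : Function.Injective t) (ht0 : t 0 = 0)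
    (htadd : ∀ a b, t (a + b) = t a + t b)
    (htg : ∀ x, ∀ a : corner O j, (a : MonoidAlgebra O G) ∈ gradeComp O ω x → t a ∈ tensorGradeComp O S ω' x)
    {x : Γ} {a : corner O j} (hta : t a ∈ tensorGradeComp O S ω' x) :
    (a : MonoidAlgebra O G) ∈ gradeComp O ω x := by
  have := Fintype.ofFinite Γ
  obtain ⟨b, hb, hba⟩ := exists_sum_gradeComp (ω := ω) (a : MonoidAlgebra O G)
  have hjb : ∀ y, j * b y * j ∈ gradeComp O ω y := fun y => by
    have h := gradeComp_mul (gradeComp_mul hj (hb y)) hj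
    rwa [one_mul, mul_one] at h
  -- Compression by `j`, which has degree 1, fixes `a`; by uniqueness of components it fixes each
  -- component.
  have hbj := sum_gradeComp_injective hjb hb (by
    rw [← Finset.sum_mul, ← Finset.mul_sum, hba, a.2.1, a.2.2])
  have hcor : ∀ y, b y ∈ corner O j := fun y => by
    rw [← hbj]
    exact ⟨by rw [← mul_assoc, ← mul_assoc, hjj], by rw [mul_assoc, hjj]⟩
  let B : Γ → corner O j := fun y => ⟨b y, hcor y⟩
  have hB : ∑ y, B y = a := Subtype.ext (by
    rw [← hba]
    exact map_sum (corner O j).subtype B Finset.univ)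
  let t' : corner O j →+ S ⊗[O] MonoidAlgebra O G' := ⟨⟨t, ht0⟩, htadd⟩
  have hsum : ∑ y, t (B y) = t a := by
    rw [← hB]
    exact (map_sum t' B Finset.univ).symm
  -- The image of a component of degree `y ≠ x` is the component of degree `y` of an element of
  -- degree `x`, so it vanishes, and injectivity applies.
  have hzero : ∀ y, y ≠ x → b y = 0 := fun y hy => by
    have h := eq_zero_of_sum_mem_tensorGradeComp (fun y => htg y (B y) (hb y)) hta hsum hy
    exact congrArg Subtype.val (ht (h.trans ht0.symm))
  rw [← hba, Finset.sum_eq_single x (fun y _ hy => hzero y hy) (fun h => absurd (Finset.mem_univ _) h)]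
  exact hb x

end Reflect
end

/-! ### Trace forms, dual families and the Casimir element -/

noncomputable section

section TracePair

variable {O S ι : Type*} [CommRing O] [Ring S] [Algebra O S] [Fintype ι]

/-- A symmetrizing form `τ` on `S` with dual bases (or generating families) `E` and `F`, such that the
Casimir element `∑ F_k ⊗ E_k` induces `τ`, as for the trace form of a matrix algebra. -/
structure IsTracePair (τ : S →ₗ[O] O) (E F : ι → S) : Prop where
  symm : ∀ x y, τ (x * y) = τ (y * x)
  expand : ∀ y, ∑ k, τ (F k * y) • E k = y
  casimir : ∀ y, ∑ k, F k * y * E k = τ y • 1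

namespace IsTracePair

variable {τ : S →ₗ[O] O} {E F : ι → S}

lemma ext (h : IsTracePair τ E F) {x y : S} (hxy : ∀ z, τ (z * x) = τ (z * y)) : x = y := by
  rw [← h.expand x, ← h.expand y]
  exact Finset.sum_congr rfl fun k _ => by rw [hxy]

lemma expand' (h : IsTracePair τ E F) (y : S) : ∑ k, τ (E k * y) • F k = y := by
  refine h.ext fun z => ?_
  conv_rhs => rw [← h.expand z, Finset.sum_mul, map_sum]
  rw [Finset.mul_sum, map_sum]
  refine Finset.sum_congr rfl fun k _ => ?_
  rw [mul_smul_comm, map_smul, smul_mul_assoc, map_smul, smul_eq_mul, smul_eq_mul, mul_comm, h.symm z]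

variable {V : Type*} [AddCommGroup V] [Module O V]

/-- Invariance of the Casimir element `∑ F_k ⊗ E_k`, read through an arbitrary bilinear map `β`:
both sides expand to the same double sum. -/
lemma sum_mul_left (h : IsTracePair τ E F) (β : S →ₗ[O] S →ₗ[O] V) (y : S) :
    ∑ k, β (F k * y) (E k) = ∑ k, β (F k) (y * E k) := by
  have h1 : ∀ k, β (F k * y) (E k) = ∑ m, τ (F k * (y * E m)) • β (F m) (E k) := fun k => by
    conv_lhs => rw [← h.expand' (F k * y)]
    rw [map_sum, LinearMap.sum_apply]
    refine Finset.sum_congr rfl fun m _ => ?_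
    rw [map_smul, LinearMap.smul_apply, h.symm, mul_assoc]
  have h2 : ∀ m, β (F m) (y * E m) = ∑ k, τ (F k * (y * E m)) • β (F m) (E k) := fun m => by
    conv_lhs => rw [← h.expand (y * E m)]
    rw [map_sum]
    exact Finset.sum_congr rfl fun k _ => map_smul _ _ _
  rw [Finset.sum_congr rfl fun k _ => h1 k, Finset.sum_congr rfl fun k _ => h2 k, Finset.sum_comm]

lemma sum_mul_right (h : IsTracePair τ E F) (β : S →ₗ[O] S →ₗ[O] V) (y : S) :
    ∑ k, β (y * F k) (E k) = ∑ k, β (F k) (E k * y) := by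
  have h1 : ∀ k, β (y * F k) (E k) = ∑ m, τ (F k * (E m * y)) • β (F m) (E k) := fun k => by
    conv_lhs => rw [← h.expand' (y * F k)]
    rw [map_sum, LinearMap.sum_apply]
    refine Finset.sum_congr rfl fun m _ => ?_
    rw [map_smul, LinearMap.smul_apply, ← mul_assoc, h.symm]
  have h2 : ∀ m, β (F m) (E m * y) = ∑ k, τ (F k * (E m * y)) • β (F m) (E k) := fun m => by
    conv_lhs => rw [← h.expand (E m * y)]
    rw [map_sum]
    exact Finset.sum_congr rfl fun k _ => map_smul _ _ _
  rw [Finset.sum_congr rfl fun k _ => h1 k, Finset.sum_congr rfl fun k _ => h2 k, Finset.sum_comm]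

/-- The Casimir element is symmetric because the form is. -/
lemma sum_swap (h : IsTracePair τ E F) (β : S →ₗ[O] S →ₗ[O] V) :
    ∑ k, β (E k) (F k) = ∑ k, β (F k) (E k) := by
  have h1 : ∀ k, β (E k) (F k) = ∑ m, τ (E m * E k) • β (F m) (F k) := fun k => by
    conv_lhs => rw [← h.expand' (E k)]
    rw [map_sum, LinearMap.sum_apply]
    exact Finset.sum_congr rfl fun m _ => by rw [map_smul, LinearMap.smul_apply]
  have h2 : ∀ m, β (F m) (E m) = ∑ k, τ (E m * E k) • β (F m) (F k) := fun m => by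
    conv_lhs => rw [← h.expand' (E m)]
    rw [map_sum]
    exact Finset.sum_congr rfl fun k _ => by rw [map_smul, h.symm]
  rw [Finset.sum_congr rfl fun k _ => h1 k, Finset.sum_congr rfl fun k _ => h2 k, Finset.sum_comm]

lemma casimir' (h : IsTracePair τ E F) (y : S) : ∑ k, E k * y * F k = τ y • 1 := by
  rw [← h.casimir]
  exact h.sum_swap ((LinearMap.mul O S).comp (LinearMap.mulRight O y))

/-- The Casimir element does not depend on the basis. This allows matrix units to be replaced by a
basis that the group permutes. -/
lemma exists_of_basis (h : IsTracePair τ E F) {κ : Type*} [Fintype κ] (b : Module.Basis κ O S) :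
    ∃ F' : κ → S, IsTracePair τ b F' ∧ ∀ k y, τ (F' k * y) = b.coord k y := by
  have h1 : ∀ k y, τ ((∑ m, b.coord k (E m) • F m) * y) = b.coord k y := fun k y => by
    conv_rhs => rw [← h.expand y]
    rw [Finset.sum_mul, map_sum, map_sum]
    exact Finset.sum_congr rfl fun m _ => by
      rw [smul_mul_assoc, map_smul, map_smul, smul_eq_mul, smul_eq_mul, mul_comm]
  refine ⟨fun k => ∑ m, b.coord k (E m) • F m, ⟨h.symm, fun y => ?_, fun y => ?_⟩, h1⟩
  · rw [Finset.sum_congr rfl fun k _ => by rw [h1]]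
    exact b.sum_repr y
  · rw [← h.casimir]
    have h2 : ∀ m, F m * y * E m = ∑ k, b.coord k (E m) • (F m * y * b k) := fun m => by
      conv_lhs => rw [← b.sum_repr (E m)]
      rw [Finset.mul_sum]
      exact Finset.sum_congr rfl fun k _ => mul_smul_comm _ _ _
    rw [Finset.sum_congr rfl fun m _ => h2 m, Finset.sum_comm]
    refine Finset.sum_congr rfl fun k _ => ?_
    rw [Finset.sum_mul, Finset.sum_mul]
    exact Finset.sum_congr rfl fun m _ => by rw [smul_mul_assoc, smul_mul_assoc]

end IsTracePair

/-- The families are the matrix units and their transposes. -/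
lemma exists_isTracePair_trace (W : Type*) [AddCommGroup W] [Module O W] [Module.Free O W]
    [Module.Finite O W] [Nontrivial O] :
    ∃ (n : ℕ) (E F : Fin n × Fin n → Module.End O W), IsTracePair (LinearMap.trace O W) E F := by
  classical
  let b := Module.finBasis O W
  have hmul : ∀ i k (y : Module.End O W), (b.coord i).smulRight (b k) * y =
      (b.coord i ∘ₗ y).smulRight (b k) := fun i k y => LinearMap.ext fun v => rfl
  refine ⟨_, fun q => (b.coord q.2).smulRight (b q.1), fun q => (b.coord q.1).smulRight (b q.2),
    LinearMap.trace_mul_comm O, fun y => b.ext fun m => ?_, fun y => b.ext fun m => ?_⟩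
  · rw [LinearMap.sum_apply, Fintype.sum_prod_type, ← b.sum_repr (y (b m))]
    refine Finset.sum_congr rfl fun i _ => ?_
    rw [Finset.sum_eq_single m]
    · rw [hmul, LinearMap.trace_smulRight, LinearMap.smul_apply, LinearMap.smulRight_apply]
      simp
    · intro k _ hk
      rw [LinearMap.smul_apply, LinearMap.smulRight_apply]
      simp [hk.symm]
    · exact fun h => absurd (Finset.mem_univ _) h
  · have h1 : LinearMap.trace O W y = ∑ i, b.coord i (y (b i)) := by
      rw [LinearMap.trace_eq_matrix_trace O b, Matrix.trace]
      exact Finset.sum_congr rfl fun i _ => LinearMap.toMatrix_apply b b y i i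
    rw [LinearMap.sum_apply, Fintype.sum_prod_type, h1, LinearMap.smul_apply, Module.End.one_apply,
      Finset.sum_smul]
    refine Finset.sum_congr rfl fun i _ => ?_
    rw [Finset.sum_eq_single m]
    · simp [Module.End.mul_apply]
    · intro k _ hk
      simp [Module.End.mul_apply, hk.symm]
    · exact fun h => absurd (Finset.mem_univ _) h

section Tensor

variable {A : Type*} [Ring A] [Algebra O A]

/-- The map `τ ⊗ 1 : S ⊗ A → A`. -/
def tensorTrace (A : Type*) [Ring A] [Algebra O A] (τ : S →ₗ[O] O) : S ⊗[O] A →ₗ[O] A :=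
  TensorProduct.lift (LinearMap.lsmul O A ∘ₗ τ)

variable {τ : S →ₗ[O] O} {E F : ι → S}

@[simp]
lemma tensorTrace_tmul (s : S) (a : A) : tensorTrace A τ (s ⊗ₜ[O] a) = τ s • a := rfl

lemma tensorTrace_one_tmul_mul (a : A) (y : S ⊗[O] A) :
    tensorTrace A τ (1 ⊗ₜ[O] a * y) = a * tensorTrace A τ y := by
  induction y with
  | zero => rw [mul_zero, map_zero, mul_zero]
  | add c d hc hd => rw [mul_add, map_add, hc, hd, map_add, mul_add]
  | tmul s c =>
    rw [Algebra.TensorProduct.tmul_mul_tmul, tensorTrace_tmul, tensorTrace_tmul, one_mul, mul_smul_comm]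

lemma tensorTrace_mul_one_tmul (a : A) (y : S ⊗[O] A) :
    tensorTrace A τ (y * 1 ⊗ₜ[O] a) = tensorTrace A τ y * a := by
  induction y with
  | zero => rw [zero_mul, map_zero, zero_mul]
  | add c d hc hd => rw [add_mul, map_add, hc, hd, map_add, add_mul]
  | tmul s c =>
    rw [Algebra.TensorProduct.tmul_mul_tmul, tensorTrace_tmul, tensorTrace_tmul, mul_one, smul_mul_assoc]

namespace IsTracePair

lemma tensorTrace_comm (h : IsTracePair τ E F) (s : S) (y : S ⊗[O] A) :
    tensorTrace A τ (s ⊗ₜ[O] 1 * y) = tensorTrace A τ (y * s ⊗ₜ[O] 1) := by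
  induction y with
  | zero => rw [mul_zero, zero_mul]
  | add c d hc hd => rw [mul_add, map_add, hc, hd, add_mul, map_add]
  | tmul t c =>
    rw [Algebra.TensorProduct.tmul_mul_tmul, Algebra.TensorProduct.tmul_mul_tmul, tensorTrace_tmul,
      tensorTrace_tmul, mul_one, one_mul, h.symm]

lemma casimir_tensor (h : IsTracePair τ E F) (y : S ⊗[O] A) :
    ∑ k, F k ⊗ₜ[O] 1 * y * E k ⊗ₜ[O] 1 = (1 : S) ⊗ₜ[O] tensorTrace A τ y := by
  induction y with
  | zero => simp
  | add c d hc hd =>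
    rw [map_add, TensorProduct.tmul_add, ← hc, ← hd, ← Finset.sum_add_distrib]
    exact Finset.sum_congr rfl fun k _ => by rw [mul_add, add_mul]
  | tmul s c =>
    rw [tensorTrace_tmul, TensorProduct.tmul_smul, TensorProduct.smul_tmul', ← h.casimir,
      TensorProduct.sum_tmul]
    exact Finset.sum_congr rfl fun k _ => by
      rw [Algebra.TensorProduct.tmul_mul_tmul, Algebra.TensorProduct.tmul_mul_tmul, one_mul, mul_one]

lemma casimir_tensor' (h : IsTracePair τ E F) (y : S ⊗[O] A) :
    ∑ k, E k ⊗ₜ[O] 1 * y * F k ⊗ₜ[O] 1 = (1 : S) ⊗ₜ[O] tensorTrace A τ y := by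
  induction y with
  | zero => simp
  | add c d hc hd =>
    rw [map_add, TensorProduct.tmul_add, ← hc, ← hd, ← Finset.sum_add_distrib]
    exact Finset.sum_congr rfl fun k _ => by rw [mul_add, add_mul]
  | tmul s c =>
    rw [tensorTrace_tmul, TensorProduct.tmul_smul, TensorProduct.smul_tmul', ← h.casimir',
      TensorProduct.sum_tmul]
    exact Finset.sum_congr rfl fun k _ => by
      rw [Algebra.TensorProduct.tmul_mul_tmul, Algebra.TensorProduct.tmul_mul_tmul, one_mul, mul_one]

lemma expand_tensor (h : IsTracePair τ E F) (y : S ⊗[O] A) :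
    ∑ k, E k ⊗ₜ[O] tensorTrace A τ (F k ⊗ₜ[O] 1 * y) = y := by
  induction y with
  | zero => simp
  | add c d hc hd =>
    conv_rhs => rw [← hc, ← hd]
    rw [← Finset.sum_add_distrib]
    exact Finset.sum_congr rfl fun k _ => by rw [mul_add, map_add, TensorProduct.tmul_add]
  | tmul s c =>
    conv_rhs => rw [← h.expand s, TensorProduct.sum_tmul]
    exact Finset.sum_congr rfl fun k _ => by
      rw [Algebra.TensorProduct.tmul_mul_tmul, tensorTrace_tmul, one_mul, TensorProduct.tmul_smul,
        TensorProduct.smul_tmul']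

end IsTracePair

end Tensor

end TracePair
end

/-! ### Equivariance of traces and the element that defines the dual map -/

noncomputable section

section TraceEquivariance

variable {O S ι : Type*} [CommRing O] [Ring S] [Algebra O S] [Fintype ι]

/-- The basis is permuted and the form is invariant under conjugation, so the dual basis is permuted
in the same way. -/
lemma IsTracePair.dual_equivariant {τ : S →ₗ[O] O} {b : Module.Basis ι O S} {F : ι → S}
    (h : IsTracePair τ b F) (hF : ∀ k y, τ (F k * y) = b.coord k y) (u : Sˣ) (p : Equiv.Perm ι)
    (hp : ∀ k, b (p k) = u * b k * (u⁻¹ : Sˣ)) (k : ι) : F (p k) = u * F k * (u⁻¹ : Sˣ) := by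
  classical
  have key : b.coord (p k) = b.coord k ∘ₗ (LinearMap.mulLeft O ((u⁻¹ : Sˣ) : S) ∘ₗ
      LinearMap.mulRight O (u : S)) := by
    refine b.ext fun m => ?_
    obtain ⟨m, rfl⟩ := p.surjective m
    have h1 : ((u⁻¹ : Sˣ) : S) * (b (p m) * u) = b m := by
      rw [hp]; simp [mul_assoc]
    rw [LinearMap.comp_apply, LinearMap.comp_apply, LinearMap.mulLeft_apply, LinearMap.mulRight_apply, h1]
    simp [Finsupp.single_apply]
  refine h.ext fun z => ?_
  rw [h.symm, hF, key, LinearMap.comp_apply, LinearMap.comp_apply, LinearMap.mulLeft_apply,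
    LinearMap.mulRight_apply, ← hF, h.symm z, mul_assoc, mul_assoc, h.symm (u : S)]
  simp only [mul_assoc]

variable {A : Type*} [Ring A] [Algebra O A]

lemma tensorTrace_conj {τ : S →ₗ[O] O} (hτ : ∀ x y, τ (x * y) = τ (y * x)) {s s' : S}
    (hs : s' * s = 1) (a a' : A) (y : S ⊗[O] A) :
    tensorTrace A τ (s ⊗ₜ[O] a * y * s' ⊗ₜ[O] a') = a * tensorTrace A τ y * a' := by
  induction y with
  | zero => rw [mul_zero, zero_mul, map_zero, mul_zero, zero_mul]
  | add c d hc hd => rw [mul_add, add_mul, map_add, hc, hd, map_add, mul_add, add_mul]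
  | tmul t c =>
    rw [Algebra.TensorProduct.tmul_mul_tmul, Algebra.TensorProduct.tmul_mul_tmul, tensorTrace_tmul,
      tensorTrace_tmul, hτ, ← mul_assoc, hs, one_mul, mul_smul_comm, smul_mul_assoc]

end TraceEquivariance

section DualElement

variable {O S G Γ H ι : Type*} [CommRing O] [Ring S] [Algebra O S] [Group G] [Group Γ] [Group H]
  {ω : G →* Γ} {κ : H →* Sˣ} {σ : H →* G} {τ : S →ₗ[O] O}

lemma tensorTrace_mem {x : Γ} {y : S ⊗[O] MonoidAlgebra O G} (hy : y ∈ tensorGradeComp O S ω x) :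
    tensorTrace (MonoidAlgebra O G) τ y ∈ gradeComp O ω x :=
  tensorGradeComp_le (V := (gradeComp O ω x).comap (tensorTrace (MonoidAlgebra O G) τ))
    (fun s _ ha => Submodule.smul_mem _ (τ s) ha) hy

lemma tensorInterior_conj_fixed {e : S ⊗[O] MonoidAlgebra O G} (he : e ∈ tensorFixed O ω κ σ) (u : H) :
    (κ u : S) ⊗ₜ[O] MonoidAlgebra.of O G (σ u) * e =
      e * (κ u : S) ⊗ₜ[O] MonoidAlgebra.of O G (σ u) := he.2 u trivial

lemma tensorTrace_equivariant (hτ : ∀ x y, τ (x * y) = τ (y * x)) {e : S ⊗[O] MonoidAlgebra O G}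
    (he : e ∈ tensorFixed O ω κ σ) (s : S) (u : H) :
    tensorTrace (MonoidAlgebra O G) τ (((κ u : S) * s * ((κ u)⁻¹ : Sˣ)) ⊗ₜ[O] 1 * e) =
      MonoidAlgebra.of O G (σ u) * tensorTrace (MonoidAlgebra O G) τ (s ⊗ₜ[O] 1 * e) *
        MonoidAlgebra.of O G (σ u)⁻¹ := by
  have h1 := tensorTrace_conj hτ (s := (κ u : S)) (s' := ((κ u)⁻¹ : Sˣ)) (Units.inv_mul _)
    (MonoidAlgebra.of O G (σ u)) (MonoidAlgebra.of O G (σ u)⁻¹) (s ⊗ₜ[O] 1 * e)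
  have hinv : MonoidAlgebra.of O G (σ u) * MonoidAlgebra.of O G (σ u)⁻¹ = 1 := by
    rw [← map_mul, mul_inv_cancel, map_one]
  have h2 : e = (κ u : S) ⊗ₜ[O] MonoidAlgebra.of O G (σ u) * e *
      ((κ u)⁻¹ : Sˣ).val ⊗ₜ[O] MonoidAlgebra.of O G (σ u)⁻¹ := by
    rw [tensorInterior_conj_fixed he, mul_assoc, Algebra.TensorProduct.tmul_mul_tmul, Units.mul_inv,
      hinv, ← Algebra.TensorProduct.one_def, mul_one]
  rw [← h1]
  congr 1
  conv_lhs => rw [h2]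
  rw [← mul_assoc, ← mul_assoc, ← mul_assoc, Algebra.TensorProduct.tmul_mul_tmul,
    Algebra.TensorProduct.tmul_mul_tmul, one_mul, mul_one, Units.inv_mul_cancel_right]

/-- The terms of the expansion of `e` in the basis `E` of `S`. -/
def basisTerm (τ : S →ₗ[O] O) (E F : ι → S) (e : S ⊗[O] MonoidAlgebra O G) (k : ι) :
    S ⊗[O] MonoidAlgebra O G :=
  E k ⊗ₜ[O] tensorTrace (MonoidAlgebra O G) τ (F k ⊗ₜ[O] 1 * e)

lemma basisTerm_mem {E F : ι → S} {e : S ⊗[O] MonoidAlgebra O G} (he : e ∈ tensorFixed O ω κ σ) (k : ι) :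
    basisTerm τ E F e k ∈ tensorGradeComp O S ω 1 := by
  refine tmul_mem_tensorGradeComp _ (tensorTrace_mem ?_)
  exact tensorGradeComp_one_mul (tmul_mem_tensorGradeComp _ one_mem_gradeComp) he.1

lemma basisTerm_act {E F : ι → S} {e : S ⊗[O] MonoidAlgebra O G} (he : e ∈ tensorFixed O ω κ σ)
    (hτ : ∀ x y, τ (x * y) = τ (y * x)) {act : H →* Equiv.Perm ι}
    (hE : ∀ u k, E (act u k) = κ u * E k * ((κ u)⁻¹ : Sˣ))
    (hF : ∀ u k, F (act u k) = κ u * F k * ((κ u)⁻¹ : Sˣ)) (u : H) (k : ι) :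
    basisTerm τ E F e (act u k) = (tensorInterior (O := O) κ σ u).val * basisTerm τ E F e k *
      ((tensorInterior (O := O) κ σ u)⁻¹).val := by
  rw [basisTerm, basisTerm, hE, hF, tensorTrace_equivariant hτ he, tensorInterior_val,
    tensorInterior_inv_val, Algebra.TensorProduct.tmul_mul_tmul, Algebra.TensorProduct.tmul_mul_tmul]

variable [Fintype ι] [IsLocalRing O] [Finite H]

/-- Expand `e` as `∑ E_k ⊗ (τ ⊗ 1)(F_k e)`. Modulo the Brauer kernel only the indices fixed by `H`
remain, and for those `F_k` is fixed. If all these traces were in `J`, then after compression by `l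
⊗ j` the idempotent `e` would lie in `l S^H l ⊗ J` modulo the kernel, hence in the kernel. -/
lemma exists_trace_notMem {E F : ι → S} (hEF : IsTracePair τ E F) {act : H →* Equiv.Perm ι}
    (hE : ∀ u k, E (act u k) = κ u * E k * ((κ u)⁻¹ : Sˣ))
    (hF : ∀ u k, F (act u k) = κ u * F k * ((κ u)⁻¹ : Sˣ))
    {l : S} {j : MonoidAlgebra O G} {JS : Submodule O S} {J : Submodule O (MonoidAlgebra O G)}
    (hl : l ∈ fixedPts (O := O) κ ⊤ ⊤) (hll : l * l = l) (hj : j ∈ groupFixed O ω σ)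
    (hJS : IsRadicalAt (fixedPts (O := O) κ ⊤ ⊤) l JS) (hJ : IsRadicalAt (groupFixed O ω σ) j J)
    {e : S ⊗[O] MonoidAlgebra O G}
    (hee : e * e = e) (heF : e ∈ tensorFixed O ω κ σ) (he : e ∉ tensorBrauerKer O ω κ σ)
    (hle : l ⊗ₜ[O] j * e = e) (hel : e * l ⊗ₜ[O] j = e) :
    ∃ s ∈ fixedPts (O := O) κ ⊤ ⊤, tensorTrace (MonoidAlgebra O G) τ (s ⊗ₜ[O] 1 * e) ∉ J := by
  by_contra hno
  have hno' : ∀ s ∈ fixedPts (O := O) κ ⊤ ⊤,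
      tensorTrace (MonoidAlgebra O G) τ (s ⊗ₜ[O] 1 * e) ∈ J := fun s hs => by
    by_contra h
    exact hno ⟨s, hs, h⟩
  have hLF : l ⊗ₜ[O] j ∈ tensorFixed O ω κ σ := tmul_mem_tensorFixed hl hj
  let V : Submodule O (S ⊗[O] MonoidAlgebra O G) :=
    (tmulSpan O (peirceFixed κ (⊤ : Submodule O S) ⊤ l) J).comap
      (LinearMap.mulLeft O (l ⊗ₜ[O] j) ∘ₗ LinearMap.mulRight O (l ⊗ₜ[O] j))
  have hV : ∀ k, (∀ u, act u k = k) → basisTerm τ E F e k ∈ V := fun k hk => by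
    have hfix : ∀ D : ι → S, (∀ u k, D (act u k) = κ u * D k * ((κ u)⁻¹ : Sˣ)) →
        D k ∈ fixedPts (O := O) κ ⊤ ⊤ := fun D hD => by
      refine mem_fixedPts_iff_conj.2 ⟨Submodule.mem_top, fun u _ => ?_⟩
      rw [← hD, hk]
    have hmem := hno' _ (hfix F hF)
    have hEk := hfix E hE
    change l ⊗ₜ[O] j * (basisTerm τ E F e k * l ⊗ₜ[O] j) ∈
      tmulSpan O (peirceFixed κ (⊤ : Submodule O S) ⊤ l) J
    rw [basisTerm, Algebra.TensorProduct.tmul_mul_tmul, Algebra.TensorProduct.tmul_mul_tmul,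
      hJ.right _ hmem, hJ.left _ hmem]
    refine tmul_mem_tmulSpan ⟨?_, ?_, ?_⟩ hmem
    · refine fixedPts_mul_mem ?_ hl (fixedPts_mul_mem ?_ hEk hl)
      · exact fun _ _ _ _ => Submodule.mem_top
      · exact fun _ _ _ _ => Submodule.mem_top
    · rw [← mul_assoc, hll]
    · rw [mul_assoc, mul_assoc, hll]
  have key := exists_mem_sub_mem_brauerKer (O := O) (Ω := ι) (tensorInterior (O := O) κ σ)
    (tensorGradeComp O S ω 1) act (basisTerm τ E F e)
  obtain ⟨c, hc, hcker⟩ := key (fun k => basisTerm_mem heF k)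
    (fun u k => basisTerm_act heF hEF.symm hE hF u k) (e := e) (hEF.expand_tensor e) (V := V) hV
  -- The basis elements `E_k` need not lie in `l S l`; compressing the congruence by `l ⊗ j`
  -- remedies this without changing `e`.
  have h1 := tensorBrauerKer_mul hLF (mul_tensorBrauerKer hLF hcker)
  have h2 : l ⊗ₜ[O] j * (e - c) * l ⊗ₜ[O] j = e - l ⊗ₜ[O] j * (c * l ⊗ₜ[O] j) := by
    rw [mul_sub, hle, sub_mul, hel, mul_assoc]
  rw [h2] at h1
  exact he (mem_tensorBrauerKer_of_radical hJS hJ hee heF (Submodule.mem_sup_right hc) h1)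

/-- The idempotent `j` is the trace of `(s ⊗ r) e`, for `H`-fixed elements `s` and `r`. -/
lemma exists_trace_eq {E F : ι → S} (hEF : IsTracePair τ E F) {act : H →* Equiv.Perm ι}
    (hE : ∀ u k, E (act u k) = κ u * E k * ((κ u)⁻¹ : Sˣ))
    (hF : ∀ u k, F (act u k) = κ u * F k * ((κ u)⁻¹ : Sˣ))
    {l : S} {j : MonoidAlgebra O G} {JS : Submodule O S} {J : Submodule O (MonoidAlgebra O G)}
    (hl : l ∈ fixedPts (O := O) κ ⊤ ⊤) (hll : l * l = l) (hj : j ∈ groupFixed O ω σ) (hjj : j * j = j)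
    (hJS : IsRadicalAt (fixedPts (O := O) κ ⊤ ⊤) l JS) (hJ : IsRadicalAt (groupFixed O ω σ) j J)
    {e : S ⊗[O] MonoidAlgebra O G}
    (hee : e * e = e) (heF : e ∈ tensorFixed O ω κ σ) (he : e ∉ tensorBrauerKer O ω κ σ)
    (hle : l ⊗ₜ[O] j * e = e) (hel : e * l ⊗ₜ[O] j = e) :
    ∃ s ∈ fixedPts (O := O) κ ⊤ ⊤, ∃ r ∈ groupFixed O ω σ, l * s = s ∧ s * l = s ∧ j * r = r ∧ r * j = r ∧
      tensorTrace (MonoidAlgebra O G) τ (s ⊗ₜ[O] r * e) = j := by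
  obtain ⟨s, hs, hsJ⟩ := exists_trace_notMem hEF hE hF hl hll hj hJS hJ hee heF he hle hel
  have hle1 : l ⊗ₜ[O] 1 * e = e := by
    rw [← hle, ← mul_assoc, Algebra.TensorProduct.tmul_mul_tmul, hll, one_mul]
  have hel1 : e * l ⊗ₜ[O] 1 = e := by
    rw [← hel, mul_assoc, Algebra.TensorProduct.tmul_mul_tmul, hll, mul_one]
  have hje : 1 ⊗ₜ[O] j * e = e := by
    rw [← hle, ← mul_assoc, Algebra.TensorProduct.tmul_mul_tmul, hjj, one_mul]
  have hej : e * 1 ⊗ₜ[O] j = e := by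
    rw [← hel, mul_assoc, Algebra.TensorProduct.tmul_mul_tmul, hjj, mul_one]
  set a := tensorTrace (MonoidAlgebra O G) τ (s ⊗ₜ[O] 1 * e) with ha
  have haF : a ∈ groupFixed O ω σ := by
    refine mem_fixedPts_iff_conj.2 ⟨tensorTrace_mem (tensorGradeComp_one_mul
      (tmul_mem_tensorGradeComp _ one_mem_gradeComp) heF.1), fun u _ => ?_⟩
    have h := tensorTrace_equivariant hEF.symm heF s u
    rw [(mem_fixedPts_iff_conj.1 hs).2 u trivial] at h
    rw [MonoidHom.comp_apply, groupUnits_inv_val]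
    exact h.symm
  have hja : j * a = a := by
    rw [ha, ← tensorTrace_one_tmul_mul, ← mul_assoc, Algebra.TensorProduct.tmul_mul_tmul, one_mul,
      mul_one]
    conv_rhs => rw [← hje, ← mul_assoc, Algebra.TensorProduct.tmul_mul_tmul, one_mul, mul_one]
  have haj : a * j = a := by
    rw [ha, ← tensorTrace_mul_one_tmul, mul_assoc, hej]
  -- The trace `a` is outside the radical, hence invertible in the fixed corner of `j`; its inverse
  -- `r` normalizes the trace to `j`.
  obtain ⟨r, hr, hjr, hrj, -, hra⟩ := (hJ.mem_or_inv a haF hja haj).resolve_left hsJ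
  refine ⟨l * s * l, fixedPts_mul_mem ?_ (fixedPts_mul_mem ?_ hl hs) hl, r, hr, ?_, ?_, hjr, hrj, ?_⟩
  · exact fun _ _ _ _ => Submodule.mem_top
  · exact fun _ _ _ _ => Submodule.mem_top
  · rw [← mul_assoc, ← mul_assoc, hll]
  · rw [mul_assoc, hll]
  · have h1 : (l * s * l) ⊗ₜ[O] r = 1 ⊗ₜ[O] r * (l ⊗ₜ[O] 1 * (s ⊗ₜ[O] 1 * l ⊗ₜ[O] 1)) := by
      rw [Algebra.TensorProduct.tmul_mul_tmul, Algebra.TensorProduct.tmul_mul_tmul,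
        Algebra.TensorProduct.tmul_mul_tmul, one_mul, mul_one, mul_one, mul_one, mul_assoc]
    rw [h1, mul_assoc, tensorTrace_one_tmul_mul, mul_assoc, hEF.tensorTrace_comm, mul_assoc, mul_assoc,
      hel1, hle1]
    exact hra

end DualElement
end

/-! ### The dual map into `Sᵒᵖ ⊗ B` and its left inverse -/

noncomputable section

open MulOpposite (op unop)

section DualMap

variable {O S A B ι : Type*} [CommRing O] [Ring S] [Algebra O S] [Ring A] [Algebra O A] [Ring B]
  [Algebra O B]

/-- The bilinear map `(x, y) ↦ xᵒᵖ ⊗ Ψ(y)`. -/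
def opTmul (Ψ : S →ₗ[O] B) : S →ₗ[O] S →ₗ[O] Sᵐᵒᵖ ⊗[O] B :=
  LinearMap.mk₂ O (fun x y => op x ⊗ₜ[O] Ψ y)
    (fun x x' y => by rw [MulOpposite.op_add, TensorProduct.add_tmul])
    (fun r x y => by rw [MulOpposite.op_smul, TensorProduct.smul_tmul'])
    (fun x y y' => by rw [map_add, TensorProduct.tmul_add])
    (fun r x y => by rw [map_smul, TensorProduct.tmul_smul])

/-- The linear map `y ↦ ψ (c (y ⊗ a) m)` on `S`. -/
def cornerInsert (ψ : S ⊗[O] A →ₗ[O] B) (c : S ⊗[O] A) (a : A) (m : S ⊗[O] A) : S →ₗ[O] B :=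
  ψ ∘ₗ LinearMap.mulLeft O c ∘ₗ LinearMap.mulRight O m ∘ₗ (TensorProduct.mk O S A).flip a

variable [Fintype ι] {τ : S →ₗ[O] O} {E F : ι → S} {ψ : S ⊗[O] A →ₗ[O] B} {m : S ⊗[O] A}

variable (E F ψ m) in
/-- The map `a ↦ ∑ F_kᵒᵖ ⊗ ψ((E_k ⊗ a) m)` from `A` to `Sᵒᵖ ⊗ B`. -/
def dualMap : A →ₗ[O] Sᵐᵒᵖ ⊗[O] B :=
  ∑ k, TensorProduct.mk O Sᵐᵒᵖ B (op (F k)) ∘ₗ ψ ∘ₗ LinearMap.mulRight O m ∘ₗ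
    TensorProduct.mk O S A (E k)

lemma dualMap_apply (a : A) : dualMap E F ψ m a = ∑ k, op (F k) ⊗ₜ[O] ψ (E k ⊗ₜ[O] a * m) := by
  rw [dualMap, LinearMap.sum_apply]
  rfl

/-- In the double sum, invariance moves `F_k` out of the opposite factor and into the argument of
`ψ`. There the Casimir identity collapses `∑ E_k (a m e) F_k` to `a j`; the normalization of `m` is
used exactly here. -/
lemma IsTracePair.dualMap_mul (h : IsTracePair τ E F) {e : S ⊗[O] A} {j : A}
    (hψ : ∀ c d, ψ c * ψ d = ψ (c * e * d)) (hj : tensorTrace A τ (m * e) = j) (a b : A) :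
    dualMap E F ψ m a * dualMap E F ψ m b = dualMap E F ψ m (a * j * b) := by
  have h1 : ∀ k, ∑ n, op (F k) ⊗ₜ[O] ψ (E k ⊗ₜ[O] a * m) * op (F n) ⊗ₜ[O] ψ (E n ⊗ₜ[O] b * m) =
      ∑ n, op (F n) ⊗ₜ[O] ψ (E k ⊗ₜ[O] a * m * e * ((F k * E n) ⊗ₜ[O] b * m)) := fun k => by
    refine Eq.trans ?_ (h.sum_mul_left (opTmul (cornerInsert ψ (E k ⊗ₜ[O] a * m * e) b m)) (F k))
    refine Finset.sum_congr rfl fun n _ => ?_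
    rw [Algebra.TensorProduct.tmul_mul_tmul, ← MulOpposite.op_mul, hψ]
    rfl
  have h2 : ∀ n, ∑ k, E k ⊗ₜ[O] a * m * e * ((F k * E n) ⊗ₜ[O] b * m) =
      E n ⊗ₜ[O] (a * j * b) * m := fun n => by
    have h3 := h.casimir_tensor' (1 ⊗ₜ[O] a * (m * e))
    rw [tensorTrace_one_tmul_mul, hj] at h3
    have h4 : E n ⊗ₜ[O] (a * j * b) = 1 ⊗ₜ[O] (a * j) * E n ⊗ₜ[O] b := by
      rw [Algebra.TensorProduct.tmul_mul_tmul, one_mul]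
    rw [h4, ← h3, Finset.sum_mul, Finset.sum_mul]
    refine Finset.sum_congr rfl fun k _ => ?_
    have h5 : E k ⊗ₜ[O] a = E k ⊗ₜ[O] 1 * 1 ⊗ₜ[O] a := by
      rw [Algebra.TensorProduct.tmul_mul_tmul, one_mul, mul_one]
    have h6 : (F k * E n) ⊗ₜ[O] b = F k ⊗ₜ[O] 1 * E n ⊗ₜ[O] b := by
      rw [Algebra.TensorProduct.tmul_mul_tmul, one_mul]
    rw [h5, h6]
    simp only [mul_assoc]
  rw [dualMap_apply, dualMap_apply, dualMap_apply, Finset.sum_mul_sum,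
    Finset.sum_congr rfl fun k _ => h1 k, Finset.sum_comm]
  refine Finset.sum_congr rfl fun n _ => ?_
  rw [← TensorProduct.tmul_sum, ← map_sum, h2]

/-- Invariance moves `v'` from `F_k` to `E_k`, where it meets the `v` pulled into `ψ` and cancels.
-/
lemma IsTracePair.mul_dualMap (h : IsTracePair τ E F) {v v' : S} {g : B} {g' a : A}
    (hv : v * v' = 1) (hψ : ∀ c, ψ (v ⊗ₜ[O] g' * c) = g * ψ c) :
    op v' ⊗ₜ[O] g * dualMap E F ψ m a = dualMap E F ψ m (g' * a) := by
  rw [dualMap_apply, dualMap_apply, Finset.mul_sum]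
  refine Eq.trans (Finset.sum_congr rfl fun k _ => ?_) ((h.sum_mul_left (opTmul
    (cornerInsert ψ 1 (g' * a) m ∘ₗ LinearMap.mulLeft O v)) v').trans
      (Finset.sum_congr rfl fun k _ => ?_))
  · rw [Algebra.TensorProduct.tmul_mul_tmul, ← hψ, ← mul_assoc, Algebra.TensorProduct.tmul_mul_tmul,
      ← MulOpposite.op_mul]
    change _ = op (F k * v') ⊗ₜ[O] ψ (1 * _)
    rw [one_mul]
    rfl
  · change op (F k) ⊗ₜ[O] ψ (1 * ((v * (v' * E k)) ⊗ₜ[O] (g' * a) * m)) = _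
    rw [one_mul, ← mul_assoc v, hv, one_mul]

lemma IsTracePair.dualMap_mul_tmul (h : IsTracePair τ E F) {v v' : S} {g : B} {g' a : A}
    (hv : v' * v = 1) (hψ : ∀ c, ψ (c * v ⊗ₜ[O] g') = ψ c * g)
    (hm : v ⊗ₜ[O] g' * m = m * v ⊗ₜ[O] g') :
    dualMap E F ψ m a * op v' ⊗ₜ[O] g = dualMap E F ψ m (a * g') := by
  rw [dualMap_apply, dualMap_apply, Finset.sum_mul]
  refine Eq.trans (Finset.sum_congr rfl fun k _ => ?_) ((h.sum_mul_right (opTmul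
    (cornerInsert ψ 1 (a * g') m ∘ₗ LinearMap.mulRight O v)) v').trans
      (Finset.sum_congr rfl fun k _ => ?_))
  · rw [Algebra.TensorProduct.tmul_mul_tmul, ← hψ, mul_assoc, ← hm, ← mul_assoc,
      Algebra.TensorProduct.tmul_mul_tmul, ← MulOpposite.op_mul]
    change _ = op (v' * F k) ⊗ₜ[O] ψ (1 * _)
    rw [one_mul]
    rfl
  · change op (F k) ⊗ₜ[O] ψ (1 * ((E k * v' * v) ⊗ₜ[O] (a * g') * m)) = _
    rw [one_mul, mul_assoc, hv, mul_one]

/-- With its right-hand counterpart, this places the image in the corner of `lᵒᵖ ⊗ j'`, as the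
realization theorem requires. -/
lemma IsTracePair.corner_mul_dualMap (h : IsTracePair τ E F) {l : S} {j a : A} {j' : B}
    (hψ : ∀ c, ψ (l ⊗ₜ[O] j * c) = ψ c) (hj' : ∀ c, j' * ψ c = ψ c) (hja : j * a = a) :
    op l ⊗ₜ[O] j' * dualMap E F ψ m a = dualMap E F ψ m a := by
  rw [dualMap_apply, Finset.mul_sum]
  refine Eq.trans (Finset.sum_congr rfl fun k _ => ?_) ((h.sum_mul_left (opTmul
    (cornerInsert ψ 1 a m)) l).trans (Finset.sum_congr rfl fun k _ => ?_))
  · rw [Algebra.TensorProduct.tmul_mul_tmul, hj', ← MulOpposite.op_mul]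
    change _ = op (F k * l) ⊗ₜ[O] ψ (1 * _)
    rw [one_mul]
    rfl
  · change op (F k) ⊗ₜ[O] ψ (1 * ((l * E k) ⊗ₜ[O] a * m)) = _
    conv_rhs => rw [← hψ, ← mul_assoc, Algebra.TensorProduct.tmul_mul_tmul, hja]
    rw [one_mul]

lemma IsTracePair.dualMap_mul_corner (h : IsTracePair τ E F) {l : S} {a : A} {j' : B}
    (hj' : ∀ c, ψ c * j' = ψ c) (hm : l ⊗ₜ[O] 1 * m = m) :
    dualMap E F ψ m a * op l ⊗ₜ[O] j' = dualMap E F ψ m a := by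
  rw [dualMap_apply, Finset.sum_mul]
  refine Eq.trans (Finset.sum_congr rfl fun k _ => ?_) ((h.sum_mul_right (opTmul
    (cornerInsert ψ 1 a m)) l).trans (Finset.sum_congr rfl fun k _ => ?_))
  · rw [Algebra.TensorProduct.tmul_mul_tmul, hj', ← MulOpposite.op_mul]
    change _ = op (l * F k) ⊗ₜ[O] ψ (1 * _)
    rw [one_mul]
    rfl
  · change op (F k) ⊗ₜ[O] ψ (1 * ((E k * l) ⊗ₜ[O] a * m)) = _
    conv_rhs => rw [← hm, ← mul_assoc, Algebra.TensorProduct.tmul_mul_tmul, mul_one]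
    rw [one_mul]

/-- The map `xᵒᵖ ⊗ b ↦ (τ ⊗ 1)(m T(b) (x ⊗ 1))` from `Sᵒᵖ ⊗ B` to `A`. -/
def dualTrace (τ : S →ₗ[O] O) (T : B →ₗ[O] S ⊗[O] A) (m : S ⊗[O] A) : Sᵐᵒᵖ ⊗[O] B →ₗ[O] A :=
  TensorProduct.lift (LinearMap.mk₂ O (fun x b => tensorTrace A τ (m * T b * unop x ⊗ₜ[O] 1))
    (fun x x' b => by rw [MulOpposite.unop_add, TensorProduct.add_tmul, mul_add, map_add])
    (fun r x b => by rw [MulOpposite.unop_smul, ← TensorProduct.smul_tmul', mul_smul_comm, map_smul])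
    (fun x b b' => by rw [map_add, mul_add, add_mul, map_add])
    (fun r x b => by rw [map_smul, mul_smul_comm, smul_mul_assoc, map_smul]))

lemma dualTrace_tmul (T : B →ₗ[O] S ⊗[O] A) (x : Sᵐᵒᵖ) (b : B) :
    dualTrace τ T m (x ⊗ₜ[O] b) = tensorTrace A τ (m * T b * unop x ⊗ₜ[O] 1) := rfl

/-- Cyclicity of the trace brings `F_k` and `E_k` around `m e`, and the Casimir identity replaces
this sum by the trace `j`. -/
lemma IsTracePair.dualTrace_dualMap (h : IsTracePair τ E F) {T : B →ₗ[O] S ⊗[O] A} {e : S ⊗[O] A}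
    {j : A} (hT : ∀ c, T (ψ c) = e * c * e) (hj : tensorTrace A τ (m * e) = j) (a : A) :
    dualTrace τ T m (dualMap E F ψ m a) = j * a * j := by
  have h1 : ∀ k, dualTrace τ T m (op (F k) ⊗ₜ[O] ψ (E k ⊗ₜ[O] a * m)) =
      tensorTrace A τ (F k ⊗ₜ[O] 1 * (m * e) * E k ⊗ₜ[O] 1 * (1 ⊗ₜ[O] a * (m * e))) := fun k => by
    rw [dualTrace_tmul, hT, MulOpposite.unop_op, ← h.tensorTrace_comm]
    congr 1
    have h5 : E k ⊗ₜ[O] a = E k ⊗ₜ[O] 1 * 1 ⊗ₜ[O] a := by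
      rw [Algebra.TensorProduct.tmul_mul_tmul, one_mul, mul_one]
    rw [h5]
    simp only [mul_assoc]
  rw [dualMap_apply, map_sum, Finset.sum_congr rfl fun k _ => h1 k, ← map_sum, ← Finset.sum_mul,
    h.casimir_tensor, hj, tensorTrace_one_tmul_mul, tensorTrace_one_tmul_mul, hj, mul_assoc]

/-- Equivariance, the property needed to carry Brauer kernels through the left inverse. -/
lemma dualTrace_conj (hτ : ∀ x y, τ (x * y) = τ (y * x)) {T : B →ₗ[O] S ⊗[O] A} {v v' : S} {g g' : B}
    {q q' : A} (hv : v' * v = 1) (hm : v ⊗ₜ[O] q * m = m * v ⊗ₜ[O] q)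
    (hTl : ∀ b, T (g * b) = v ⊗ₜ[O] q * T b) (hTr : ∀ b, T (b * g') = T b * v' ⊗ₜ[O] q')
    (y : Sᵐᵒᵖ ⊗[O] B) :
    dualTrace τ T m (op v' ⊗ₜ[O] g * y * op v ⊗ₜ[O] g') = q * dualTrace τ T m y * q' := by
  induction y with
  | zero => rw [mul_zero, zero_mul, map_zero, mul_zero, zero_mul]
  | add c d hc hd => rw [mul_add, add_mul, map_add, hc, hd, map_add, mul_add, add_mul]
  | tmul x b =>
    rw [Algebra.TensorProduct.tmul_mul_tmul, Algebra.TensorProduct.tmul_mul_tmul, dualTrace_tmul,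
      dualTrace_tmul, hTr, hTl, ← tensorTrace_conj hτ hv]
    congr 1
    have h1 : unop (op v' * x * op v) ⊗ₜ[O] (1 : A) = v ⊗ₜ[O] 1 * (unop x ⊗ₜ[O] 1 * v' ⊗ₜ[O] 1) := by
      rw [Algebra.TensorProduct.tmul_mul_tmul, Algebra.TensorProduct.tmul_mul_tmul, one_mul, one_mul]
      rfl
    have h2 : v' ⊗ₜ[O] q' * (v ⊗ₜ[O] 1 * (unop x ⊗ₜ[O] 1 * v' ⊗ₜ[O] 1)) =
        unop x ⊗ₜ[O] 1 * v' ⊗ₜ[O] q' := by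
      simp only [Algebra.TensorProduct.tmul_mul_tmul, one_mul, mul_one]
      rw [← mul_assoc v', hv, one_mul]
    rw [h1, ← mul_assoc m, ← mul_assoc m, ← hm]
    simp only [mul_assoc]
    rw [h2]

end DualMap
end

/-! ### The dual embedding and the realization of fusions in the reverse direction -/

noncomputable section

open MulOpposite (op unop)

section OpUnits

variable {S H : Type*} [Ring S] [Group H]

/-- The structural map `u ↦ (κ(u)⁻¹)ᵒᵖ` of the opposite of an interior algebra. -/
def opUnits (κ : H →* Sˣ) : H →* Sᵐᵒᵖˣ :=
  MonoidHom.toHomUnits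
    { toFun := fun u => op ((κ u)⁻¹ : Sˣ).val
      map_one' := by rw [map_one, inv_one, Units.val_one, MulOpposite.op_one]
      map_mul' := fun u v => by rw [map_mul, mul_inv_rev, Units.val_mul, MulOpposite.op_mul] }

lemma opUnits_val (κ : H →* Sˣ) (u : H) : (opUnits κ u).val = op ((κ u)⁻¹ : Sˣ).val := rfl

lemma opUnits_inv_val (κ : H →* Sˣ) (u : H) : ((opUnits κ u)⁻¹).val = op (κ u).val := by
  rw [← map_inv, opUnits_val, map_inv, inv_inv]

variable {O : Type*} [CommRing O] [Algebra O S]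

lemma op_mem_fixedPts_iff {κ : H →* Sˣ} {x : S} :
    op x ∈ fixedPts (O := O) (opUnits κ) ⊤ ⊤ ↔ x ∈ fixedPts (O := O) κ ⊤ ⊤ := by
  have key : ∀ u, (opUnits κ u).val * op x = op x * (opUnits κ u).val ↔
      (κ u : S) * x = x * κ u := fun u => by
    rw [opUnits_val, ← MulOpposite.op_mul, ← MulOpposite.op_mul, MulOpposite.op_inj,
      Units.mul_inv_eq_iff_eq_mul, mul_assoc, Units.eq_inv_mul_iff_mul_eq]
  exact ⟨fun h => ⟨Submodule.mem_top, fun u hu => (key u).1 (h.2 u hu)⟩,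
    fun h => ⟨Submodule.mem_top, fun u hu => (key u).2 (h.2 u hu)⟩⟩

lemma IsPrimitiveIdempotentIn.op {κ : H →* Sˣ} {l : S}
    (hl : IsPrimitiveIdempotentIn (fixedPts (O := O) κ ⊤ ⊤) l) :
    IsPrimitiveIdempotentIn (fixedPts (O := O) (opUnits κ) ⊤ ⊤) (op l) := by
  obtain ⟨h1, h2, h3, h4⟩ := hl
  refine ⟨op_mem_fixedPts_iff.2 h1, by rw [← MulOpposite.op_mul, h2], by simpa using h3, ?_⟩
  intro e he hee hle hel
  obtain ⟨e, rfl⟩ := MulOpposite.op_surjective e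
  rw [← MulOpposite.op_mul, MulOpposite.op_inj] at hee hle hel
  rw [MulOpposite.op_eq_zero_iff, MulOpposite.op_inj]
  exact h4 e (op_mem_fixedPts_iff.1 he) hee hel hle

end OpUnits

section Dual

variable {O S G G' Γ H ι : Type*} [CommRing O] [Ring S] [Algebra O S] [Group G] [Group G']
  [Group Γ] [Group H] [Fintype ι] {ω : G →* Γ} {ω' : G' →* Γ} {κ : H →* Sˣ} {σ : H →* G}
  {σ' : H →* G'} {τ : S →ₗ[O] O} {E F : ι → S} {j : MonoidAlgebra O G} {j' : MonoidAlgebra O G'}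
  {e : S ⊗[O] MonoidAlgebra O G'} {T : MonoidAlgebra O G →ₗ[O] S ⊗[O] MonoidAlgebra O G'}
  {ψ : S ⊗[O] MonoidAlgebra O G' →ₗ[O] MonoidAlgebra O G}

lemma dualMap_mem {m : S ⊗[O] MonoidAlgebra O G'} (hm : m ∈ tensorGradeComp O S ω' 1)
    (hψ : ∀ x, ∀ c ∈ tensorGradeComp O S ω' x, ψ c ∈ gradeComp O ω x) {x : Γ}
    {a : MonoidAlgebra O G'} (ha : a ∈ gradeComp O ω' x) :
    dualMap E F ψ m a ∈ tensorGradeComp O Sᵐᵒᵖ ω x := by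
  rw [dualMap_apply]
  refine Submodule.sum_mem _ fun k _ => tmul_mem_tensorGradeComp _ (hψ x _ ?_)
  have h := tensorGradeComp_mul (tmul_mem_tensorGradeComp (E k) ha) hm
  rwa [mul_one] at h

lemma dualTrace_mem {m : S ⊗[O] MonoidAlgebra O G'} (hm : m ∈ tensorGradeComp O S ω' 1)
    (hT : ∀ b ∈ gradeComp O ω 1, T b ∈ tensorGradeComp O S ω' 1) {y : Sᵐᵒᵖ ⊗[O] MonoidAlgebra O G}
    (hy : y ∈ tensorGradeComp O Sᵐᵒᵖ ω 1) : dualTrace τ T m y ∈ gradeComp O ω' 1 := by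
  refine tensorGradeComp_le (V := (gradeComp O ω' 1).comap (dualTrace τ T m)) (fun x b hb => ?_) hy
  rw [Submodule.mem_comap, dualTrace_tmul]
  exact tensorTrace_mem (tensorGradeComp_one_mul (tensorGradeComp_one_mul hm (hT b hb))
    (tmul_mem_tensorGradeComp _ one_mem_gradeComp))

/-- Data that define the dual embedding: an equivalence of corners, and a fixed element `m` such that
`(τ ⊗ 1)(m e) = j'`. -/
structure IsDualSetup (ω : G →* Γ) (ω' : G' →* Γ) (κ : H →* Sˣ) (σ : H →* G) (σ' : H →* G')
    (τ : S →ₗ[O] O) (E F : ι → S) (l : S) (j : MonoidAlgebra O G) (j' : MonoidAlgebra O G')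
    (e : S ⊗[O] MonoidAlgebra O G') (T : MonoidAlgebra O G →ₗ[O] S ⊗[O] MonoidAlgebra O G')
    (ψ : S ⊗[O] MonoidAlgebra O G' →ₗ[O] MonoidAlgebra O G) (m : S ⊗[O] MonoidAlgebra O G') :
    Prop where
  pair : IsTracePair τ E F
  equiv : IsCornerEquiv ((groupUnits O G).comp σ) (gradeComp O ω) (tensorInterior (O := O) κ σ')
    (tensorGradeComp O S ω') j e T ψ
  fixed : j ∈ groupFixed O ω σ
  fixed' : j' ∈ groupFixed O ω' σ'
  idem' : j' * j' = j'
  below : l ⊗ₜ[O] j' * e = e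
  mem : m ∈ tensorFixed O ω' κ σ'
  mul_mem : l ⊗ₜ[O] 1 * m = m
  trace : tensorTrace (MonoidAlgebra O G') τ (m * e) = j'

namespace IsDualSetup

variable {l : S} {m : S ⊗[O] MonoidAlgebra O G'}

lemma below' (h : IsDualSetup ω ω' κ σ σ' τ E F l j j' e T ψ m) (hel : e * l ⊗ₜ[O] j' = e)
    (c : S ⊗[O] MonoidAlgebra O G') : ψ (l ⊗ₜ[O] j' * c) = ψ c := by
  rw [← h.equiv.inv_corner_left, ← mul_assoc, hel, h.equiv.inv_corner_left]

lemma interior_left (h : IsDualSetup ω ω' κ σ σ' τ E F l j j' e T ψ m) (u : H)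
    (a : MonoidAlgebra O G') :
    (tensorInterior (O := O) (opUnits κ) σ u).val * dualMap E F ψ m a =
      dualMap E F ψ m (MonoidAlgebra.of O G' (σ' u) * a) :=
  h.pair.mul_dualMap (Units.mul_inv _)
    (fun c => h.equiv.inv_interior_left (fun u => groupFixed_comm h.fixed u) u c)

lemma interior_right (h : IsDualSetup ω ω' κ σ σ' τ E F l j j' e T ψ m) (u : H)
    (a : MonoidAlgebra O G') :
    dualMap E F ψ m a * (tensorInterior (O := O) (opUnits κ) σ u).val =
      dualMap E F ψ m (a * MonoidAlgebra.of O G' (σ' u)) :=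
  h.pair.dualMap_mul_tmul (Units.inv_mul _)
    (fun c => h.equiv.inv_interior_right (fun u => groupFixed_comm h.fixed u) u c)
    (tensorInterior_conj_fixed h.mem u)

lemma map_mul (h : IsDualSetup ω ω' κ σ σ' τ E F l j j' e T ψ m) (a b : MonoidAlgebra O G') :
    dualMap E F ψ m a * dualMap E F ψ m b = dualMap E F ψ m (a * j' * b) :=
  h.pair.dualMap_mul h.equiv.inv_mul h.trace a b

lemma mem_tensorFixed (h : IsDualSetup ω ω' κ σ σ' τ E F l j j' e T ψ m) :
    dualMap E F ψ m j' ∈ tensorFixed O ω (opUnits κ) σ := by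
  refine ⟨dualMap_mem h.mem.1 h.equiv.inv_graded h.fixed'.1, fun u _ => ?_⟩
  rw [h.interior_left, h.interior_right, groupFixed_comm h.fixed']

lemma isTwistedUnit (h : IsDualSetup ω ω' κ σ σ' τ E F l j j' e T ψ m) {φ : MulAut H} {x : Γ}
    {a a' : MonoidAlgebra O G'}
    (ha : IsTwistedUnit ((groupUnits O G').comp σ') (gradeComp O ω') j' φ x a a') :
    IsTwistedUnit (tensorInterior (O := O) (opUnits κ) σ) (tensorGradeComp O Sᵐᵒᵖ ω)
      (dualMap E F ψ m j') φ x (dualMap E F ψ m a) (dualMap E F ψ m a') where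
  mem := dualMap_mem h.mem.1 h.equiv.inv_graded ha.mem
  mem' := dualMap_mem h.mem.1 h.equiv.inv_graded ha.mem'
  left := by rw [h.map_mul, h.idem', ha.left]
  right := by rw [h.map_mul, mul_assoc, h.idem', ha.right]
  left' := by rw [h.map_mul, h.idem', ha.left']
  right' := by rw [h.map_mul, mul_assoc, h.idem', ha.right']
  mul_eq := by rw [h.map_mul, ha.right, ha.mul_eq]
  mul_eq' := by rw [h.map_mul, ha.right', ha.mul_eq']
  twist u := by
    have h1 : MonoidAlgebra.of O G' (σ' (φ u)) * a = a * MonoidAlgebra.of O G' (σ' u) := ha.twist u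
    rw [h.interior_left, h.interior_right, h1]

/-- The equivariant left inverse sends the image of `j'` to `j'`, so membership in the kernel would
contradict the locality of `j'`. -/
lemma notMem_tensorBrauerKer [IsLocalRing O] [Finite H]
    (h : IsDualSetup ω ω' κ σ σ' τ E F l j j' e T ψ m)
    (hloc : j' ∉ brauerKer ((groupUnits O G').comp σ') (gradeComp O ω' 1) ⊤) :
    dualMap E F ψ m j' ∉ tensorBrauerKer O ω (opUnits κ) σ := by
  intro hker
  refine hloc ?_
  have h1 := h.pair.dualTrace_dualMap h.equiv.map_inv h.trace j'
  rw [h.idem', h.idem'] at h1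
  rw [← h1]
  have h2 : ∀ (u : H), ∀ y ∈ tensorGradeComp O Sᵐᵒᵖ ω 1,
      (tensorInterior (O := O) (opUnits κ) σ u).val * y *
        ((tensorInterior (O := O) (opUnits κ) σ u)⁻¹).val ∈ tensorGradeComp O Sᵐᵒᵖ ω 1 :=
    fun u y hy => conj_mem_tensorGradeComp_one (O := O) (opUnits κ) σ u hy
  have h3 : ∀ y ∈ tensorGradeComp O Sᵐᵒᵖ ω 1, dualTrace τ T m y ∈ gradeComp O ω' 1 :=
    fun y hy => dualTrace_mem h.mem.1 (h.equiv.graded 1) hy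
  refine brauerKer_top_map (θ := tensorInterior (O := O) (opUnits κ) σ)
    (B₁ := tensorGradeComp O Sᵐᵒᵖ ω 1) (θ' := (groupUnits O G').comp σ') (C₁ := gradeComp O ω' 1)
    (dualTrace τ T m) h2 h3 (fun u y => ?_) hker
  rw [tensorInterior_val, tensorInterior_inv_val, opUnits_val, opUnits_inv_val,
    MonoidHom.comp_apply, groupUnits_val, groupUnits_inv_val]
  refine dualTrace_conj h.pair.symm (Units.inv_mul _) (tensorInterior_conj_fixed h.mem u)
    (fun b => h.equiv.interior_left u b) (fun b => ?_) y
  have h4 := h.equiv.interior_right u⁻¹ b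
  rw [MonoidHom.comp_apply, map_inv, groupUnits_val] at h4
  rw [h4, map_inv, tensorInterior_inv_val]

variable [IsLocalRing O] [IsNoetherianRing O] [IsAdicComplete (IsLocalRing.maximalIdeal O) O]
  [Module.Finite O S] [Finite G] [Finite H]

/-- A twisted unit at the point of `j'` is realized by an element of `G` at the point of `j`. -/
lemma exists_conj (h : IsDualSetup ω ω' κ σ σ' τ E F l j j' e T ψ m)
    (hl : IsPrimitiveIdempotentIn (fixedPts (O := O) κ ⊤ ⊤) l)
    (hj : IsPrimitiveIdempotentIn (groupFixed O ω σ) j) (hel : e * l ⊗ₜ[O] j' = e)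
    (hloc : j' ∉ brauerKer ((groupUnits O G').comp σ') (gradeComp O ω' 1) ⊤)
    {φ : MulAut H} {x : Γ} {a a' : MonoidAlgebra O G'}
    (ha : IsTwistedUnit ((groupUnits O G').comp σ') (gradeComp O ω') j' φ x a a') :
    ∃ g : G, ω g = x ∧ (∀ u, σ (φ u) * g = g * σ u) ∧
      FixedConj ((groupUnits O G).comp σ) (gradeComp O ω 1) ⊤ j
        (MonoidAlgebra.of O G g * j * MonoidAlgebra.of O G g⁻¹) := by
  have hfin : Module.Finite O Sᵐᵒᵖ := Module.Finite.equiv (MulOpposite.opLinearEquiv O)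
  have h1 := h.map_mul j' j'
  rw [h.idem', h.idem'] at h1
  have h2 := h.pair.corner_mul_dualMap (m := m) (h.below' hel) h.equiv.inv_left h.idem'
  have h3 := h.pair.dualMap_mul_corner (m := m) (a := j') h.equiv.inv_right h.mul_mem
  obtain ⟨g, hg, hgσ, hconj, -⟩ := exists_realization_of_isTwistedUnit hl.op hj h1 h.mem_tensorFixed
    (h.notMem_tensorBrauerKer hloc) h2 h3 (h.isTwistedUnit ha)
  exact ⟨g, hg, hgσ, hconj⟩

end IsDualSetup

end Dual
end

/-! ### Higman's criterion and Dade algebras -/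

noncomputable section

section ProjectiveModules

variable {O N V : Type*} [CommRing O] [Group N] [AddCommGroup V] [Module O V]

lemma Module.Projective.of_asModule (τ : Representation O N V)
    (h : Module.Projective (MonoidAlgebra O N) τ.asModule) : Module.Projective O V := by
  obtain ⟨s, hs⟩ := h.out
  have : Module.Free O (MonoidAlgebra O N) := Module.Free.of_basis (MonoidAlgebra.basis N O)
  have h1 : Module.Projective O τ.asModule := by
    refine Module.Projective.of_split (M := τ.asModule →₀ MonoidAlgebra O N) (s.restrictScalars O)
      ((Finsupp.linearCombination (MonoidAlgebra O N) id).restrictScalars O) ?_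
    exact LinearMap.ext hs
  exact Module.Projective.of_equiv τ.asModuleEquiv

/-- Higman's criterion, for the identity of a projective module. -/
lemma exists_sum_conj_eq_one [Fintype N] (τ : Representation O N V)
    (h : Module.Projective (MonoidAlgebra O N) τ.asModule) :
    ∃ t : Module.End O V, ∑ n, τ n * t * τ n⁻¹ = 1 := by
  obtain ⟨s, hs⟩ := h.out
  -- The coefficient at the identity of `N` is a projection whose conjugates by `N` add up to the
  -- canonical surjection from the free module; the splitting `s` then gives `t`.
  let c : (τ.asModule →₀ MonoidAlgebra O N) →ₗ[O] τ.asModule :=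
    Finsupp.lsum O fun v => LinearMap.toSpanSingleton O τ.asModule v ∘ₗ
      (Finsupp.lapply 1 ∘ₗ (MonoidAlgebra.coeffLinearEquiv O).toLinearMap)
  have hc : ∀ v a, c (Finsupp.single v a) = a.coeff 1 • v := fun v a => by
    simp only [c, Finsupp.lsum_single, LinearMap.comp_apply, LinearMap.toSpanSingleton_apply]
    rfl
  have key : ∀ f : τ.asModule →₀ MonoidAlgebra O N,
      ∑ n, MonoidAlgebra.of O N n • c (MonoidAlgebra.of O N n⁻¹ • f) =
        Finsupp.linearCombination (MonoidAlgebra O N) id f := fun f => by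
    induction f using Finsupp.induction_linear with
    | zero => simp
    | add f g hf hg => simp only [smul_add, map_add, Finset.sum_add_distrib, hf, hg]
    | single v a =>
      have h1 : ∀ n, c (MonoidAlgebra.of O N n⁻¹ • Finsupp.single v a) = a.coeff n • v := fun n => by
        rw [Finsupp.smul_single, hc, smul_eq_mul, MonoidAlgebra.of_apply,
          MonoidAlgebra.coeff_single_mul_apply, inv_inv, mul_one, one_mul]
      rw [Finset.sum_congr rfl fun n _ => by rw [h1], Finsupp.linearCombination_single, id]
      conv_rhs => rw [← sum_coeff_smul_of a, Finset.sum_smul]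
      exact Finset.sum_congr rfl fun n _ => by rw [smul_comm, smul_assoc]
  let t : Module.End O V :=
    τ.asModuleEquiv.toLinearMap ∘ₗ c ∘ₗ s.restrictScalars O ∘ₗ τ.asModuleEquiv.symm.toLinearMap
  refine ⟨t, LinearMap.ext fun v => ?_⟩
  have h2 := (key (s (τ.asModuleEquiv.symm v))).trans (hs _)
  have h3 := congrArg τ.asModuleEquiv h2
  rw [map_sum, LinearEquiv.apply_symm_apply] at h3
  rw [LinearMap.sum_apply, Module.End.one_apply]
  refine Eq.trans (Finset.sum_congr rfl fun n _ => ?_) h3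
  rw [Representation.asModuleEquiv_map_smul, Representation.asAlgebraHom_of, ← map_smul,
    ← Representation.asModuleEquiv_symm_map_rho]
  rfl

/-- A projective module is relatively trivially projective over every group that embeds in `N`. -/
lemma exists_sum_comp_conj_eq_one [Finite N] (τ : Representation O N V)
    (h : Module.Projective (MonoidAlgebra O N) τ.asModule) {Y : Type*} [Group Y] [Fintype Y] (ι : Y →* N)
    (hι : Function.Injective ι) : ∃ t : Module.End O V, ∑ y, τ (ι y) * t * τ (ι y⁻¹) = 1 := by
  classical
  have := Fintype.ofFinite N
  obtain ⟨t, ht⟩ := exists_sum_conj_eq_one τ h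
  -- The trace over `N` is the trace over the image of `Y` of a partial trace over a transversal.
  obtain ⟨T, hT, -⟩ := ι.range.exists_isComplement_right 1
  have := Fintype.ofFinite T
  refine ⟨∑ x : T, τ x * t * τ (x : N)⁻¹, ?_⟩
  rw [← ht]
  let E : Y × T ≃ N := ((MonoidHom.ofInjective hι).toEquiv.prodCongr (Equiv.refl T)).trans hT.equiv.symm
  have hE : ∀ q, E q = ι q.1 * q.2 := fun q => rfl
  rw [← E.sum_comp, Fintype.sum_prod_type]
  refine Finset.sum_congr rfl fun y _ => ?_
  rw [Finset.mul_sum, Finset.sum_mul]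
  refine Finset.sum_congr rfl fun x _ => ?_
  rw [hE, mul_inv_rev, map_mul, map_mul, map_inv ι]
  simp only [mul_assoc]

end ProjectiveModules

section DadeAlgebras

variable {O B P : Type*} [CommRing O] [IsLocalRing O] [Ring B] [Algebra O B] [Group P]
  {θ : P →* Bˣ}

lemma IsDadeAlgebra.exists_basis [Module.Finite O B] (h : IsDadeAlgebra (O := O) θ) :
    ∃ (X : Set B) (_ : Fintype X) (E : Module.Basis X O B) (act : P →* Equiv.Perm X),
      ∀ u k, E (act u k) = θ u * E k * ((θ u)⁻¹ : Bˣ) := by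
  obtain ⟨⟨X, hli, hspan, hX⟩, -⟩ := h
  let E : Module.Basis X O B := Module.Basis.mk hli (by rw [Subtype.range_coe, hspan])
  have := Module.Finite.finite_basis E
  let _ : MulAction P X :=
    { smul := fun u x => ⟨_, hX u x x.2⟩
      one_smul := fun x => Subtype.ext (by
        change ((θ 1 : Bˣ) : B) * x * ((θ 1)⁻¹ : Bˣ) = x
        simp)
      mul_smul := fun u v x => Subtype.ext (by
        change ((θ (u * v) : Bˣ) : B) * x * ((θ (u * v))⁻¹ : Bˣ) =
          θ u * (θ v * x * ((θ v)⁻¹ : Bˣ)) * ((θ u)⁻¹ : Bˣ)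
        simp [mul_assoc]) }
  refine ⟨X, Fintype.ofFinite X, E, MulAction.toPermHom P X, fun u k => ?_⟩
  rw [Module.Basis.mk_apply, Module.Basis.mk_apply]
  rfl

/-- A Sylow `p`-subgroup has index invertible in `O`; if it were proper, the identity would be the
relative trace of the inverse of this index. -/
lemma isPGroup_of_one_notMem_brauerKer [Finite P] (p : ℕ) [Fact p.Prime] [CharP (IsLocalRing.ResidueField O) p]
    (h : (1 : B) ∉ brauerKer (O := O) θ ⊤ ⊤) : IsPGroup p P := by
  let R : Sylow p P := default
  by_cases hR : (R : Subgroup P) = ⊤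
  · have := R.isPGroup'
    rw [hR] at this
    exact this.of_equiv Subgroup.topEquiv
  exfalso
  have hu : IsUnit ((R : Subgroup P).index : O) := by
    rw [← IsLocalRing.residue_ne_zero_iff_isUnit, map_natCast, Ne,
      CharP.cast_eq_zero_iff (IsLocalRing.ResidueField O) p]
    exact R.not_dvd_index
  obtain ⟨c, hc⟩ := hu
  have h1 : ((c⁻¹ : Oˣ) : O) • (1 : B) ∈ fixedPts (O := O) θ ⊤ (R : Subgroup P) :=
    ⟨trivial, fun u _ => by rw [mul_smul_comm, smul_mul_assoc, mul_one, one_mul]⟩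
  refine h ?_
  convert relTrace_mem_brauerKer (lt_top_iff_ne_top.2 hR) h1 using 1
  have h2 : ∀ u : P, (θ u : B) * (((c⁻¹ : Oˣ) : O) • (1 : B)) * ((θ u)⁻¹ : Bˣ) =
      ((c⁻¹ : Oˣ) : O) • (1 : B) := fun u => by
    rw [mul_smul_comm, smul_mul_assoc, mul_one, Units.mul_inv]
  have := Fintype.ofFinite ((⊤ : Subgroup P) ⧸ (R : Subgroup P).subgroupOf ⊤)
  rw [relTrace, finsum_congr fun q => h2 _, finsum_eq_sum_of_fintype, Finset.sum_const, Finset.card_univ,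
    ← Nat.card_eq_fintype_card]
  have h3 : Nat.card ((⊤ : Subgroup P) ⧸ (R : Subgroup P).subgroupOf ⊤) = (R : Subgroup P).index :=
    (R : Subgroup P).relIndex_top_right
  rw [h3, ← Nat.cast_smul_eq_nsmul O, smul_smul, ← hc, Units.mul_inv, one_smul]

/-- If the identity of a Dade algebra is a relative trace from the trivial subgroup of `Y`, then `Y`
has order prime to the residue characteristic. -/
lemma IsDadeAlgebra.card_notMem [Module.Finite O B] (h : IsDadeAlgebra (O := O) θ) (Y : Subgroup P)
    [Fintype Y] {t : B} (ht : ∑ y : Y, (θ y : B) * t * ((θ y)⁻¹ : Bˣ) = 1) :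
    (Fintype.card Y : O) ∉ IsLocalRing.maximalIdeal O := by
  intro hY
  obtain ⟨X, _, E, act, hE⟩ := h.exists_basis
  have hcoord : ∀ u a k, E.repr (θ u * a * ((θ u)⁻¹ : Bˣ)) (act u k) = E.repr a k := fun u a k => by
    classical
    have key : E.coord (act u k) ∘ₗ (LinearMap.mulLeft O (θ u : B) ∘ₗ
        LinearMap.mulRight O ((θ u)⁻¹ : Bˣ).val) = E.coord k := by
      refine E.ext fun m => ?_
      rw [LinearMap.comp_apply, LinearMap.comp_apply, LinearMap.mulLeft_apply,
        LinearMap.mulRight_apply, ← mul_assoc, ← hE]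
      simp [Finsupp.single_apply]
    have := LinearMap.congr_fun key a
    rw [LinearMap.comp_apply, LinearMap.comp_apply, LinearMap.mulLeft_apply,
      LinearMap.mulRight_apply, ← mul_assoc] at this
    exact this
  -- At a basis element fixed by `P`, the coordinate of the identity is `|Y|` times that of `t`. If
  -- `|Y|` is in the maximal ideal, all surviving terms are in the Brauer kernel, and with them the
  -- identity.
  obtain ⟨c, hc, hker⟩ := exists_mem_sub_mem_brauerKer (O := O) θ ⊤ act
    (fun k => E.repr 1 k • E k) (fun _ => trivial) (fun u k => by
      have := hcoord u 1 k
      rw [mul_one, Units.mul_inv] at this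
      rw [this, hE, mul_smul_comm, smul_mul_assoc]) (E.sum_repr 1)
    (V := IsLocalRing.maximalIdeal O • fixedPts θ ⊤ ⊤) (fun k hk => by
      have h1 : E.repr 1 k = Fintype.card Y * E.repr t k := by
        have h2 : ∀ y : Y, E.repr (θ y * t * ((θ y)⁻¹ : Bˣ)) k = E.repr t k := fun y => by
          have := hcoord y t k
          rwa [hk] at this
        rw [← ht, map_sum, Finset.sum_apply', Finset.sum_congr rfl fun y _ => h2 y, Finset.sum_const,
          Finset.card_univ, nsmul_eq_mul]
      refine Submodule.smul_mem_smul (h1 ▸ Ideal.mul_mem_right _ _ hY)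
        (mem_fixedPts_iff_conj.2 ⟨trivial, fun u _ => ?_⟩)
      rw [← hE, hk])
  refine h.2 ?_
  rw [← sub_add_cancel 1 c]
  exact add_mem hker (smul_fixedPts_le_brauerKer _ _ _ hc)

end DadeAlgebras
end

/-! ### Injectivity of the two projections of the vertex -/

noncomputable section

section Source

variable {O : Type*} [CommRing O]

/-- A subgroup over which the source of a Dade algebra is relatively trivially projective is trivial. -/
lemma IsDadeAlgebra.eq_bot_of_sum_conj {B P : Type*} [IsLocalRing O] [Ring B] [Algebra O B] [Module.Finite O B] [Group P]
    [Finite P] {θ : P →* Bˣ} (p : ℕ) [Fact p.Prime] [CharP (IsLocalRing.ResidueField O) p]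
    (h : IsDadeAlgebra (O := O) θ) (Y : Subgroup P) [Fintype Y] {t : B}
    (ht : ∑ y : Y, (θ y : B) * t * ((θ y)⁻¹ : Bˣ) = 1) : Y = ⊥ := by
  have hP := (isPGroup_of_one_notMem_brauerKer p h.2).to_subgroup Y
  have hY := h.card_notMem Y ht
  rcases hP.card_eq_or_dvd with h1 | h1
  · exact Subgroup.card_eq_one.1 h1
  · refine absurd ?_ hY
    rw [← IsLocalRing.residue_eq_zero_iff, map_natCast,
      CharP.cast_eq_zero_iff (IsLocalRing.ResidueField O) p, ← Nat.card_eq_fintype_card]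
    exact h1

variable {G G' Γ : Type*} [Group G] [Group G'] [Group Γ] {ω : G →* Γ}
  {ω' : G' →* Γ} {b : MonoidAlgebra O ω.ker} {b' : MonoidAlgebra O ω'.ker} {M W : Type*}
  [AddCommGroup M] [Module O M] [AddCommGroup W] [Module O W]
  {ρ : Representation O (diagGroup ω ω') M} {P : Subgroup (diagGroup ω ω')} {κ : Representation O P W}

lemma IsDiagonalModule.finite_source (hM : IsDiagonalModule b b' ρ) (hP : IsVertexSource ρ P κ) :
    Module.Finite O W := by
  obtain ⟨s, r, -, -, hrs⟩ := hP.source_summand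
  have := hM.finite
  exact Module.Finite.of_surjective r fun v => ⟨s v, LinearMap.congr_fun hrs v⟩

/-- `M` is projective over `O` because `O N` is free over `O`, and the source is a direct summand of
`M`; over a local ring it is then free. -/
lemma IsDiagonalModule.free_source [IsLocalRing O] (hM : IsDiagonalModule b b' ρ) (hP : IsVertexSource ρ P κ) :
    Module.Free O W := by
  have := hM.finite_source hP
  have := Module.Projective.of_asModule _ hM.projective_left
  obtain ⟨s, r, -, -, hrs⟩ := hP.source_summand
  have := Module.Projective.of_split s r hrs
  exact Module.free_of_flat_of_isLocalRing

/-- Higman's relation on `M` is cut down to its direct summand, the source, by the equivariant maps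
`s` and `r`. -/
lemma IsVertexSource.exists_sum_conj_eq_one {N : Type*} [Group N] [Finite N] (hP : IsVertexSource ρ P κ)
    (i : N →* diagGroup ω ω')
    (hproj : Module.Projective (MonoidAlgebra O N) (Representation.asModule (ρ.comp i)))
    (Y : Subgroup P) [Fintype Y] (ι : Y →* N) (hι : ∀ y : Y, i (ι y) = (y : P)) :
    ∃ t : Module.End O W,
      ∑ y : Y, (κ.toHomUnits y : Module.End O W) * t * ((κ.toHomUnits y)⁻¹ : (Module.End O W)ˣ) = 1 := by
  obtain ⟨s, r, hs, hr, hrs⟩ := hP.source_summand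
  obtain ⟨t, ht⟩ := exists_sum_comp_conj_eq_one (ρ.comp i) hproj ι (fun y z h =>
    Subtype.ext (Subtype.ext (by rw [← hι, ← hι, h])))
  refine ⟨r ∘ₗ t ∘ₗ s, ?_⟩
  have h1 : ∀ y : Y, (κ.toHomUnits y : Module.End O W) * (r ∘ₗ t ∘ₗ s) *
      ((κ.toHomUnits y)⁻¹ : (Module.End O W)ˣ) =
        r ∘ₗ (ρ.comp i (ι y) * t * ρ.comp i (ι y⁻¹)) ∘ₗ s := fun y => by
    rw [← map_inv]
    change κ y ∘ₗ (r ∘ₗ t ∘ₗ s) ∘ₗ κ (y : P)⁻¹ =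
      r ∘ₗ (ρ (i (ι y)) ∘ₗ t ∘ₗ ρ (i (ι y⁻¹))) ∘ₗ s
    have h2 : κ y ∘ₗ r = r ∘ₗ ρ ((y : P) : diagGroup ω ω') := (hr y).symm
    have h3 : s ∘ₗ κ (y : P)⁻¹ = ρ (((y : P)⁻¹ : P) : diagGroup ω ω') ∘ₗ s := hs (y : P)⁻¹
    rw [hι, hι, LinearMap.comp_assoc, LinearMap.comp_assoc, h3, ← LinearMap.comp_assoc, h2]
    simp only [LinearMap.comp_assoc]
    rfl
  rw [Finset.sum_congr rfl fun y _ => h1 y]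
  refine LinearMap.ext fun v => ?_
  rw [LinearMap.sum_apply]
  simp only [LinearMap.comp_apply]
  rw [← map_sum, ← LinearMap.sum_apply, ht, Module.End.one_apply]
  exact LinearMap.congr_fun hrs v

variable [IsLocalRing O] [Finite G] [Finite G']

/-- An element of the kernel has the form `(1, n')` with `n' ∈ N'`, and `M` is projective over `1 ×
N'`. So the identity of `S` is a trace from the trivial subgroup of the kernel, which is therefore
trivial. -/
lemma IsBasicGradedMorita.sigmaL_injective (p : ℕ) [Fact p.Prime]
    [CharP (IsLocalRing.ResidueField O) p] (hM : IsDiagonalModule b b' ρ) (hP : IsVertexSource ρ P κ)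
    (h : IsBasicGradedMorita b b' ρ P κ) : Function.Injective (sigmaL P) := by
  have := hM.finite_source hP
  have := hM.free_source hP
  have := Fintype.ofFinite (sigmaL P).ker
  let ι : (sigmaL P).ker →* ω'.ker := ((sigmaR P).comp (sigmaL P).ker.subtype).codRestrict _ fun y => by
    have h1 : ω (sigmaL P y) = ω' (sigmaR P y) := (y : P).1.2
    have h2 : sigmaL P y = 1 := y.2
    rw [h2, map_one] at h1
    exact h1.symm
  obtain ⟨t, ht⟩ := hP.exists_sum_conj_eq_one (diagInr ω ω') hM.projective_right (sigmaL P).ker ι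
    (fun y => Subtype.ext (Prod.ext (y.2 : sigmaL P y = 1).symm rfl))
  exact (MonoidHom.ker_eq_bot_iff _).1 (h.dade.eq_bot_of_sum_conj p _ ht)

lemma IsBasicGradedMorita.sigmaR_injective (p : ℕ) [Fact p.Prime]
    [CharP (IsLocalRing.ResidueField O) p] (hM : IsDiagonalModule b b' ρ) (hP : IsVertexSource ρ P κ)
    (h : IsBasicGradedMorita b b' ρ P κ) : Function.Injective (sigmaR P) := by
  have := hM.finite_source hP
  have := hM.free_source hP
  have := Fintype.ofFinite (sigmaR P).ker
  let ι : (sigmaR P).ker →* ω.ker := ((sigmaL P).comp (sigmaR P).ker.subtype).codRestrict _ fun y => by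
    have h1 : ω (sigmaL P y) = ω' (sigmaR P y) := (y : P).1.2
    have h2 : sigmaR P y = 1 := y.2
    rw [h2, map_one] at h1
    exact h1
  obtain ⟨t, ht⟩ := hP.exists_sum_conj_eq_one (diagInl ω ω') hM.projective_left (sigmaR P).ker ι
    (fun y => Subtype.ext (Prod.ext rfl (y.2 : sigmaR P y = 1).symm))
  exact (MonoidHom.ker_eq_bot_iff _).1 (h.dade.eq_bot_of_sum_conj p _ ht)

end Source
end

/-! ### Transport of fusions between the two sides -/

noncomputable section

section Transport

variable {O G Γ H : Type*} [CommRing O] [Group G] [Group Γ] [Group H]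
  {ω : G →* Γ} {Q : Subgroup G} {δ : Set (MonoidAlgebra O G)} {i j j₀ : MonoidAlgebra O G} {σ : H →* G}

variable {G' S ι ι' : Type*} [Group G'] [Ring S] [Algebra O S] {ω' : G' →* Γ} {κ : H →* Sˣ} {σ' : H →* G'}
  {l : S} {j' : MonoidAlgebra O G'} {e : S ⊗[O] MonoidAlgebra O G'}
  {T : MonoidAlgebra O G →ₗ[O] S ⊗[O] MonoidAlgebra O G'}
  {ψ : S ⊗[O] MonoidAlgebra O G' →ₗ[O] MonoidAlgebra O G} {φ : MulAut H} {x : Γ}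

lemma IsCornerEquiv.mem_tensorFixed
    (h : IsCornerEquiv ((groupUnits O G).comp σ) (gradeComp O ω) (tensorInterior (O := O) κ σ')
      (tensorGradeComp O S ω') j e T ψ) (hj : j ∈ groupFixed O ω σ) :
    e ∈ tensorFixed O ω' κ σ' := by
  refine ⟨?_, fun u _ => h.comm (fun u => groupFixed_comm hj u) u⟩
  rw [← h.map_self]
  exact h.graded 1 j hj.1

lemma range_eq_of_mulEquiv (s : H ≃* Q) (hs : ∀ u, (s u : G) = σ u) : σ.range = Q := by
  ext g
  refine ⟨?_, fun hg => ⟨s.symm ⟨g, hg⟩, by rw [← hs, MulEquiv.apply_symm_apply]⟩⟩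
  rintro ⟨u, rfl⟩
  rw [← hs]
  exact (s u).2

variable [IsLocalRing O]

/-- Expresses the fusions of `Q` through the abstract group `H`, so that the two sides can be
compared for the same automorphism. -/
lemma mem_gradedFusionGroup_congr_iff
    (hδ : IsLocalPoint (groupUnits O G) (gradeComp O ω 1) Q δ) (hj : j ∈ δ) (hj₀δ : j₀ ∈ δ)
    (hj₀ : j₀ ∈ corner O i) (s : H ≃* Q) (hs : ∀ u, (s u : G) = σ u) {φ : MulAut H} {x : Γ} :
    (MulAut.congr s φ, x) ∈
        gradedFusionGroup ω (groupUnits O G) (gradeComp O ω) Q i j (hδ.1.commute hj) ↔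
      (∀ u, ω (σ (φ u)) = ω (σ u)) ∧
        ∃ a a', IsTwistedUnit ((groupUnits O G).comp σ) (gradeComp O ω) j φ x a a' := by
  rw [mem_gradedFusionGroup_iff hδ hj hj₀δ hj₀]
  refine and_congr ⟨fun h u => ?_, fun h u => ?_⟩ (exists₂_congr fun a a' =>
    IsTwistedUnit.congr s fun u => ?_)
  · have h1 := h (s u)
    rw [MulAut.congr_apply] at h1
    simpa [hs] using h1
  · obtain ⟨u, rfl⟩ := s.surjective u
    rw [MulAut.congr_apply]
    simpa [hs] using h u
  · rw [MonoidHom.comp_apply, MonoidHom.comp_apply, Subgroup.subtype_apply, hs]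

/-- Converts the output of the realization theorem back into a twisted unit. -/
lemma exists_isTwistedUnit_of_conj
    (hδ : IsLocalPoint (groupUnits O G) (gradeComp O ω 1) Q δ) (hj : j ∈ δ)
    (s : H ≃* Q) (hs : ∀ u, (s u : G) = σ u) {φ : MulAut H} {x : Γ} {g : G} (hg : ω g = x)
    (hgσ : ∀ u, σ (φ u) * g = g * σ u)
    (hconj : FixedConj ((groupUnits O G).comp σ) (gradeComp O ω 1) ⊤ j
      (MonoidAlgebra.of O G g * j * MonoidAlgebra.of O G g⁻¹)) :
    ∃ a a', IsTwistedUnit ((groupUnits O G).comp σ) (gradeComp O ω) j φ x a a' := by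
  have hσ := range_eq_of_mulEquiv s hs
  have hφ : ∀ u : Q, ((MulAut.congr s φ u : Q) : G) = g * u * g⁻¹ := fun u => by
    obtain ⟨u, rfl⟩ := s.surjective u
    rw [MulAut.congr_apply, eq_mul_inv_iff_mul_eq, hs, ← hgσ]
    simp [hs]
  have hB₁ : ∀ a ∈ gradeComp O ω 1, ∀ c ∈ gradeComp O ω 1, a * c ∈ gradeComp O ω 1 :=
    fun a ha c hc => gradeComp_one_mul ha hc
  have hmem := hδ.1.mem_conjStabilizer hB₁ (fun g a ha => conj_mem_gradeComp_one g ha) hj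
    (mem_normalizer_of_conj_eq hφ) (by
      rw [groupUnits_val, groupUnits_inv_val]
      exact (fixedConj_comp hσ).1 hconj)
  obtain ⟨a, a', ha⟩ := exists_isTwistedUnit_of_mem_conjStabilizer hδ.1 hj hφ hmem
  rw [hg] at ha
  refine ⟨a, a', (IsTwistedUnit.congr s fun u => ?_).1 ha⟩
  rw [MonoidHom.comp_apply, MonoidHom.comp_apply, Subgroup.subtype_apply, hs]

lemma IsLocalPoint.isPrimitiveIdempotentIn_groupFixed
    (hδ : IsLocalPoint (groupUnits O G) (gradeComp O ω 1) Q δ) (hj : j ∈ δ)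
    (s : H ≃* Q) (hs : ∀ u, (s u : G) = σ u) : IsPrimitiveIdempotentIn (groupFixed O ω σ) j := by
  rw [groupFixed, fixedPts_comp (range_eq_of_mulEquiv s hs)]
  have hB₁ : ∀ a ∈ gradeComp O ω 1, ∀ c ∈ gradeComp O ω 1, a * c ∈ gradeComp O ω 1 :=
    fun a ha c hc => gradeComp_one_mul ha hc
  exact hδ.1.isPrimitiveIdempotentIn hB₁ hj

variable [Finite H]

lemma IsCornerEquiv.notMem_tensorBrauerKer
    (h : IsCornerEquiv ((groupUnits O G).comp σ) (gradeComp O ω) (tensorInterior (O := O) κ σ')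
      (tensorGradeComp O S ω') j e T ψ) (hj : IsPrimitiveIdempotentIn (groupFixed O ω σ) j)
    (hloc : j ∉ brauerKer ((groupUnits O G).comp σ) (gradeComp O ω 1) ⊤) :
    e ∉ tensorBrauerKer O ω' κ σ' :=
  h.notMem_brauerKer (fun u => groupFixed_comm hj.1 u) hj.2.1
    (fun u _ hc => conj_mem_tensorGradeComp_one κ σ' u hc) hloc

variable [IsNoetherianRing O] [IsAdicComplete (IsLocalRing.maximalIdeal O) O] [Module.Finite O S]
  [Finite G']

/-- Fusions at `j` are realized at `j'`, and they are fusions at `l`. -/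
lemma IsCornerEquiv.exists_conj
    (h : IsCornerEquiv ((groupUnits O G).comp σ) (gradeComp O ω) (tensorInterior (O := O) κ σ')
      (tensorGradeComp O S ω') j e T ψ) (hj : IsPrimitiveIdempotentIn (groupFixed O ω σ) j)
    (hloc : j ∉ brauerKer ((groupUnits O G).comp σ) (gradeComp O ω 1) ⊤)
    (hl : IsPrimitiveIdempotentIn (fixedPts (O := O) κ ⊤ ⊤) l)
    (hj' : IsPrimitiveIdempotentIn (groupFixed O ω' σ') j') (he : e ∈ corner O (l ⊗ₜ[O] j'))
    {a a' : MonoidAlgebra O G}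
    (ha : IsTwistedUnit ((groupUnits O G).comp σ) (gradeComp O ω) j φ x a a') :
    ∃ g : G', ω' g = x ∧ (∀ u, σ' (φ u) * g = g * σ' u) ∧
      FixedConj ((groupUnits O G').comp σ') (gradeComp O ω' 1) ⊤ j'
        (MonoidAlgebra.of O G' g * j' * MonoidAlgebra.of O G' g⁻¹) ∧
      ∃ s : Sˣ, ∀ u, (s : S) * (κ u * l) * (s⁻¹ : Sˣ) = κ (φ u) * l :=
  exists_realization_of_isTwistedUnit hl hj' h.idem (h.mem_tensorFixed hj.1)
    (h.notMem_tensorBrauerKer hj hloc) he.1 he.2 (h.isTwistedUnit ha)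

variable [Finite G]

/-- Fusions at `j'` are realized at `j`, if `S` has an `H`-stable basis. -/
lemma IsCornerEquiv.exists_conj'
    (h : IsCornerEquiv ((groupUnits O G).comp σ) (gradeComp O ω) (tensorInterior (O := O) κ σ')
      (tensorGradeComp O S ω') j e T ψ) (hj : IsPrimitiveIdempotentIn (groupFixed O ω σ) j)
    (hloc : j ∉ brauerKer ((groupUnits O G).comp σ) (gradeComp O ω 1) ⊤)
    (hl : IsPrimitiveIdempotentIn (fixedPts (O := O) κ ⊤ ⊤) l)
    (hj' : IsPrimitiveIdempotentIn (groupFixed O ω' σ') j')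
    (hloc' : j' ∉ brauerKer ((groupUnits O G').comp σ') (gradeComp O ω' 1) ⊤)
    (he : e ∈ corner O (l ⊗ₜ[O] j')) [Fintype ι] [Fintype ι'] {τ : S →ₗ[O] O} {E F : ι' → S}
    (hEF : IsTracePair τ E F) (X : Module.Basis ι O S) {act : H →* Equiv.Perm ι}
    (hX : ∀ u k, X (act u k) = κ u * X k * ((κ u)⁻¹ : Sˣ)) {a a' : MonoidAlgebra O G'}
    (ha : IsTwistedUnit ((groupUnits O G').comp σ') (gradeComp O ω') j' φ x a a') :
    ∃ g : G, ω g = x ∧ (∀ u, σ (φ u) * g = g * σ u) ∧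
      FixedConj ((groupUnits O G).comp σ) (gradeComp O ω 1) ⊤ j
        (MonoidAlgebra.of O G g * j * MonoidAlgebra.of O G g⁻¹) := by
  -- The trace form is re-expressed in the stable basis, so that both dual families are permuted by
  -- `H`.
  obtain ⟨D, hD, hcoord⟩ := hEF.exists_of_basis X
  have hDact := fun u k => hD.dual_equivariant hcoord (κ u) (act u) (hX u) k
  obtain ⟨JS, hJS⟩ := exists_isRadicalAt
    (fun a ha c hc => fixedPts_mul_mem (fun _ _ _ _ => Submodule.mem_top) ha hc) hl
  have hB₁ : ∀ a ∈ gradeComp O ω' 1, ∀ c ∈ gradeComp O ω' 1, a * c ∈ gradeComp O ω' 1 :=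
    fun a ha c hc => gradeComp_one_mul ha hc
  obtain ⟨J, hJ⟩ := exists_isRadicalAt (fun a ha c hc => fixedPts_mul_mem hB₁ ha hc) hj'
  have heF := h.mem_tensorFixed hj.1
  obtain ⟨s, hs, r, hr, hls, -, -, -, htr⟩ := exists_trace_eq hD hX hDact hl.1 hl.2.1 hj'.1 hj'.2.1
    hJS hJ h.idem heF (h.notMem_tensorBrauerKer hj hloc) he.1 he.2
  have hsetup : IsDualSetup ω ω' κ σ σ' τ X D l j j' e T ψ (s ⊗ₜ[O] r) :=
    { pair := hD
      equiv := h
      fixed := hj.1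
      fixed' := hj'.1
      idem' := hj'.2.1
      below := he.1
      mem := tmul_mem_tensorFixed hs hr
      mul_mem := by rw [Algebra.TensorProduct.tmul_mul_tmul, hls, one_mul]
      trace := htr }
  exact hsetup.exists_conj hl hj he.2 hloc' ha

/-- The equality of the groups of fusions at two points whose corners are equivalent. -/
lemma IsCornerEquiv.mem_gradedFusionGroup_iff
    (h : IsCornerEquiv ((groupUnits O G).comp σ) (gradeComp O ω) (tensorInterior (O := O) κ σ')
      (tensorGradeComp O S ω') j e T ψ) {Q' : Subgroup G'} {δ' : Set (MonoidAlgebra O G')}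
    {i' j₀' : MonoidAlgebra O G'}
    (hδ : IsLocalPoint (groupUnits O G) (gradeComp O ω 1) Q δ) (hj : j ∈ δ) (hj₀δ : j₀ ∈ δ)
    (hj₀ : j₀ ∈ corner O i) (s : H ≃* Q) (hs : ∀ u, (s u : G) = σ u)
    (hδ' : IsLocalPoint (groupUnits O G') (gradeComp O ω' 1) Q' δ') (hj' : j' ∈ δ') (hj₀δ' : j₀' ∈ δ')
    (hj₀' : j₀' ∈ corner O i') (s' : H ≃* Q') (hs' : ∀ u, (s' u : G') = σ' u)
    (hl : IsPrimitiveIdempotentIn (fixedPts (O := O) κ ⊤ ⊤) l) (he : e ∈ corner O (l ⊗ₜ[O] j'))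
    [Fintype ι] [Fintype ι'] {τ : S →ₗ[O] O} {E F : ι' → S}
    (hEF : IsTracePair τ E F) (X : Module.Basis ι O S) {act : H →* Equiv.Perm ι}
    (hX : ∀ u k, X (act u k) = κ u * X k * ((κ u)⁻¹ : Sˣ)) (hω : ∀ u, ω (σ u) = ω' (σ' u)) :
    ((MulAut.congr s φ, x) ∈
        gradedFusionGroup ω (groupUnits O G) (gradeComp O ω) Q i j (hδ.1.commute hj) →
      ∃ r : Sˣ, ∀ u, (r : S) * (κ u * l) * (r⁻¹ : Sˣ) = κ (φ u) * l) ∧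
    ((MulAut.congr s φ, x) ∈
        gradedFusionGroup ω (groupUnits O G) (gradeComp O ω) Q i j (hδ.1.commute hj) ↔
      (MulAut.congr s' φ, x) ∈
        gradedFusionGroup ω' (groupUnits O G') (gradeComp O ω') Q' i' j' (hδ'.1.commute hj')) := by
  have hjF : IsPrimitiveIdempotentIn (groupFixed O ω σ) j :=
    hδ.isPrimitiveIdempotentIn_groupFixed hj s hs
  have hjF' : IsPrimitiveIdempotentIn (groupFixed O ω' σ') j' :=
    hδ'.isPrimitiveIdempotentIn_groupFixed hj' s' hs'
  have hloc : j ∉ brauerKer ((groupUnits O G).comp σ) (gradeComp O ω 1) ⊤ := fun h =>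
    hδ.2 j hj (brauerKer_comp_le s hs (fun g a ha => conj_mem_gradeComp_one g ha) h)
  have hloc' : j' ∉ brauerKer ((groupUnits O G').comp σ') (gradeComp O ω' 1) ⊤ := fun h =>
    hδ'.2 j' hj' (brauerKer_comp_le s' hs' (fun g a ha => conj_mem_gradeComp_one g ha) h)
  rw [mem_gradedFusionGroup_congr_iff hδ hj hj₀δ hj₀ s hs,
    mem_gradedFusionGroup_congr_iff hδ' hj' hj₀δ' hj₀' s' hs']
  refine ⟨?_, and_congr (forall_congr' fun u => by rw [hω, hω]) ⟨?_, ?_⟩⟩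
  · rintro ⟨-, a, a', ha⟩
    obtain ⟨-, -, -, -, hfus⟩ := h.exists_conj hjF hloc hl hjF' he ha
    exact hfus
  · rintro ⟨a, a', ha⟩
    obtain ⟨g, hg, hgσ, hconj, -⟩ := h.exists_conj hjF hloc hl hjF' he ha
    exact exists_isTwistedUnit_of_conj hδ' hj' s' hs' hg hgσ hconj
  · rintro ⟨a, a', ha⟩
    obtain ⟨g, hg, hgσ, hconj⟩ := h.exists_conj' hjF hloc hl hjF' hloc' he hEF X hX ha
    exact exists_isTwistedUnit_of_conj hδ hj s hs hg hgσ hconj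

end Transport
end

/-! ### Corner embeddings from corresponding points -/

noncomputable section

section CornerEmbedding

variable {O B C G P : Type*} [CommRing O] [Ring B] [Algebra O B] [Ring C] [Algebra O C] [Group G]
  [Group P]

lemma fixedConj_comp_map {θ : G →* Bˣ} {B₁ : Submodule O B} {σ : P →* G} {K : Subgroup P} {a c : B} :
    FixedConj (θ.comp σ) B₁ K a c ↔ FixedConj θ B₁ (K.map σ) a c := by
  have h : fixedPts (θ.comp σ) B₁ K = fixedPts θ B₁ (K.map σ) := by
    ext a
    refine and_congr_right fun _ => ⟨?_, fun h u hu => h _ ⟨u, hu, rfl⟩⟩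
    rintro h _ ⟨u, hu, rfl⟩
    exact h u hu
  rw [FixedConj, FixedConj, h]

lemma conj_mem_corner (w : Bˣ) {a d : B} (h : a ∈ corner O d) :
    w * a * (w⁻¹ : Bˣ) ∈ corner O (w * d * (w⁻¹ : Bˣ)) := by
  have key : ∀ a c : B, w * a * (w⁻¹ : Bˣ) * (w * c * (w⁻¹ : Bˣ)) = w * (a * c) * (w⁻¹ : Bˣ) :=
    fun a c => by simp [mul_assoc]
  exact ⟨by rw [key, h.1], by rw [key, h.2]⟩

variable {G' Γ W : Type*} [Group G'] [Group Γ] [AddCommGroup W] [Module O W] {ω : G →* Γ}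
  {ω' : G' →* Γ}

/-- Conjugate idempotents `l₁`, `l` and `j₁`, `j` have conjugate tensor products, and the conjugating unit
moves the idempotents below them. -/
lemma exists_fixedConj_tmul {Pd : Subgroup (diagGroup ω ω')} {κ : Representation O Pd W}
    {K : Subgroup Pd} {l₁ l : Module.End O W} {j₁ j : MonoidAlgebra O G'}
    (hl : FixedConj (O := O) κ.toHomUnits ⊤ K l₁ l)
    (hj : FixedConj (groupUnits O G') (gradeComp O ω' 1) (K.map (sigmaR Pd)) j₁ j)
    {e₁ : Module.End O W ⊗[O] MonoidAlgebra O G'} (he₁ : e₁ ∈ corner O (l₁ ⊗ₜ[O] j₁)) :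
    ∃ e ∈ corner O (l ⊗ₜ[O] j), FixedConj (tensorUnits κ) (tensorGrade O W ω' 1) K e₁ e := by
  obtain ⟨s, hs, hs', rfl⟩ := hl
  obtain ⟨v, hv, hv', rfl⟩ := hj
  let w : (Module.End O W ⊗[O] MonoidAlgebra O G')ˣ :=
    { val := s.val ⊗ₜ[O] v.val
      inv := s⁻¹.val ⊗ₜ[O] v⁻¹.val
      val_inv := by
        rw [Algebra.TensorProduct.tmul_mul_tmul, Units.mul_inv, Units.mul_inv,
          Algebra.TensorProduct.one_def]
      inv_val := by
        rw [Algebra.TensorProduct.tmul_mul_tmul, Units.inv_mul, Units.inv_mul,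
          Algebra.TensorProduct.one_def] }
  have hmem : ∀ a ∈ fixedPts (O := O) κ.toHomUnits ⊤ K,
      ∀ c ∈ fixedPts (groupUnits O G') (gradeComp O ω' 1) (K.map (sigmaR Pd)),
      a ⊗ₜ[O] c ∈ fixedPts (tensorUnits κ) (tensorGrade O W ω' 1) K := by
    refine fun a ha c hc => ⟨tmul_mem_tensorGradeComp a hc.1, fun u hu => ?_⟩
    have h1 := ha.2 u hu
    have h2 := hc.2 (sigmaR Pd u) ⟨u, hu, rfl⟩
    change (κ u ⊗ₜ[O] MonoidAlgebra.of O G' (sigmaR Pd u)) * a ⊗ₜ[O] c =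
      a ⊗ₜ[O] c * (κ u ⊗ₜ[O] MonoidAlgebra.of O G' (sigmaR Pd u))
    rw [Algebra.TensorProduct.tmul_mul_tmul, Algebra.TensorProduct.tmul_mul_tmul]
    exact congrArg₂ (· ⊗ₜ[O] ·) h1 h2
  have hw : (s * l₁ * s⁻¹.val) ⊗ₜ[O] (v * j₁ * v⁻¹.val) =
      (w : Module.End O W ⊗[O] MonoidAlgebra O G') * l₁ ⊗ₜ[O] j₁ * (w⁻¹).val := by
    change _ = s.val ⊗ₜ[O] v.val * l₁ ⊗ₜ[O] j₁ * s⁻¹.val ⊗ₜ[O] v⁻¹.val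
    rw [Algebra.TensorProduct.tmul_mul_tmul, Algebra.TensorProduct.tmul_mul_tmul]
  refine ⟨w * e₁ * (w⁻¹).val, ?_, w, hmem _ hs _ hv, hmem _ hs' _ hv', rfl⟩
  rw [hw]
  exact conj_mem_corner w he₁

lemma tensorUnits_comp_subtype {Pd : Subgroup (diagGroup ω ω')} (κ : Representation O Pd W)
    (K : Subgroup Pd) : (tensorUnits (O := O) (G' := G') κ).comp K.subtype =
      tensorInterior (O := O) (κ.toHomUnits.comp K.subtype) ((sigmaR Pd).comp K.subtype) :=
  MonoidHom.ext fun _ => Units.ext rfl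

/-- Corresponding points give an embedding of the corner at `j` into the corner at `l ⊗ j'`. -/
lemma exists_isGradedEmbedding_of_pointsCorrespond {Pd : Subgroup (diagGroup ω ω')}
    {κ : Representation O Pd W} {K : Subgroup Pd} {Q : Subgroup G} {Q' : Subgroup G'}
    {i j : MonoidAlgebra O G} {i' j' : MonoidAlgebra O G'} {l : Module.End O W}
    {f : corner O i →ₙₐ[O] corner O ((1 : Module.End O W) ⊗ₜ[O] i')}
    (hf : IsGradedEmbedding ((groupUnits O G).comp (sigmaL Pd)) (gradeComp O ω)
      (tensorUnits κ) (tensorGrade O W ω') ⊤ i ((1 : Module.End O W) ⊗ₜ[O] i') f)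
    {δ : Set (MonoidAlgebra O G)} {δ' : Set (MonoidAlgebra O G')} {δd : Set (Module.End O W)}
    (hcorr : PointsCorrespond κ f K δ δd δ') (hii : i * i = i)
    (hQ : K.map (sigmaL Pd) = Q) (hQ' : K.map (sigmaR Pd) = Q')
    (hδ : IsPoint (groupUnits O G) (gradeComp O ω 1) Q δ) (hj : j ∈ δ)
    (hδ' : IsPoint (groupUnits O G') (gradeComp O ω' 1) Q' δ') (hj' : j' ∈ δ')
    (hδd : IsPoint (O := O) κ.toHomUnits ⊤ K δd) (hl : l ∈ δd) :
    ∃ e ∈ corner O (l ⊗ₜ[O] j'), ∃ t : corner O j →ₙₐ[O] corner O (l ⊗ₜ[O] j'),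
      IsGradedEmbedding ((groupUnits O G).comp (sigmaL Pd)) (gradeComp O ω)
        (tensorUnits κ) (tensorGrade O W ω') K j (l ⊗ₜ[O] j') t ∧
      ∀ J : corner O j, (J : MonoidAlgebra O G) = j →
        (t J : Module.End O W ⊗[O] MonoidAlgebra O G') = e := by
  obtain ⟨J₁, hJ₁, l₁, hl₁, j₁', hj₁', -, e₁, he₁, hconj₁⟩ := hcorr
  subst hQ hQ'
  have hG₁ : ∀ a ∈ gradeComp O ω 1, ∀ c ∈ gradeComp O ω 1, a * c ∈ gradeComp O ω 1 :=
    fun a ha c hc => gradeComp_one_mul ha hc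
  have hG₁' : ∀ a ∈ gradeComp O ω' 1, ∀ c ∈ gradeComp O ω' 1, a * c ∈ gradeComp O ω' 1 :=
    fun a ha c hc => gradeComp_one_mul ha hc
  have hl' : FixedConj (O := O) κ.toHomUnits ⊤ K l₁ l :=
    hδd.fixedConj (fun _ _ _ _ => Submodule.mem_top) hl₁ hl
  obtain ⟨e, he, hconj₂⟩ := exists_fixedConj_tmul hl' (hδ'.fixedConj hG₁' hj₁' hj') he₁
  have hT₁ : ∀ a ∈ tensorGrade O W ω' 1, ∀ c ∈ tensorGrade O W ω' 1, a * c ∈ tensorGrade O W ω' 1 :=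
    fun a ha c hc => tensorGradeComp_one_mul ha hc
  have hconj : FixedConj (tensorUnits κ) (tensorGrade O W ω' 1) K
      (f J₁ : Module.End O W ⊗[O] MonoidAlgebra O G') e :=
    FixedConj.trans hT₁ hconj₁ hconj₂
  obtain ⟨t, ht, hte⟩ := exists_isGradedEmbedding (𝓑 := gradeComp O ω) (𝓒 := tensorGrade O W ω') hf
    (fun ha hc => gradeComp_mul ha hc) (fun ha hc => tensorGradeComp_mul ha hc) hii J₁ rfl
    (hδ.isPrimitiveIdempotentIn hG₁ hJ₁).2.1
    (fixedConj_comp_map.2 (hδ.fixedConj hG₁ hJ₁ hj)) he hconj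
  exact ⟨e, he, t, ht, hte⟩

/-- An embedding is only assumed to preserve degrees; that its inverse does so too is the reflection
of degrees, which uses finiteness. -/
lemma exists_isCornerEquiv_of_isGradedEmbedding [Finite Γ] [Finite G] [Finite G']
    {Pd : Subgroup (diagGroup ω ω')} {κ : Representation O Pd W} {K : Subgroup Pd}
    {j : MonoidAlgebra O G} {c e : Module.End O W ⊗[O] MonoidAlgebra O G'}
    {t : corner O j →ₙₐ[O] corner O c}
    (ht : IsGradedEmbedding ((groupUnits O G).comp (sigmaL Pd)) (gradeComp O ω)
      (tensorUnits κ) (tensorGrade O W ω') K j c t)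
    (hj : j ∈ fixedPts (groupUnits O G) (gradeComp O ω 1) (K.map (sigmaL Pd))) (hjj : j * j = j)
    (hte : ∀ J : corner O j, (J : MonoidAlgebra O G) = j →
      (t J : Module.End O W ⊗[O] MonoidAlgebra O G') = e) :
    ∃ T ψ, IsCornerEquiv ((groupUnits O G).comp ((sigmaL Pd).comp K.subtype)) (gradeComp O ω)
      (tensorInterior (O := O) (κ.toHomUnits.comp K.subtype) ((sigmaR Pd).comp K.subtype))
      (tensorGradeComp O (Module.End O W) ω') j e T ψ := by
  let t' : corner O j → Module.End O W ⊗[O] MonoidAlgebra O G' := fun a => t a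
  have hrefl : ∀ x, ∀ a : corner O j,
      (t a : Module.End O W ⊗[O] MonoidAlgebra O G') ∈ tensorGrade O W ω' x →
        (a : MonoidAlgebra O G) ∈ gradeComp O ω x := fun x a ha =>
    mem_gradeComp_of_map_mem hj.1 hjj t' (Subtype.val_injective.comp ht.injective)
      (congrArg Subtype.val (map_zero t)) (fun a b => congrArg Subtype.val (map_add t a b)) ht.graded ha
  have key := exists_isCornerEquiv (𝓑 := gradeComp O ω) (𝓒 := tensorGrade O W ω') ht
    (fun ha hc => gradeComp_mul ha hc) (fun ha hc => tensorGradeComp_mul ha hc) hrefl hj.1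
    (fun u hu => hj.2 _ ⟨u, hu, rfl⟩) ⟨j, hjj, hjj⟩ rfl
  rw [hte _ rfl, tensorUnits_comp_subtype] at key
  exact key

end CornerEmbedding

end

/-! ### The theorem -/

theorem mainTheorem8
    -- `O` is a complete discrete valuation ring of characteristic `0`, with residue characteristic `p`.
    {O : Type*} [CommRing O] [IsDomain O] [IsDiscreteValuationRing O] [CharZero O]
    [IsAdicComplete (IsLocalRing.maximalIdeal O) O]
    (p : ℕ) [Fact p.Prime] [CharP (IsLocalRing.ResidueField O) p]
    {G G' Γ : Type*} [Group G] [Group G'] [Group Γ] [Finite G] [Finite G']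
    (ω : G →* Γ) (ω' : G' →* Γ) (hω : Function.Surjective ω) (hω' : Function.Surjective ω')
    (b : MonoidAlgebra O ω.ker) (b' : MonoidAlgebra O ω'.ker)
    (hb : IsInvariantBlock ω b) (hb' : IsInvariantBlock ω' b')
    -- The `O G̈`-module `M`, its vertex `P̈` and its source `N̈`, with `S = End_O(N̈)`.
    {M Nd : Type*} [AddCommGroup M] [Module O M] [AddCommGroup Nd] [Module O Nd]
    (ρ : Representation O (diagGroup ω ω') M) (hM : IsDiagonalModule b b' ρ)
    (Pd : Subgroup (diagGroup ω ω')) (κ : Representation O Pd Nd) (hPd : IsVertexSource ρ Pd κ)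
    (hbasic : IsBasicGradedMorita b b' ρ Pd κ)
    -- `P_γ` on `A_1 = O N b` and `P'_γ'` on `A'_1 = O N' b'`, with `i ∈ γ` and `i' ∈ γ'`.
    (γ : Set (MonoidAlgebra O G)) (γ' : Set (MonoidAlgebra O G'))
    (hγ : IsLocalPoint (groupUnits O G) (gradeComp O ω 1) (sigmaL Pd).range γ)
    (hγ' : IsLocalPoint (groupUnits O G') (gradeComp O ω' 1) (sigmaR Pd).range γ')
    (hγb : ∀ a ∈ γ, a * kerInclusion O ω b = a) (hγb' : ∀ a ∈ γ', a * kerInclusion O ω' b' = a)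
    (i : MonoidAlgebra O G) (hi : i ∈ γ) (i' : MonoidAlgebra O G') (hi' : i' ∈ γ')
    -- The embedding `A_γ → S ⊗ A'_γ'` of `Γ`-graded `P̈`-interior algebras.
    (f : corner O i →ₙₐ[O] corner O ((1 : Module.End O Nd) ⊗ₜ[O] i'))
    (hf : IsGradedEmbedding ((groupUnits O G).comp (sigmaL Pd)) (gradeComp O ω)
      (tensorUnits κ) (tensorGrade O Nd ω') ⊤ i ((1 : Module.End O Nd) ⊗ₜ[O] i') f)
    -- The subgroups `Q ≤ P`, `Q̈ = σ⁻¹(Q)`, `Q' = σ'(Q̈)`.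
    (Q : Subgroup G) (hQ : Q ≤ (sigmaL Pd).range)
    (Qd : Subgroup Pd) (hQd : Qd = Q.comap (sigmaL Pd))
    (Q' : Subgroup G') (hQ' : Q' = Qd.map (sigmaR Pd))
    -- The corresponding local points `δ` and `δ'`, and the local point `δ̈` of `Q̈` on `S`.
    (δ : Set (MonoidAlgebra O G)) (δ' : Set (MonoidAlgebra O G')) (δd : Set (Module.End O Nd))
    (hδ : IsLocalPoint (groupUnits O G) (gradeComp O ω 1) Q δ)
    (hδ' : IsLocalPoint (groupUnits O G') (gradeComp O ω' 1) Q' δ')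
    (hδd : IsLocalPoint (O := O) κ.toHomUnits ⊤ Qd δd)
    (hcorr : PointsCorrespond κ f Qd δ δd δ')
    (j : MonoidAlgebra O G) (hj : j ∈ δ) (j' : MonoidAlgebra O G') (hj' : j' ∈ δ')
    (l : Module.End O Nd) (hl : l ∈ δd) :
    -- `N_G^K(Q_δ) / C_N(Q)` is isomorphic to the group of `(G, Γ)`-fusions.
    (centralizerInKer ω Q ≤ gradedPointNormalizer ω (groupUnits O G) Q δ ∧
      ∃ e : (gradedPointNormalizer ω (groupUnits O G) Q δ ⧸
              (centralizerInKer ω Q).subgroupOf (gradedPointNormalizer ω (groupUnits O G) Q δ)) ≃*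
            gradedFusionGroup ω (groupUnits O G) (gradeComp O ω) Q i j (hδ.1.commute hj),
        ∀ g : gradedPointNormalizer ω (groupUnits O G) Q δ,
          (∀ u : Q, (((e g).1.1 u : Q) : G) = g * u * (g : G)⁻¹) ∧ (e g).1.2 = ω g) ∧
    -- The embedding `A_δ → S_δ̈ ⊗ A'_δ'` of `Γ`-graded `Q̈`-interior algebras.
    (∃ t : corner O j →ₙₐ[O] corner O (l ⊗ₜ[O] j'),
      IsGradedEmbedding ((groupUnits O G).comp (sigmaL Pd)) (gradeComp O ω)
        (tensorUnits κ) (tensorGrade O Nd ω') Qd j (l ⊗ₜ[O] j') t) ∧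
    -- `σ` and `σ'` identify `Q̈` with `Q` and `Q'`, and under this identification the fusions of `Q_δ`
    -- are fusions of `Q̈_δ̈` in `S` and coincide with the fusions of `Q'_δ'`.
    ∃ (s : Qd ≃* Q) (s' : Qd ≃* Q'),
      (∀ u : Qd, (s u : G) = sigmaL Pd u) ∧ (∀ u : Qd, (s' u : G') = sigmaR Pd u) ∧
      (∀ (φ : MulAut Qd) (x : Γ),
        (MulAut.congr s φ, x) ∈
            gradedFusionGroup ω (groupUnits O G) (gradeComp O ω) Q i j (hδ.1.commute hj) →
          φ ∈ fusionGroup κ.toHomUnits Qd l) ∧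
      ∀ (φ : MulAut Qd) (x : Γ),
        (MulAut.congr s φ, x) ∈
            gradedFusionGroup ω (groupUnits O G) (gradeComp O ω) Q i j (hδ.1.commute hj) ↔
          (MulAut.congr s' φ, x) ∈
            gradedFusionGroup ω' (groupUnits O G') (gradeComp O ω') Q' i' j' (hδ'.1.commute hj') := by 
  have hfin := hM.finite_source hPd
  have hfree := hM.free_source hPd
  have hΓ : Finite Γ := Finite.of_surjective ω hω
  have hG₁ : ∀ a ∈ gradeComp O ω 1, ∀ c ∈ gradeComp O ω 1, a * c ∈ gradeComp O ω 1 :=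
    fun a ha c hc => gradeComp_one_mul ha hc
  have hQmap : Qd.map (sigmaL Pd) = Q := by rw [hQd, Subgroup.map_comap_eq_self hQ]
  have hprim := hδ.1.isPrimitiveIdempotentIn hG₁ hj
  obtain ⟨e, he, t, ht, hte⟩ := exists_isGradedEmbedding_of_pointsCorrespond hf hcorr
    (hγ.1.isPrimitiveIdempotentIn hG₁ hi).2.1 hQmap hQ'.symm hδ.1 hj hδ'.1 hj' hδd.1 hl
  obtain ⟨T, ψ, hT⟩ := exists_isCornerEquiv_of_isGradedEmbedding ht
    (by rw [hQmap]; exact hprim.1) hprim.2.1 hte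
  -- The correspondence also supplies the representatives of `δ` and `δ'` inside the corners of `i`
  -- and `i'`, by which fusions become twisted units.
  obtain ⟨J₁, hJ₁, -, -, j₁', hj₁', hj₁'i, -⟩ := hcorr
  refine ⟨⟨centralizerInKer_le hδ.1, exists_normalizer_quotient_equiv hδ hj hJ₁ J₁.2⟩, ⟨t, ht⟩, ?_⟩
  let s : Qd ≃* Q := (Qd.equivMapOfInjective _ (hbasic.sigmaL_injective p hM hPd)).trans
    (MulEquiv.subgroupCongr hQmap)
  let s' : Qd ≃* Q' := (Qd.equivMapOfInjective _ (hbasic.sigmaR_injective p hM hPd)).trans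
    (MulEquiv.subgroupCongr hQ'.symm)
  have hlF : IsPrimitiveIdempotentIn (fixedPts (O := O) (κ.toHomUnits.comp Qd.subtype) ⊤ ⊤) l := by
    rw [fixedPts_comp Qd.range_subtype]
    exact hδd.1.isPrimitiveIdempotentIn (fun _ _ _ _ => Submodule.mem_top) hl
  -- Two bases of `S` play different roles: the stable one from the Dade property for Brauer
  -- arguments, and matrix units to establish the properties of the trace form.
  obtain ⟨X, _, E, act, hact⟩ := hbasic.dade.exists_basis
  obtain ⟨n, E₀, F₀, hEF⟩ := exists_isTracePair_trace (O := O) Nd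
  have key := fun (φ : MulAut Qd) (x : Γ) => hT.mem_gradedFusionGroup_iff (φ := φ) (x := x) hδ hj hJ₁ J₁.2 s
    (fun _ => rfl) hδ' hj' hj₁' hj₁'i s' (fun _ => rfl) hlF he hEF E (act := act.comp Qd.subtype)
    (fun u k => hact u k) (fun u => (u : Pd).1.2)
  exact ⟨s, s', fun _ => rfl, fun _ => rfl, fun φ x => (key φ x).1, fun φ x => (key φ x).2⟩
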